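/- **Setting.** Let $F:\mathbb R^d\to\mathbb R$, $F(x)=\mathbb E_{\xi\sim\mathcal D}f(x;\xi)$, be differentiable and $L$-smooth, $\|\nabla F(x)-\nabla F(y)\|\le L\|x-y\|$ with $L>0$ (Euclidean norm), and let $F$ have a minimizer $x^*$; put $F^*=F(x^*)$. Let $\nabla f(x;\xi)$ be stochastic gradients, i.e. jointly measurable with $\mathbb E_{\xi\sim\mathcal D}\nabla f(x;\xi)=\nabla F(x)$, of variance $\mathbb E_{\xi\sim\mathcal D}\|\nabla f(x;\xi)-\nabla F(x)\|^2\le\sigma^2$ for every $x$, where $\sigma\ge 0$. (Gradients need not be bounded.) **Algorithm (Asynchronous SGD).** There are $M$ workers. All of them start by computing a stochastic gradient at the (possibly random) initial point $x_0$. At each iteration $k=1,2,\dots$ the gradient of one worker $m_k\in[M]$ arrives and $$x_k=x_{k-1}-\gamma_k\nabla f\bigl(x_{\mathrm{prev}(k,m_k)};\xi_{\mathrm{prev}(k,m_k)}^{m_k}\bigr),$$ after which worker $m_k$ starts computing a stochastic gradient at $x_k$. Here $\xi_k^m\sim\mathcal D$ are i.i.d., $\mathrm{prev}(k,m)=\max\{1\le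 j<k: m_j=m\}$ ($0$ if there is no such $j$), $\mathrm{next}(k,m)=\min\{j\ge k: m_j=m\}$ ($\infty$ if there is none). The delays are $\tau(k,m)=k-\mathrm{prev}(k,m)$ and $\tau(k)=\tau(k,m_k)$. Assume that the samples $(\xi_k^m)$ are independent of the pair formed by $x_0$ and the delays $(\tau(k,m))_{k,m}$. The stepsize $\gamma_k=\gamma(\tau(k))$ is a function of the delay, given below for each case. For a number of iterations $K$ and $1\le k\le K$, let $\hat\gamma_k=\gamma(\hat\tau_k)$ with $\hat\tau_k=\max\{1,\min\{\mathrm{next}(k+1,m_k),K\}-k\}$; this is the stepsize with which the gradient computed at $x_k$ is eventually applied, the iteration counter being frozen at $K$. A term below with $\sigma$ in the denominator is understood to be $+\infty$ inside a minimum if $\sigma=0$, and $\sigma^2\log(e+a/\sigma^2)$ is understood as $0$ if $\sigma=0$. **Theorem.** There are positive numerical constants $c_1,c_2,c_3,c_4$ such that, always in this setting, the following hold. 1. If $F$ is convex, $K\ge M$, $B>0$, $\mathbb E\|x_0-x^*\|^2\le B^2$ and $\gamma(\tau)=\min\bigl\{\frac1{4L\tau},\frac1{4ML},\frac{B}{\sigma\sqrt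 K}\bigr\}$, then $\tilde x_K=\frac{\sum_{k=1}^K\hat\gamma_kx_k}{\sum_{k=1}^K\hat\gamma_k}$ satisfies $$\mathbb E[F(\tilde x_K)-F^*]\le c_1\Bigl(\frac{MLB^2}{K}+\frac{\sigma B}{\sqrt K}\Bigr).$$ 2. If $F$ is $\mu$-strongly convex with $\mu>0$, $K\ge 3M$, $B\ge 0$, $\mathbb E\|x_0-x^*\|^2\le B^2$ and $\gamma(\tau)=\min\Bigl\{\frac{\exp(-\mu\tau/(4ML))}{4L\tau},\frac1{8ML},\frac{504\ln(e+\mu^2K^2B^2/\sigma^2)}{\mu K}\Bigr\}$, then $\tilde x_K=\frac{\sum_{k=1}^K\hat\gamma_k\hat P_kx_k}{\sum_{k=1}^K\hat\gamma_k\hat P_k}$ with $\hat P_k=\exp\bigl(\mu\sum_{j=1}^k\hat\gamma_j\bigr)$ satisfies $$\mathbb E[F(\tilde x_K)-F^*]\le c_2\Bigl(MLB^2\exp\Bigl(-\frac{c_3K\mu}{ML}\Bigr)+\frac{\sigma^2}{\mu K}\log\Bigl(e+\frac{\mu^2K^2B^2}{\sigma^2}\Bigr)\Bigr).$$ 3.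 For general (possibly non-convex) $F$, if $K\ge M$, $\Delta>0$, $\mathbb EF(x_0)-F^*\le\Delta$ and $\gamma(\tau)=\min\Bigl\{\frac1{4L\tau},\frac1{2ML},\sqrt{\frac{\Delta}{KL\sigma^2}}\Bigr\}$, and if $\tilde x_K$ is a random element of $x_1,\dots,x_K$ which, given the whole run (initial point, arrival schedule, samples), is $x_k$ with probability $\hat\gamma_k/\sum_{j=1}^K\hat\gamma_j$, then $$\mathbb E\|\nabla F(\tilde x_K)\|^2\le c_4\Bigl(\frac{ML\Delta}{K}+\sqrt{\frac{L\Delta\sigma^2}{K}}\Bigr).$$ -/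

import Mathlib

open MeasureTheory ProbabilityTheory

namespace AsyncSGD

/-- `prev s k m`: the last iteration `j` with `1 ≤ j < k` at which worker `m` delivered a gradient
under the arrival schedule `s` (`s j` is the worker whose gradient is used at iteration `j ≥ 1`).
It is `0` if there is none: every worker starts at the initial point. The value `s 0` is unused. -/
def prev {M : ℕ} (s : ℕ → Fin M) (k : ℕ) (m : Fin M) : ℕ :=
  ((Finset.range k).filter (fun j => 1 ≤ j ∧ s j = m)).sup id

theorem prev_lt {M : ℕ} (s : ℕ → Fin M) {k : ℕ} (hk : 0 < k) (m : Fin M) : prev s k m < k := by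
  unfold prev
  refine (Finset.sup_lt_iff (show (⊥ : ℕ) < k from hk)).2 ?_
  intro j hj
  exact Finset.mem_range.1 (Finset.mem_filter.1 hj).1

/-- `next s k m`: the first iteration `j ≥ k` at which worker `m` delivers a gradient
(`⊤` if it never does). -/
noncomputable def next {M : ℕ} (s : ℕ → Fin M) (k : ℕ) (m : Fin M) : ℕ∞ :=
  ⨅ j ∈ {j : ℕ | k ≤ j ∧ s j = m}, (j : ℕ∞)

/-- The delay `τ(k, m) = k - prev(k, m)` of the gradient that worker `m` holds at iteration `k`. -/
def delay {M : ℕ} (s : ℕ → Fin M) (k : ℕ) (m : Fin M) : ℕ := k - prev s k m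

/-- The delay with which the gradient at the iterate `x_k` (computed by worker `s k`) is applied,
the iteration counter being frozen at `K`: `max {1, min {next(k + 1, m_k), K} - k}`. -/
noncomputable def returnDelay {M : ℕ} (s : ℕ → Fin M) (K k : ℕ) : ℕ :=
  max 1 ((min (next s (k + 1) (s k)) (K : ℕ∞)).toNat - k)

/-- Asynchronous SGD. At iteration `k ≥ 1` the gradient of worker `m = s k` arrives; it was computed
at the point `x_{prev(k, m)}` with the sample `ξ_{prev(k, m)}^m`, and
`x_k = x_{k-1} - γ(τ(k)) • g(x_{prev(k, m)}, ξ_{prev(k, m)}^m)`, with `τ(k) = τ(k, s k)`. -/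
noncomputable def iterate {M : ℕ} {E Ξ : Type*} [AddCommGroup E] [Module ℝ E]
    (g : E → Ξ → E) (γ : ℕ → ℝ) (x₀ : E) (s : ℕ → Fin M) (ξ : ℕ → Fin M → Ξ) : ℕ → E
  | 0 => x₀
  | k + 1 =>
    iterate g γ x₀ s ξ k - γ (delay s (k + 1) (s (k + 1))) •
      g (iterate g γ x₀ s ξ (prev s (k + 1) (s (k + 1))))
        (ξ (prev s (k + 1) (s (k + 1))) (s (k + 1)))
  termination_by k => k
  decreasing_by
    · exact Nat.lt_succ_self k
    · exact prev_lt s (Nat.succ_pos k) _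

/-- The iterates `x_k` of a random run: random initial point, arrival schedule and samples. -/
noncomputable def run {M : ℕ} {E Ω Ξ : Type*} [AddCommGroup E] [Module ℝ E]
    (g : E → Ξ → E) (γ : ℕ → ℝ) (x₀ : Ω → E) (s : ℕ → Ω → Fin M) (ξ : ℕ → Fin M → Ω → Ξ)
    (ω : Ω) (k : ℕ) : E :=
  iterate g γ (x₀ ω) (fun j => s j ω) (fun j m => ξ j m ω) k

/-- The stepsize `γ̂_k` with which the gradient at `x_k` is eventually applied. -/
noncomputable def stepHat {M : ℕ} (γ : ℕ → ℝ) (s : ℕ → Fin M) (K k : ℕ) : ℝ :=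
  γ (returnDelay s K k)

/-- The weights `γ̂_k exp(μ (γ̂_1 + ⋯ + γ̂_k))`. -/
noncomputable def expWeight {M : ℕ} (μ : ℝ) (γ : ℕ → ℝ) (s : ℕ → Fin M) (K k : ℕ) : ℝ :=
  stepHat γ s K k * Real.exp (μ * ∑ j ∈ Finset.Icc 1 k, stepHat γ s K j)

/-- The average of `x_1, …, x_K` with weights proportional to `w_1, …, w_K`. -/
noncomputable def weightedAverage {E : Type*} [AddCommGroup E] [Module ℝ E]
    (w : ℕ → ℝ) (x : ℕ → E) (K : ℕ) : E :=
  (∑ k ∈ Finset.Icc 1 K, w k)⁻¹ • ∑ k ∈ Finset.Icc 1 K, w k • x k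

/-- Convex case: `γ = min {1/(4Lτ), 1/(4ML), B/(σ√K)}` as a function of the delay `τ`.
For `σ = 0` the last term is infinite, hence omitted. -/
noncomputable def convexStep (M K : ℕ) (L σ B : ℝ) (τ : ℕ) : ℝ :=
  if σ = 0 then min (1 / (4 * L * τ)) (1 / (4 * M * L))
  else min (min (1 / (4 * L * τ)) (1 / (4 * M * L))) (B / (σ * √K))

/-- Strongly convex case:
`γ = min {exp(-μτ/(4ML))/(4Lτ), 1/(8ML), 504 ln(e + μ²K²B²/σ²)/(μK)}`.
For `σ = 0` the last term is infinite, hence omitted. -/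
noncomputable def stronglyConvexStep (M K : ℕ) (L σ B μ : ℝ) (τ : ℕ) : ℝ :=
  if σ = 0 then min (Real.exp (-(μ * τ) / (4 * M * L)) / (4 * L * τ)) (1 / (8 * M * L))
  else min (min (Real.exp (-(μ * τ) / (4 * M * L)) / (4 * L * τ)) (1 / (8 * M * L)))
    (504 * Real.log (Real.exp 1 + μ ^ 2 * K ^ 2 * B ^ 2 / σ ^ 2) / (μ * K))

/-- Non-convex case: `γ = min {1/(4Lτ), 1/(2ML), √(Δ/(KLσ²))}`.
For `σ = 0` the last term is infinite, hence omitted. -/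
noncomputable def nonconvexStep (M K : ℕ) (L σ Δ : ℝ) (τ : ℕ) : ℝ :=
  if σ = 0 then min (1 / (4 * L * τ)) (1 / (2 * M * L))
  else min (min (1 / (4 * L * τ)) (1 / (2 * M * L))) (√(Δ / (K * L * σ ^ 2)))

/-- Convex case: the average of `x_1, …, x_K` with weights proportional to `γ̂_k`. -/
noncomputable def convexOutput {M : ℕ} {E Ω Ξ : Type*} [AddCommGroup E] [Module ℝ E]
    (g : E → Ξ → E) (γ : ℕ → ℝ) (x₀ : Ω → E) (s : ℕ → Ω → Fin M) (ξ : ℕ → Fin M → Ω → Ξ)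
    (K : ℕ) (ω : Ω) : E :=
  weightedAverage (stepHat γ (fun j => s j ω) K) (run g γ x₀ s ξ ω) K

/-- Strongly convex case: the average of `x_1, …, x_K` with weights proportional to
`γ̂_k exp(μ (γ̂_1 + ⋯ + γ̂_k))`. -/
noncomputable def stronglyConvexOutput {M : ℕ} {E Ω Ξ : Type*} [AddCommGroup E] [Module ℝ E]
    (μ : ℝ) (g : E → Ξ → E) (γ : ℕ → ℝ) (x₀ : Ω → E) (s : ℕ → Ω → Fin M)
    (ξ : ℕ → Fin M → Ω → Ξ) (K : ℕ) (ω : Ω) : E :=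
  weightedAverage (expWeight μ γ (fun j => s j ω) K) (run g γ x₀ s ξ ω) K

/-- `F` is `L`-smooth: differentiable with `L`-Lipschitz gradient. -/
def IsSmooth {d : ℕ} (L : ℝ) (F : EuclideanSpace ℝ (Fin d) → ℝ) : Prop :=
  Differentiable ℝ F ∧ ∀ x y, ‖gradient F x - gradient F y‖ ≤ L * ‖x - y‖

/-- `g x z` is a stochastic gradient of `F` at `x` when the sample `z` has law `D`: it is jointly
measurable, integrable in `z`, and its mean is `∇F(x)`. Gradients, or measurable selections of subgradients,
`∇f(x; z)` of a loss with `F(x) = E f(x; z)` are the instances in view; only this is used of them. -/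
structure IsStochasticGradient {d : ℕ} {Ξ : Type*} [MeasurableSpace Ξ] (D : Measure Ξ)
    (F : EuclideanSpace ℝ (Fin d) → ℝ)
    (g : EuclideanSpace ℝ (Fin d) → Ξ → EuclideanSpace ℝ (Fin d)) : Prop where
  measurable : Measurable (fun p : EuclideanSpace ℝ (Fin d) × Ξ => g p.1 p.2)
  integrable : ∀ x, Integrable (g x) D
  unbiased : ∀ x, ∫ z, g x z ∂D = gradient F x

/-- The stochastic gradients `g` of `F` have variance at most `σ²` at every point. -/
def HasBoundedVariance {d : ℕ} {Ξ : Type*} [MeasurableSpace Ξ] (D : Measure Ξ)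
    (F : EuclideanSpace ℝ (Fin d) → ℝ)
    (g : EuclideanSpace ℝ (Fin d) → Ξ → EuclideanSpace ℝ (Fin d)) (σ : ℝ) : Prop :=
  ∀ x, Integrable (fun z => ‖g x z - gradient F x‖ ^ 2) D ∧
    ∫ z, ‖g x z - gradient F x‖ ^ 2 ∂D ≤ σ ^ 2

/-- The samples `ξ k m` are independent and identically distributed with law `D`. -/
structure IsIIDSample {Ω Ξ : Type*} [MeasurableSpace Ω] [MeasurableSpace Ξ] {M : ℕ}
    (P : Measure Ω) (D : Measure Ξ) (ξ : ℕ → Fin M → Ω → Ξ) : Prop where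
  measurable : ∀ k m, Measurable (ξ k m)
  law : ∀ k m, P.map (ξ k m) = D
  indep : iIndepFun (fun p : ℕ × Fin M => ξ p.1 p.2) P

/-- The data samples are independent of the initial point and the delays `τ(k, m)`. -/
def DataIndependentOfDelays {Ω Ξ : Type*} [MeasurableSpace Ω] [MeasurableSpace Ξ] {d M : ℕ}
    (P : Measure Ω) (x₀ : Ω → EuclideanSpace ℝ (Fin d)) (s : ℕ → Ω → Fin M)
    (ξ : ℕ → Fin M → Ω → Ξ) : Prop :=
  IndepFun (fun ω => (x₀ ω, fun (k : ℕ) (m : Fin M) => delay (fun j => s j ω) k m))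
    (fun ω (k : ℕ) (m : Fin M) => ξ k m ω) P

/-- The σ-algebra generated by the initial point, the arrival schedule and the data. -/
abbrev runSigma {Ω Ξ : Type*} [MeasurableSpace Ξ] {d M : ℕ}
    (x₀ : Ω → EuclideanSpace ℝ (Fin d)) (s : ℕ → Ω → Fin M) (ξ : ℕ → Fin M → Ω → Ξ) :
    MeasurableSpace Ω :=
  MeasurableSpace.comap
    (fun ω => (x₀ ω, (fun k : ℕ => s k ω), (fun (k : ℕ) (m : Fin M) => ξ k m ω))) inferInstance

/-- `κ` is a random index in `{1, …, K}` which, given the whole run of the algorithm, equals `k`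
with probability proportional to the weight `w ω k`. -/
structure IsRandomIndex {Ω Ξ : Type*} [MeasurableSpace Ω] [MeasurableSpace Ξ] {d M : ℕ}
    (P : Measure Ω) (x₀ : Ω → EuclideanSpace ℝ (Fin d)) (s : ℕ → Ω → Fin M)
    (ξ : ℕ → Fin M → Ω → Ξ) (w : Ω → ℕ → ℝ) (K : ℕ) (κ : Ω → ℕ) : Prop where
  measurable : Measurable κ
  mem : ∀ ω, κ ω ∈ Finset.Icc 1 K
  condProb : ∀ k ∈ Finset.Icc 1 K,
    P[(κ ⁻¹' {k}).indicator (fun _ => (1 : ℝ)) | runSigma x₀ s ξ]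
      =ᵐ[P] fun ω => w ω k / ∑ j ∈ Finset.Icc 1 K, w ω j

end AsyncSGD

/-! Fix the schedule and the initial point, and compare x_k with a virtual sequence y_k in which
every gradient is applied as soon as its computation starts, with the stepsize it will eventually
receive. The step from y_k to y_{k+1} uses a stochastic gradient at x_{k+1} whose sample is
independent of both x_{k+1} and y_k. So y is SGD with gradients taken at a displaced point, and the
noise of a step only costs a multiple of σ²γ̂². These stepsizes look into the future of the
schedule, which is harmless because the schedule is independent of the samples.

The displacement x_{k+1} - y_k is a sum of gradients in flight, at most one per worker
(`iterate_sub_virtualIterate`). Their noises are uncorrelated; their means are handled by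
Cauchy–Schwarz at the cost of a factor M (`integral_inFlight_le`). A gradient of delay τ is in
flight for at most τ iterations, and γ(τ)τ ≤ 1/(4L), so summed over all iterations it contributes
one stepsize times O(h/L), where h bounds all stepsizes (`sum_inFlight_le`). Its noise part is then
comparable to the noise of the y-steps, and its mean part is absorbed by the descent at the point
where it was computed, because h is at most of order 1/(ML). `weighted_descent` carries this out for
all three cases. In the strongly convex case the weights grow exponentially, and the exponential in
the stepsize compensates for their growth during a flight.

Long delays give small steps, but they are rare: each worker has one pending gradient at a time, so
the delays sum to at most (M+1)K and ∑γ̂_k ≥ hK/16 (`sum_returnDelay_le`, `sum_stepHat_ge`).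
Dividing by the total weight gives bounds of the form V₀/(hK) + σ²h, with an additional factor
exp(-cμhK) on the first term under strong convexity; the last term of each stepsize balances the
two.

Finally, the delays determine the schedule from index 1 on, so x₀ and the schedule together are
independent of the samples and can be frozen by Tonelli (`integral_le_of_fixed_schedule`). In the
non-convex case the random index is then averaged out (`integral_random_index`). -/

namespace AsyncSGD

/-! ### Combinatorics of the arrival schedule. -/

section Schedule

variable {M : ℕ} (s : ℕ → Fin M)

theorem prev_one (m : Fin M) : prev s 1 m = 0 := by
  have := prev_lt s Nat.one_pos m
  omega

theorem prev_succ {k : ℕ} (hk : 1 ≤ k) (m : Fin M) :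
    prev s (k + 1) m = if s k = m then k else prev s k m := by
  unfold prev
  rw [Finset.range_add_one, Finset.filter_insert]
  by_cases h : s k = m
  · rw [if_pos ⟨hk, h⟩, if_pos h, Finset.sup_insert, id, sup_eq_left]
    refine Finset.sup_le fun j hj => ?_
    exact (Finset.mem_range.1 (Finset.mem_filter.1 hj).1).le
  · rw [if_neg (fun h' => h h'.2), if_neg h]

variable {s} in
theorem le_prev {j k : ℕ} {m : Fin M} (hj : 1 ≤ j) (hjk : j < k) (hm : s j = m) :
    j ≤ prev s k m :=
  Finset.le_sup (f := id) (Finset.mem_filter.2 ⟨Finset.mem_range.2 hjk, hj, hm⟩)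

theorem prev_eq_zero_or (k : ℕ) (m : Fin M) : prev s k m = 0 ∨ s (prev s k m) = m := by
  induction k with
  | zero => left; rfl
  | succ k ih =>
    rcases Nat.eq_zero_or_pos k with rfl | hk
    · left; exact prev_one s m
    · rw [prev_succ s hk]
      split_ifs with h
      · right; exact h
      · exact ih

theorem next_le {j k : ℕ} {m : Fin M} (hj : k ≤ j) (hm : s j = m) : next s k m ≤ j := by
  unfold next
  exact iInf₂_le (f := fun (j : ℕ) (_ : j ∈ {j : ℕ | k ≤ j ∧ s j = m}) => (j : ℕ∞)) j ⟨hj, hm⟩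

theorem le_next {n k : ℕ} {m : Fin M} (h : ∀ j, k ≤ j → s j = m → n ≤ j) :
    (n : ℕ∞) ≤ next s k m := by
  unfold next
  refine le_iInf₂ fun j hj => ?_
  exact_mod_cast h j hj.1 hj.2

/-- The arrival time, frozen at `K`, of the gradient that worker `m` starts computing after
iteration `j`. -/
noncomputable def arrival (K j : ℕ) (m : Fin M) : ℕ := (min (next s (j + 1) m) (K : ℕ∞)).toNat

/-- The delay with which the gradient that worker `m` starts computing after iteration `j` is
applied, the iteration counter being frozen at `K`. -/
noncomputable def jobDelay (K j : ℕ) (m : Fin M) : ℕ := max 1 (arrival s K j m - j)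

theorem returnDelay_eq (K k : ℕ) : returnDelay s K k = jobDelay s K k (s k) := rfl

theorem coe_arrival (K j : ℕ) (m : Fin M) :
    (arrival s K j m : ℕ∞) = min (next s (j + 1) m) (K : ℕ∞) :=
  ENat.natCast_toNat (ne_top_of_le_ne_top (ENat.natCast_ne_top K) (min_le_right _ _))

theorem arrival_le (K j : ℕ) (m : Fin M) : arrival s K j m ≤ K := by
  have := coe_arrival s K j m
  have h : (arrival s K j m : ℕ∞) ≤ K := this.le.trans (min_le_right _ _)
  exact_mod_cast h

theorem arrival_le_of {K j i : ℕ} {m : Fin M} (hi : j < i) (hm : s i = m) :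
    arrival s K j m ≤ i := by
  have h : (arrival s K j m : ℕ∞) ≤ i :=
    (coe_arrival s K j m).le.trans ((min_le_left _ _).trans (next_le s hi hm))
  exact_mod_cast h

theorem le_arrival {K j n : ℕ} {m : Fin M} (hK : n ≤ K)
    (h : ∀ i, j < i → s i = m → n ≤ i) : n ≤ arrival s K j m := by
  have h' : (n : ℕ∞) ≤ arrival s K j m := by
    rw [coe_arrival]
    exact le_min (le_next s h) (by exact_mod_cast hK)
  exact_mod_cast h'

theorem one_le_jobDelay (K j : ℕ) (m : Fin M) : 1 ≤ jobDelay s K j m := le_max_left _ _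

/-- Freezing the counter at `K` does not alter the delay of a gradient delivered by iteration `K`:
after its previous delivery, the worker delivers next at `k` itself. -/
theorem jobDelay_prev {K k : ℕ} (hk : 1 ≤ k) (hK : k ≤ K) :
    jobDelay s K (prev s k (s k)) (s k) = delay s k (s k) := by
  have hp := prev_lt s hk (s k)
  have h : arrival s K (prev s k (s k)) (s k) = k := by
    refine le_antisymm (arrival_le_of s hp rfl) (le_arrival s hK fun i hi hm => ?_)
    by_contra hik
    have := le_prev (s := s) (by omega) (not_le.1 hik) hm
    omega
  unfold jobDelay delay
  rw [h]
  omega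

/-- A gradient in flight at iteration `k` (and not applied there) was started less than its delay
ago. -/
theorem le_arrival_of_prev {K k j : ℕ} {m : Fin M} (hK : k ≤ K)
    (hp : prev s k m = j) : k ≤ arrival s K j m := by
  refine le_arrival s hK fun i hi him => ?_
  by_contra hik
  have := le_prev (s := s) (by omega) (not_le.1 hik) him
  omega

theorem sub_le_jobDelay {K k j : ℕ} {m : Fin M} (hK : k ≤ K)
    (hp : prev s k m = j) : k - j ≤ jobDelay s K j m :=
  (Nat.sub_le_sub_right (le_arrival_of_prev s hK hp) j).trans (le_max_right _ _)

/-- All these iterations lie between the start of the job and its frozen arrival. Thus the delay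
bounds how often a gradient enters the displacement. -/
theorem card_inFlight_le (K j : ℕ) (m : Fin M) :
    ((Finset.Icc 1 K).filter (fun k => prev s k m = j ∧ s k ≠ m)).card ≤ jobDelay s K j m := by
  refine le_trans (Finset.card_le_card (t := Finset.Ioc j (arrival s K j m)) fun k hk => ?_) ?_
  · obtain ⟨hk, hp, hm⟩ := Finset.mem_filter.1 hk
    rw [Finset.mem_Icc] at hk
    rw [Finset.mem_Ioc]
    exact ⟨hp ▸ prev_lt s hk.1 m, le_arrival_of_prev s hk.2 hp⟩
  · rw [Nat.card_Ioc]
    exact le_max_right _ _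

/-- Expresses a waiting time as a number of iterations, ready for double counting. The summand 1
pays for the `max 1` in the delay. -/
theorem returnDelay_le (K : ℕ) {j : ℕ} (hj : 1 ≤ j) :
    returnDelay s K j ≤ 1 + ((Finset.Icc 1 K).filter (fun k => j < k ∧ prev s k (s j) = j)).card := by
  have h : arrival s K j (s j) - j ≤
      ((Finset.Icc 1 K).filter (fun k => j < k ∧ prev s k (s j) = j)).card := by
    rw [← Nat.card_Ioc]
    refine Finset.card_le_card fun k hk => ?_
    rw [Finset.mem_Ioc] at hk
    rw [Finset.mem_filter, Finset.mem_Icc]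
    refine ⟨⟨by omega, hk.2.trans (arrival_le s K j _)⟩, hk.1,
      le_antisymm ?_ (le_prev hj hk.1 rfl)⟩
    -- Otherwise the worker would have delivered strictly between `j` and `k`, although `k` does not
    -- exceed the first arrival after `j`.
    by_contra hp
    have hp := not_le.1 hp
    rcases prev_eq_zero_or s k (s j) with h0 | h0
    · omega
    · have h1 := arrival_le_of s (K := K) hp h0
      have h2 := prev_lt s (show 0 < k by omega) (s j)
      omega
  rw [returnDelay_eq]
  unfold jobDelay
  omega

/-- Double counting: at iteration `k` distinct pending jobs belong to distinct workers, so `k` is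
charged at most `M` times. -/
theorem sum_returnDelay_le (K : ℕ) :
    ∑ j ∈ Finset.Icc 1 K, returnDelay s K j ≤ K + M * K := by
  calc ∑ j ∈ Finset.Icc 1 K, returnDelay s K j
      ≤ ∑ j ∈ Finset.Icc 1 K, (1 + ∑ k ∈ Finset.Icc 1 K,
          if j < k ∧ prev s k (s j) = j then 1 else 0) := by
        refine Finset.sum_le_sum fun j hj => ?_
        rw [← Finset.card_filter]
        exact returnDelay_le s K (Finset.mem_Icc.1 hj).1
    _ = K + ∑ k ∈ Finset.Icc 1 K, ∑ j ∈ Finset.Icc 1 K,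
          if j < k ∧ prev s k (s j) = j then 1 else 0 := by
        rw [Finset.sum_add_distrib, Finset.sum_comm]
        simp
    _ ≤ K + ∑ k ∈ Finset.Icc 1 K, M := by
        gcongr with k hk
        rw [← Finset.card_filter]
        conv_rhs => rw [← Fintype.card_fin M, ← Finset.card_univ]
        refine Finset.card_le_card_of_injOn s (fun _ _ => Finset.mem_coe.2 (Finset.mem_univ _)) ?_
        intro i hi j hj hij
        have hi := (Finset.mem_filter.1 hi).2.2
        have hj := (Finset.mem_filter.1 hj).2.2
        rw [← hi, ← hj, hij]
    _ = K + M * K := by simp [mul_comm]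

-- The congruence lemmas leave `s 0` free: the algorithm never reads it, and the delays do not
-- determine it.
variable {s} in
theorem prev_congr {s' : ℕ → Fin M} {k : ℕ} (h : ∀ j, 1 ≤ j → j < k → s j = s' j) (m : Fin M) :
    prev s k m = prev s' k m := by
  unfold prev
  congr 1
  refine Finset.filter_congr fun j hj => ?_
  constructor
  · rintro ⟨h1, h2⟩
    exact ⟨h1, h j h1 (Finset.mem_range.1 hj) ▸ h2⟩
  · rintro ⟨h1, h2⟩
    exact ⟨h1, (h j h1 (Finset.mem_range.1 hj)).trans h2⟩

variable {s} in
theorem arrival_congr {s' : ℕ → Fin M} {K : ℕ} (h : ∀ j, 1 ≤ j → j ≤ K → s j = s' j) (j : ℕ)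
    (m : Fin M) : arrival s K j m = arrival s' K j m := by
  have key : ∀ {s s' : ℕ → Fin M}, (∀ j, 1 ≤ j → j ≤ K → s j = s' j) →
      arrival s K j m ≤ arrival s' K j m := fun {s s'} h => by
    refine le_arrival s' (arrival_le s K j m) fun i hi him => ?_
    by_cases hiK : i ≤ K
    · exact arrival_le_of s hi ((h i (by omega) hiK).trans him)
    · exact (arrival_le s K j m).trans (by omega)
  exact le_antisymm (key h) (key fun j h1 h2 => (h j h1 h2).symm)

variable {s} in
theorem stepHat_congr {s' : ℕ → Fin M} {K : ℕ} (h : ∀ j, 1 ≤ j → j ≤ K → s j = s' j)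
    (γ : ℕ → ℝ) {k : ℕ} (hk : 1 ≤ k) (hkK : k ≤ K) : stepHat γ s K k = stepHat γ s' K k := by
  unfold stepHat
  rw [returnDelay_eq, returnDelay_eq]
  unfold jobDelay
  rw [h k hk hkK, arrival_congr h]

variable {s} in
theorem expWeight_congr {s' : ℕ → Fin M} {K : ℕ} (h : ∀ j, 1 ≤ j → j ≤ K → s j = s' j)
    (μ : ℝ) (γ : ℕ → ℝ) {k : ℕ} (hk : 1 ≤ k) (hkK : k ≤ K) :
    expWeight μ γ s K k = expWeight μ γ s' K k := by
  unfold expWeight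
  rw [stepHat_congr h γ hk hkK, Finset.sum_congr rfl fun j hj =>
    stepHat_congr h γ (Finset.mem_Icc.1 hj).1 ((Finset.mem_Icc.1 hj).2.trans hkK)]

variable {s} in
theorem iterate_congr {E Ξ : Type*} [AddCommGroup E] [Module ℝ E] {s' : ℕ → Fin M} {K : ℕ}
    (h : ∀ j, 1 ≤ j → j ≤ K → s j = s' j) (g : E → Ξ → E) (γ : ℕ → ℝ) (x₀ : E)
    (ξ : ℕ → Fin M → Ξ) {k : ℕ} (hk : k ≤ K) :
    iterate g γ x₀ s ξ k = iterate g γ x₀ s' ξ k := by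
  induction k using Nat.strong_induction_on with
  | _ k ih =>
    cases k with
    | zero => rw [iterate, iterate]
    | succ k =>
      have hp : prev s (k + 1) (s (k + 1)) = prev s' (k + 1) (s' (k + 1)) := by
        rw [h (k + 1) (by omega) hk]
        exact prev_congr (fun j h1 h2 => h j h1 (by omega)) _
      have hl := prev_lt s' (Nat.succ_pos k) (s' (k + 1))
      rw [iterate, iterate, ih k (by omega) (by omega)]
      unfold delay
      rw [hp, ih _ hl (by omega), h (k + 1) (by omega) hk]

end Schedule

end AsyncSGD

namespace AsyncSGD

/-! ### Weights, and the total weight of a gradient in flight. -/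

section Weights

variable {M : ℕ}

/-- The stepsize with which the gradient started by worker `m` after iteration `j` is applied. -/
noncomputable def jobStep (γ : ℕ → ℝ) (s : ℕ → Fin M) (K j : ℕ) (m : Fin M) : ℝ :=
  γ (jobDelay s K j m)

theorem stepHat_eq_jobStep (γ : ℕ → ℝ) (s : ℕ → Fin M) (K k : ℕ) :
    stepHat γ s K k = jobStep γ s K k (s k) := rfl

/-- The factor `exp (μ (γ̂_1 + ⋯ + γ̂_k))` of the weights. -/
noncomputable def expFactor (μ : ℝ) (γ : ℕ → ℝ) (s : ℕ → Fin M) (K k : ℕ) : ℝ :=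
  Real.exp (μ * ∑ j ∈ Finset.Icc 1 k, stepHat γ s K j)

theorem expWeight_eq (μ : ℝ) (γ : ℕ → ℝ) (s : ℕ → Fin M) (K k : ℕ) :
    expWeight μ γ s K k = stepHat γ s K k * expFactor μ γ s K k := rfl

theorem expFactor_pos (μ : ℝ) (γ : ℕ → ℝ) (s : ℕ → Fin M) (K k : ℕ) :
    0 < expFactor μ γ s K k := Real.exp_pos _

theorem expFactor_zero (μ : ℝ) (γ : ℕ → ℝ) (s : ℕ → Fin M) (K : ℕ) :
    expFactor μ γ s K 0 = 1 := by
  simp [expFactor]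

theorem expFactor_succ (μ : ℝ) (γ : ℕ → ℝ) (s : ℕ → Fin M) (K k : ℕ) :
    expFactor μ γ s K (k + 1) =
      expFactor μ γ s K k * Real.exp (μ * stepHat γ s K (k + 1)) := by
  unfold expFactor
  rw [Finset.sum_Icc_succ_top (by omega), mul_add, Real.exp_add]

/-- The properties of the delay-adaptive stepsizes on which the analysis rests: they are at most
`h ≤ b` and decrease with the delay `τ` at least like `exp (-μbτ) / (4Lτ)`. -/
structure IsAdaptiveStep (γ : ℕ → ℝ) (L μ b h : ℝ) : Prop where
  pos : ∀ τ, 1 ≤ τ → 0 < γ τ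
  le : ∀ τ, 1 ≤ τ → γ τ ≤ h
  mul_le : ∀ τ : ℕ, 1 ≤ τ → γ τ * (τ * Real.exp (μ * b * τ)) ≤ 1 / (4 * L)
  le_cap : h ≤ b

namespace IsAdaptiveStep

variable {γ : ℕ → ℝ} {L μ b h : ℝ}

theorem jobStep_pos (hγ : IsAdaptiveStep γ L μ b h) (s : ℕ → Fin M) (K j : ℕ) (m : Fin M) :
    0 < jobStep γ s K j m := hγ.pos _ (one_le_jobDelay s K j m)

theorem jobStep_le (hγ : IsAdaptiveStep γ L μ b h) (s : ℕ → Fin M) (K j : ℕ) (m : Fin M) :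
    jobStep γ s K j m ≤ h := hγ.le _ (one_le_jobDelay s K j m)

theorem stepHat_pos (hγ : IsAdaptiveStep γ L μ b h) (s : ℕ → Fin M) (K k : ℕ) :
    0 < stepHat γ s K k := hγ.jobStep_pos s K k (s k)

theorem stepHat_le (hγ : IsAdaptiveStep γ L μ b h) (s : ℕ → Fin M) (K k : ℕ) :
    stepHat γ s K k ≤ h := hγ.jobStep_le s K k (s k)

theorem nonneg (hγ : IsAdaptiveStep γ L μ b h) : 0 ≤ h :=
  (hγ.pos 1 le_rfl).le.trans (hγ.le 1 le_rfl)

theorem expWeight_pos (hγ : IsAdaptiveStep γ L μ b h) (s : ℕ → Fin M) (K k : ℕ) :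
    0 < expWeight μ γ s K k := mul_pos (hγ.stepHat_pos s K k) (Real.exp_pos _)

/-- One iteration multiplies the factor by at most exp(μb), since every stepsize is at most `b`.
This controls the growth of the weights during one flight. -/
theorem expFactor_le (hγ : IsAdaptiveStep γ L μ b h) (hμ : 0 ≤ μ) (s : ℕ → Fin M) (K : ℕ)
    {j k τ : ℕ} (hjk : j ≤ k) (hτ : k - j ≤ τ) :
    expFactor μ γ s K k ≤ expFactor μ γ s K j * Real.exp (μ * b * τ) := by
  obtain ⟨n, rfl⟩ := Nat.exists_eq_add_of_le hjk
  have hb : 0 ≤ b := hγ.nonneg.trans hγ.le_cap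
  have key : expFactor μ γ s K (j + n) ≤ expFactor μ γ s K j * Real.exp (μ * b * n) := by
    clear hτ hjk
    induction n with
    | zero => simp
    | succ n ih =>
      rw [← add_assoc, expFactor_succ]
      have h1 : Real.exp (μ * stepHat γ s K (j + n + 1)) ≤ Real.exp (μ * b) :=
        Real.exp_le_exp.2 (mul_le_mul_of_nonneg_left
          ((hγ.stepHat_le s K _).trans hγ.le_cap) hμ)
      calc _ ≤ expFactor μ γ s K j * Real.exp (μ * b * n) * Real.exp (μ * b) :=
            mul_le_mul ih h1 (Real.exp_pos _).le
              (mul_nonneg (expFactor_pos _ _ _ _ _).le (Real.exp_pos _).le)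
        _ = _ := by
            rw [mul_assoc, ← Real.exp_add]
            congr 2
            push_cast
            ring
  refine key.trans (mul_le_mul_of_nonneg_left (Real.exp_le_exp.2 ?_) (expFactor_pos _ _ _ _ _).le)
  have : (n : ℝ) ≤ τ := by exact_mod_cast (by omega : n ≤ τ)
  gcongr

theorem expFactor_mono (hγ : IsAdaptiveStep γ L μ b h) (hμ : 0 ≤ μ) (s : ℕ → Fin M) (K k : ℕ) :
    1 ≤ expFactor μ γ s K k :=
  Real.one_le_exp (mul_nonneg hμ (Finset.sum_nonneg fun _ _ => (hγ.stepHat_pos s K _).le))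

/-- The total weight of the iterations during which a gradient is in flight. -/
theorem sum_weight_inFlight_le (hγ : IsAdaptiveStep γ L μ b h) (hμ : 0 ≤ μ) (s : ℕ → Fin M)
    (K j : ℕ) (m : Fin M) :
    jobStep γ s K j m *
      ∑ k ∈ (Finset.Icc 1 K).filter (fun k => prev s k m = j ∧ s k ≠ m), expWeight μ γ s K k ≤
      expFactor μ γ s K j * h / (4 * L) := by
  set τ := jobDelay s K j m with hτ
  have h1 : ∑ k ∈ (Finset.Icc 1 K).filter (fun k => prev s k m = j ∧ s k ≠ m),
      expWeight μ γ s K k ≤ τ * (h * (expFactor μ γ s K j * Real.exp (μ * b * τ))) := by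
    have hc : ∀ k ∈ (Finset.Icc 1 K).filter (fun k => prev s k m = j ∧ s k ≠ m),
        expWeight μ γ s K k ≤ h * (expFactor μ γ s K j * Real.exp (μ * b * τ)) := by
      intro k hk
      obtain ⟨hk, hp, -⟩ := Finset.mem_filter.1 hk
      rw [Finset.mem_Icc] at hk
      exact mul_le_mul (hγ.stepHat_le s K k)
        (hγ.expFactor_le hμ s K (hp ▸ (prev_lt s hk.1 m).le) (sub_le_jobDelay s hk.2 hp))
        (Real.exp_pos _).le hγ.nonneg
    refine (Finset.sum_le_card_nsmul _ _ _ hc).trans ?_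
    rw [nsmul_eq_mul]
    refine mul_le_mul_of_nonneg_right ?_ (mul_nonneg hγ.nonneg
      (mul_nonneg (expFactor_pos _ _ _ _ _).le (Real.exp_pos _).le))
    exact_mod_cast card_inFlight_le s K j m
  calc _ ≤ jobStep γ s K j m * (τ * (h * (expFactor μ γ s K j * Real.exp (μ * b * τ)))) :=
        mul_le_mul_of_nonneg_left h1 (hγ.jobStep_pos s K j m).le
    -- The stepsize meets the number of iterations in flight and the growth of the weights; this
    -- product is what `mul_le` bounds.
    _ = (γ τ * (τ * Real.exp (μ * b * τ))) * (expFactor μ γ s K j * h) := by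
        unfold jobStep
        ring
    _ ≤ 1 / (4 * L) * (expFactor μ γ s K j * h) :=
        mul_le_mul_of_nonneg_right (hγ.mul_le τ (one_le_jobDelay s K j m))
          (mul_nonneg (expFactor_pos _ _ _ _ _).le hγ.nonneg)
    _ = _ := by ring

/-- Exchange the summations, so that each job (j, m) collects the weights of the iterations during
which it is in flight. Only the `M` initial jobs and the pairs (j, s j) contribute; for any other
pair no iteration has that job pending. -/
theorem sum_inFlight_le (hγ : IsAdaptiveStep γ L μ b h) (hμ : 0 ≤ μ) (s : ℕ → Fin M) (K : ℕ)
    (Q : ℕ → Fin M → ℝ) (hQ : ∀ j m, 0 ≤ Q j m) :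
    ∑ k ∈ Finset.Icc 1 K, expWeight μ γ s K k *
        ∑ m ∈ Finset.univ.filter (fun m => s k ≠ m),
          jobStep γ s K (prev s k m) m * Q (prev s k m) m ≤
      h / (4 * L) * (∑ m, Q 0 m + ∑ j ∈ Finset.Icc 1 K, expFactor μ γ s K j * Q j (s j)) := by
  have hswap : ∑ k ∈ Finset.Icc 1 K, expWeight μ γ s K k *
        ∑ m ∈ Finset.univ.filter (fun m => s k ≠ m),
          jobStep γ s K (prev s k m) m * Q (prev s k m) m =
      ∑ m, ∑ j ∈ Finset.range (K + 1),
        jobStep γ s K j m * (∑ k ∈ (Finset.Icc 1 K).filter (fun k => prev s k m = j ∧ s k ≠ m),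
          expWeight μ γ s K k) * Q j m := by
    simp_rw [Finset.mul_sum, Finset.sum_filter]
    rw [Finset.sum_comm]
    refine Finset.sum_congr rfl fun m _ => ?_
    rw [← Finset.sum_fiberwise_of_maps_to (s := Finset.Icc 1 K) (t := Finset.range (K + 1))
      (g := fun k => prev s k m)]
    · refine Finset.sum_congr rfl fun j _ => ?_
      rw [Finset.sum_filter, Finset.sum_mul]
      refine Finset.sum_congr rfl fun k _ => ?_
      by_cases h1 : prev s k m = j
      · subst h1
        by_cases h2 : s k = m
        · simp [h2]
        · simp only [h2, ne_eq, not_false_eq_true, and_self, if_true]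
          ring
      · simp [h1]
    · intro k hk
      rw [Finset.mem_Icc] at hk
      have := prev_lt s hk.1 m
      exact Finset.mem_range.2 (by omega)
  rw [hswap]
  have hterm : ∀ m, ∀ j ∈ Finset.range (K + 1),
      jobStep γ s K j m * (∑ k ∈ (Finset.Icc 1 K).filter (fun k => prev s k m = j ∧ s k ≠ m),
          expWeight μ γ s K k) * Q j m ≤
        if j = 0 ∨ s j = m then h / (4 * L) * (expFactor μ γ s K j * Q j m) else 0 := by
    intro m j _
    split_ifs with hj
    · refine (mul_le_mul_of_nonneg_right (hγ.sum_weight_inFlight_le hμ s K j m) (hQ j m)).trans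
        (le_of_eq ?_)
      ring
    · have : (Finset.Icc 1 K).filter (fun k => prev s k m = j ∧ s k ≠ m) = ∅ := by
        refine Finset.filter_eq_empty_iff.2 fun k _ hk => hj ?_
        rw [← hk.1]
        exact prev_eq_zero_or s k m
      rw [this]
      simp
  refine (Finset.sum_le_sum fun m _ => Finset.sum_le_sum (hterm m)).trans (le_of_eq ?_)
  have hrange : Finset.range (K + 1) = insert 0 (Finset.Icc 1 K) := by
    ext j
    simp only [Finset.mem_range, Finset.mem_insert, Finset.mem_Icc]
    omega
  have hm : ∀ m, ∑ j ∈ Finset.range (K + 1),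
      (if j = 0 ∨ s j = m then h / (4 * L) * (expFactor μ γ s K j * Q j m) else 0) =
      h / (4 * L) * Q 0 m + ∑ j ∈ Finset.Icc 1 K,
        if s j = m then h / (4 * L) * (expFactor μ γ s K j * Q j m) else 0 := by
    intro m
    rw [hrange, Finset.sum_insert (by simp), if_pos (Or.inl rfl), expFactor_zero, one_mul]
    congr 1
    refine Finset.sum_congr rfl fun j hj => ?_
    have : j ≠ 0 := by
      have := (Finset.mem_Icc.1 hj).1
      omega
    simp [this]
  simp_rw [hm]
  rw [Finset.sum_add_distrib, Finset.sum_comm, mul_add, Finset.mul_sum, Finset.mul_sum]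
  simp

end IsAdaptiveStep

end Weights

end AsyncSGD

namespace AsyncSGD

/-! ### Lower bounds on the total weight, and the perturbed descent inequality. -/

namespace IsAdaptiveStep

variable {M : ℕ} {γ : ℕ → ℝ} {L μ b h : ℝ}

/-- The lower bound `hlow` is affine in the delay, so only the average delay matters. That average
is at most 2M, and at 2M the bound still equals h/2. -/
theorem sum_stepHat_ge (s : ℕ → Fin M) (K : ℕ) (hh : 0 ≤ h)
    (hlow : ∀ τ : ℕ, 1 ≤ τ → h * (1 - τ / (4 * M)) ≤ 8 * γ τ) (hM : 1 ≤ M) :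
    h * K / 16 ≤ ∑ k ∈ Finset.Icc 1 K, stepHat γ s K k := by
  have hM' : (1 : ℝ) ≤ M := by exact_mod_cast hM
  have hs : ∑ k ∈ Finset.Icc 1 K, (returnDelay s K k : ℝ) ≤ 2 * M * K := by
    have h1 : ∑ k ∈ Finset.Icc 1 K, (returnDelay s K k : ℝ) ≤ K + M * K := by
      exact_mod_cast sum_returnDelay_le s K
    nlinarith [(Nat.cast_nonneg K : (0 : ℝ) ≤ K)]
  have h2 : ∑ k ∈ Finset.Icc 1 K, h * (1 - (returnDelay s K k : ℝ) / (4 * M)) ≤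
      ∑ k ∈ Finset.Icc 1 K, 8 * stepHat γ s K k :=
    Finset.sum_le_sum fun k _ => hlow _ (one_le_jobDelay s K k (s k))
  rw [← Finset.mul_sum, ← Finset.mul_sum, Finset.sum_sub_distrib, ← Finset.sum_div] at h2
  simp only [Finset.sum_const, Nat.card_Icc, add_tsub_cancel_right, nsmul_eq_mul, mul_one] at h2
  have h3 : (∑ k ∈ Finset.Icc 1 K, (returnDelay s K k : ℝ)) / (4 * M) ≤ K / 2 := by
    rw [div_le_iff₀ (by positivity)]
    linarith
  have h4 : h * (K / 2) ≤ h * (K - (∑ k ∈ Finset.Icc 1 K, (returnDelay s K k : ℝ)) / (4 * M)) :=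
    mul_le_mul_of_nonneg_left (by linarith) hh
  linarith

theorem sum_stepHat_le_sum_expWeight (hγ : IsAdaptiveStep γ L μ b h) (hμ : 0 ≤ μ)
    (s : ℕ → Fin M) (K : ℕ) :
    ∑ k ∈ Finset.Icc 1 K, stepHat γ s K k ≤ ∑ k ∈ Finset.Icc 1 K, expWeight μ γ s K k := by
  refine Finset.sum_le_sum fun k _ => ?_
  exact le_mul_of_one_le_right (hγ.stepHat_pos s K k).le (hγ.expFactor_mono hμ s K k)

/-- Telescoping: an increment of the factor P is P_k (1 - exp(-μγ̂_k)) ≤ μγ̂_k P_k. -/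
theorem _root_.AsyncSGD.expFactor_sub_one_le (μ : ℝ) (γ : ℕ → ℝ) (s : ℕ → Fin M) (K n : ℕ) :
    expFactor μ γ s K n - 1 ≤ μ * ∑ k ∈ Finset.Icc 1 n, expWeight μ γ s K k := by
  induction n with
  | zero => simp [expFactor_zero]
  | succ n ih =>
    rw [Finset.sum_Icc_succ_top (by omega), mul_add]
    have h1 : expFactor μ γ s K n =
        expFactor μ γ s K (n + 1) * Real.exp (-(μ * stepHat γ s K (n + 1))) := by
      rw [expFactor_succ, mul_assoc, ← Real.exp_add]
      simp
    have h2 := Real.add_one_le_exp (-(μ * stepHat γ s K (n + 1)))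
    have h3 := mul_le_mul_of_nonneg_left h2 (expFactor_pos μ γ s K (n + 1)).le
    rw [← h1] at h3
    rw [expWeight_eq]
    linarith

/-- By the previous bound μ times the sum is at least exp(μT) - 1 = 2 exp(μT/2) sinh(μT/2), and sinh
u ≥ u. Half of the exponential is given up to keep the factor T for every μ. -/
theorem _root_.AsyncSGD.sum_expWeight_ge (hμ : 0 < μ) (s : ℕ → Fin M) {K : ℕ}
    {T : ℝ} (hT : 0 ≤ T) (hTs : T ≤ ∑ k ∈ Finset.Icc 1 K, stepHat γ s K k) :
    T * Real.exp (μ * T / 2) ≤ ∑ k ∈ Finset.Icc 1 K, expWeight μ γ s K k := by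
  have h1 := expFactor_sub_one_le μ γ s K K
  have h2 : Real.exp (μ * T) ≤ expFactor μ γ s K K :=
    Real.exp_le_exp.2 (mul_le_mul_of_nonneg_left hTs hμ.le)
  have h3 : μ * T / 2 ≤ Real.sinh (μ * T / 2) :=
    Real.self_le_sinh_iff.2 (by positivity)
  rw [Real.sinh_eq] at h3
  have h4 : μ * T * Real.exp (μ * T / 2) ≤ Real.exp (μ * T) - 1 := by
    have h5 := mul_le_mul_of_nonneg_right h3 (Real.exp_pos (μ * T / 2)).le
    have h6 : Real.exp (μ * T / 2) * Real.exp (μ * T / 2) = Real.exp (μ * T) := by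
      rw [← Real.exp_add]
      congr 1
      ring
    have h7 : Real.exp (-(μ * T / 2)) * Real.exp (μ * T / 2) = 1 := by
      rw [← Real.exp_add]
      simp
    linarith
  refine le_of_mul_le_mul_left ?_ hμ
  linarith

theorem sum_initial_le (hγ : IsAdaptiveStep γ L μ b h) (s : ℕ → Fin M) (K : ℕ) :
    ∑ m, jobStep γ s K 0 m ≤ M * h := by
  refine (Finset.sum_le_sum fun m _ => hγ.jobStep_le s K 0 m).trans (le_of_eq ?_)
  simp

/-- The weights are chosen so that multiplying the recursion by the next factor cancels the
contraction exp(-μγ̂). -/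
theorem weighted_telescope (s : ℕ → Fin M) (K : ℕ) (V R : ℕ → ℝ)
    (hstep : ∀ k, k < K → V (k + 1) ≤
      Real.exp (-(μ * stepHat γ s K (k + 1))) * V k + stepHat γ s K (k + 1) * R (k + 1))
    (n : ℕ) (hn : n ≤ K) :
    expFactor μ γ s K n * V n ≤ V 0 + ∑ k ∈ Finset.Icc 1 n, expWeight μ γ s K k * R k := by
  induction n with
  | zero => simp [expFactor_zero]
  | succ n ih =>
    rw [Finset.sum_Icc_succ_top (by omega)]
    have h1 := mul_le_mul_of_nonneg_left (hstep n (by omega)) (expFactor_pos μ γ s K (n + 1)).le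
    have h2 : expFactor μ γ s K (n + 1) * Real.exp (-(μ * stepHat γ s K (n + 1))) =
        expFactor μ γ s K n := by
      rw [expFactor_succ, mul_assoc, ← Real.exp_add]
      simp
    rw [mul_add, ← mul_assoc, h2] at h1
    have h3 := ih (by omega)
    rw [expWeight_eq]
    linarith

/-- The weighted sum of a descent inequality perturbed by the gradients in flight. -/
theorem weighted_descent (hγ : IsAdaptiveStep γ L μ b h) (hμ : 0 ≤ μ) (hL : 0 < L)
    (s : ℕ → Fin M) {K : ℕ}
    (hlow : ∀ τ : ℕ, 1 ≤ τ → h * (1 - τ / (4 * M)) ≤ 8 * γ τ) (hMK : M ≤ K) (hM : 1 ≤ M)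
    {σ a a' cA c₀ V₀ : ℝ} (hcA : 0 ≤ cA) (hc₀ : 0 ≤ c₀)
    (V D A G : ℕ → ℝ) (hV : 0 ≤ V K) (hG : ∀ k, 0 ≤ G k)
    (hGD : ∀ k, cA * (M * b / (2 * L)) * G k ≤ a' * D k)
    (hstep : ∀ k, k < K → V (k + 1) ≤ Real.exp (-(μ * stepHat γ s K (k + 1))) * V k +
      stepHat γ s K (k + 1) *
        (-a * D (k + 1) + cA * A (k + 1) + c₀ * σ ^ 2 * stepHat γ s K (k + 1)))
    (hA : ∀ k ∈ Finset.Icc 1 K, A k ≤ ∑ m ∈ Finset.univ.filter (fun m => s k ≠ m),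
      jobStep γ s K (prev s k m) m ^ 2 * (2 * σ ^ 2 + 2 * M * G (prev s k m)))
    (hinit : V 0 ≤ V₀ + ∑ m, jobStep γ s K 0 m * (-a' * D 0 + c₀ * σ ^ 2 * jobStep γ s K 0 m)) :
    (a - a') * ∑ k ∈ Finset.Icc 1 K, expWeight μ γ s K k * D k ≤
      V₀ + 17 * (c₀ + cA / (2 * L)) * σ ^ 2 * h * ∑ k ∈ Finset.Icc 1 K, expWeight μ γ s K k := by
  -- `V` is the potential of the virtual iterates, `D` the quantity to be bounded, `A` the squared
  -- displacement and `G` the squared gradient. The share `a'` of the descent coefficient `a` is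
  -- reserved for absorbing the gradients in flight; the initial step has to provide only this
  -- share.
  have hh := hγ.nonneg
  set W := ∑ k ∈ Finset.Icc 1 K, expWeight μ γ s K k with hW
  set S := ∑ m, jobStep γ s K 0 m with hS
  have htel := weighted_telescope s K V
    (fun k => -a * D k + cA * A k + c₀ * σ ^ 2 * stepHat γ s K k) hstep K le_rfl
  have hVK := mul_nonneg (expFactor_pos μ γ s K K).le hV
  have hsum : ∑ k ∈ Finset.Icc 1 K, expWeight μ γ s K k *
        (-a * D k + cA * A k + c₀ * σ ^ 2 * stepHat γ s K k) ≤
      -a * ∑ k ∈ Finset.Icc 1 K, expWeight μ γ s K k * D k +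
      cA * ∑ k ∈ Finset.Icc 1 K, expWeight μ γ s K k * A k + c₀ * σ ^ 2 * h * W := by
    rw [Finset.mul_sum, Finset.mul_sum, hW, Finset.mul_sum, ← Finset.sum_add_distrib,
      ← Finset.sum_add_distrib]
    refine Finset.sum_le_sum fun k _ => ?_
    have := mul_le_mul_of_nonneg_left (hγ.stepHat_le s K k)
      (mul_nonneg (mul_nonneg hc₀ (sq_nonneg σ)) (hγ.expWeight_pos s K k).le)
    linarith
  have hflight : ∑ k ∈ Finset.Icc 1 K, expWeight μ γ s K k * A k ≤
      h / (4 * L) * (∑ m, jobStep γ s K 0 m * (2 * σ ^ 2 + 2 * M * G 0) +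
        ∑ j ∈ Finset.Icc 1 K, expWeight μ γ s K j * (2 * σ ^ 2 + 2 * M * G j)) := by
    refine (Finset.sum_le_sum fun k hk => mul_le_mul_of_nonneg_left (hA k hk)
      (hγ.expWeight_pos s K k).le).trans ?_
    -- Of the squared stepsize of a job, one factor is spent on the duration of the flight; the
    -- other, times the exponential factor, is again a weight.
    have := hγ.sum_inFlight_le hμ s K
      (fun j m => jobStep γ s K j m * (2 * σ ^ 2 + 2 * M * G j))
      (fun j m => mul_nonneg (hγ.jobStep_pos s K j m).le (by
        have := hG j
        positivity))
    refine le_trans (le_of_eq ?_) (this.trans (le_of_eq ?_))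
    · refine Finset.sum_congr rfl fun k _ => ?_
      congr 1
      refine Finset.sum_congr rfl fun m _ => ?_
      ring
    · congr 2
      refine Finset.sum_congr rfl fun k _ => ?_
      rw [expWeight_eq, stepHat_eq_jobStep]
      ring
  -- The mean part of the flight is absorbed through `hGD` and `h ≤ b`; only noise remains.
  have habs : ∀ w j, 0 ≤ w → cA * (h / (4 * L) * (w * (2 * σ ^ 2 + 2 * M * G j))) ≤
      cA / (2 * L) * σ ^ 2 * h * w + a' * (w * D j) := by
    intro w j hw
    have h1 : cA * (M * h / (2 * L)) * G j ≤ a' * D j := by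
      refine le_trans ?_ (hGD j)
      have := hγ.le_cap
      have := hG j
      gcongr
    have h2 := mul_le_mul_of_nonneg_left h1 hw
    have h3 : cA * (h / (4 * L) * (w * (2 * σ ^ 2 + 2 * M * G j))) =
        cA / (2 * L) * σ ^ 2 * h * w + w * (cA * (M * h / (2 * L)) * G j) := by
      field_simp
      ring
    linarith
  have habs' : cA * (h / (4 * L) * (∑ m, jobStep γ s K 0 m * (2 * σ ^ 2 + 2 * M * G 0) +
        ∑ j ∈ Finset.Icc 1 K, expWeight μ γ s K j * (2 * σ ^ 2 + 2 * M * G j))) ≤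
      cA / (2 * L) * σ ^ 2 * h * S + a' * (S * D 0) + (cA / (2 * L) * σ ^ 2 * h * W +
        a' * ∑ k ∈ Finset.Icc 1 K, expWeight μ γ s K k * D k) := by
    rw [mul_add, mul_add]
    refine add_le_add ?_ ?_
    · rw [← Finset.sum_mul]
      exact habs S 0 (Finset.sum_nonneg fun m _ => (hγ.jobStep_pos s K 0 m).le)
    · rw [hW, Finset.mul_sum, Finset.mul_sum, Finset.mul_sum, Finset.mul_sum,
        ← Finset.sum_add_distrib]
      exact Finset.sum_le_sum fun j _ => habs _ j (hγ.expWeight_pos s K j).le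
  have hinit' : ∑ m, jobStep γ s K 0 m * (-a' * D 0 + c₀ * σ ^ 2 * jobStep γ s K 0 m) ≤
      -a' * (S * D 0) + c₀ * σ ^ 2 * h * S := by
    rw [hS, Finset.sum_mul, Finset.mul_sum, Finset.mul_sum, ← Finset.sum_add_distrib]
    refine Finset.sum_le_sum fun m _ => ?_
    have := mul_le_mul_of_nonneg_left (hγ.jobStep_le s K 0 m)
      (mul_nonneg (mul_nonneg hc₀ (sq_nonneg σ)) (hγ.jobStep_pos s K 0 m).le)
    linarith
  -- The `M` initial jobs weigh at most Mh ≤ Kh, comparable to the total weight. Their noise costs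
  -- 16W and the others' costs W, hence the factor 17.
  have hSW : S ≤ 16 * W := by
    have h1 := hγ.sum_initial_le s K
    have h2 := sum_stepHat_ge s K hh hlow hM
    have h3 := hγ.sum_stepHat_le_sum_expWeight hμ s K
    have h4 : (M : ℝ) * h ≤ K * h := by
      have : (M : ℝ) ≤ K := by exact_mod_cast hMK
      gcongr
    linarith
  have hfin : (c₀ + cA / (2 * L)) * σ ^ 2 * h * S ≤
      (c₀ + cA / (2 * L)) * σ ^ 2 * h * (16 * W) := by
    gcongr
  have hflight' := mul_le_mul_of_nonneg_left hflight hcA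
  linarith

end IsAdaptiveStep

end AsyncSGD

namespace AsyncSGD

/-! ### Deterministic inequalities for smooth and convex functions. -/

section Smooth

open scoped InnerProductSpace

variable {d : ℕ} {F : EuclideanSpace ℝ (Fin d) → ℝ} {L μ : ℝ} {xstar : EuclideanSpace ℝ (Fin d)}

theorem hasDerivAt_along_segment (hF : Differentiable ℝ F) (x v : EuclideanSpace ℝ (Fin d))
    (t : ℝ) : HasDerivAt (fun t : ℝ => F (x + t • v)) ⟪gradient F (x + t • v), v⟫_ℝ t := by
  have h1 : HasDerivAt (fun t : ℝ => x + t • v) v t := by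
    simpa using ((hasDerivAt_id t).smul_const v).const_add x
  exact (hF (x + t • v)).hasGradientAt.hasFDerivAt.comp_hasDerivAt t h1

namespace IsSmooth

theorem continuous_gradient (hF : IsSmooth L F) : Continuous (gradient F) := by
  refine LipschitzWith.continuous (K := L.toNNReal) (LipschitzWith.of_dist_le_mul fun x y => ?_)
  rw [dist_eq_norm, dist_eq_norm]
  refine (hF.2 x y).trans ?_
  gcongr
  exact Real.le_coe_toNNReal L

/-- Along the segment from `x` to `y`, the quadratic upper model minus F has nonnegative derivative,
by the Lipschitz bound on the gradient. -/
theorem le_quadratic (hF : IsSmooth L F) (x y : EuclideanSpace ℝ (Fin d)) :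
    F y ≤ F x + ⟪gradient F x, y - x⟫_ℝ + L / 2 * ‖y - x‖ ^ 2 := by
  set v := y - x with hv
  have hd : ∀ t : ℝ, HasDerivAt
      (fun t : ℝ => F x + t * ⟪gradient F x, v⟫_ℝ + L / 2 * t ^ 2 * ‖v‖ ^ 2 - F (x + t • v))
      (⟪gradient F x, v⟫_ℝ + L * t * ‖v‖ ^ 2 - ⟪gradient F (x + t • v), v⟫_ℝ) t := by
    intro t
    have h1 := ((hasDerivAt_id t).mul_const ⟪gradient F x, v⟫_ℝ).const_add (F x)
    have h2 := (((hasDerivAt_id t).pow 2).const_mul (L / 2)).mul_const (‖v‖ ^ 2)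
    refine ((h1.add h2).sub (hasDerivAt_along_segment hF.1 x v t)).congr_deriv ?_
    simp only [id_eq, Nat.cast_ofNat, Nat.add_one_sub_one, pow_one]
    ring
  have hmono : MonotoneOn
      (fun t : ℝ => F x + t * ⟪gradient F x, v⟫_ℝ + L / 2 * t ^ 2 * ‖v‖ ^ 2 - F (x + t • v))
      (Set.Ici 0) := by
    refine monotoneOn_of_deriv_nonneg (convex_Ici 0)
      (fun t _ => (hd t).continuousAt.continuousWithinAt)
      (fun t _ => (hd t).differentiableAt.differentiableWithinAt) fun t ht => ?_
    rw [interior_Ici, Set.mem_Ioi] at ht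
    rw [(hd t).deriv]
    have h1 : ⟪gradient F (x + t • v) - gradient F x, v⟫_ℝ ≤ L * t * ‖v‖ ^ 2 := by
      refine (real_inner_le_norm _ _).trans ?_
      have h2 := hF.2 (x + t • v) x
      rw [add_sub_cancel_left, norm_smul, Real.norm_of_nonneg ht.le] at h2
      nlinarith [norm_nonneg v]
    rw [inner_sub_left] at h1
    linarith
  have h01 := hmono (Set.mem_Ici.2 le_rfl) (Set.mem_Ici.2 zero_le_one) zero_le_one
  simp only [zero_mul, zero_smul, one_mul, one_smul, hv, add_sub_cancel, add_zero] at h01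
  rw [hv]
  linarith

theorem gradient_eq_zero (hmin : ∀ x, F xstar ≤ F x) : gradient F xstar = 0 := by
  have h : IsLocalMin F xstar := Filter.Eventually.of_forall hmin
  simp [gradient, h.fderiv_eq_zero]

theorem norm_gradient_le (hF : IsSmooth L F) (hmin : ∀ x, F xstar ≤ F x)
    (x : EuclideanSpace ℝ (Fin d)) : ‖gradient F x‖ ≤ L * ‖x - xstar‖ := by
  simpa [gradient_eq_zero hmin] using hF.2 x xstar

theorem sub_min_le (hF : IsSmooth L F) (hmin : ∀ x, F xstar ≤ F x)
    (x : EuclideanSpace ℝ (Fin d)) : F x - F xstar ≤ L / 2 * ‖x - xstar‖ ^ 2 := by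
  have := hF.le_quadratic xstar x
  rw [gradient_eq_zero hmin, inner_zero_left] at this
  linarith

/-- A gradient step of length 1/L decreases F by ‖∇F(x)‖²/(2L) and cannot go below the minimum. -/
theorem norm_gradient_sq_le (hF : IsSmooth L F) (hL : 0 < L) (hmin : ∀ x, F xstar ≤ F x)
    (x : EuclideanSpace ℝ (Fin d)) : ‖gradient F x‖ ^ 2 ≤ 2 * L * (F x - F xstar) := by
  have h := hF.le_quadratic x (x - L⁻¹ • gradient F x)
  rw [show x - L⁻¹ • gradient F x - x = -(L⁻¹ • gradient F x) by abel, inner_neg_right,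
    real_inner_smul_right, real_inner_self_eq_norm_sq, norm_neg, norm_smul,
    Real.norm_of_nonneg (inv_nonneg.2 hL.le)] at h
  have h2 := hmin (x - L⁻¹ • gradient F x)
  have h3 : L * (F x - F xstar) ≥ ‖gradient F x‖ ^ 2 / 2 := by
    have : L / 2 * (L⁻¹ * ‖gradient F x‖) ^ 2 = L⁻¹ * ‖gradient F x‖ ^ 2 / 2 := by
      field_simp
    rw [this] at h
    have h4 : L⁻¹ * ‖gradient F x‖ ^ 2 / 2 ≤ F x - F xstar := by linarith
    have h5 := mul_le_mul_of_nonneg_left h4 hL.le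
    have h6 : L * (L⁻¹ * ‖gradient F x‖ ^ 2 / 2) = ‖gradient F x‖ ^ 2 / 2 := by
      field_simp
    linarith
  linarith

/-- Strong convexity bounds the difference quotients at `x` towards `y`; let t tend to 0 from the
right. For μ = 0 this is the gradient inequality of convex functions. -/
theorem strongConvex_lower (hF : IsSmooth L F) (hc : StrongConvexOn Set.univ μ F)
    (x y : EuclideanSpace ℝ (Fin d)) :
    F x + ⟪gradient F x, y - x⟫_ℝ + μ / 2 * ‖y - x‖ ^ 2 ≤ F y := by
  have hd := hasDerivAt_along_segment hF.1 x (y - x) 0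
  rw [zero_smul, add_zero] at hd
  have hlim : Filter.Tendsto (fun t : ℝ => t⁻¹ * (F (x + t • (y - x)) - F x))
      (nhdsWithin 0 (Set.Ioi 0)) (nhds ⟪gradient F x, y - x⟫_ℝ) := by
    have := hd.tendsto_slope_zero_right
    simpa using this
  have hlim2 : Filter.Tendsto (fun t : ℝ => F y - F x - (1 - t) * (μ / 2 * ‖y - x‖ ^ 2))
      (nhdsWithin 0 (Set.Ioi 0)) (nhds (F y - F x - (1 - 0) * (μ / 2 * ‖y - x‖ ^ 2))) := by
    refine Filter.Tendsto.mono_left (Continuous.tendsto ?_ 0) nhdsWithin_le_nhds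
    fun_prop
  have hle : ⟪gradient F x, y - x⟫_ℝ ≤ F y - F x - (1 - 0) * (μ / 2 * ‖y - x‖ ^ 2) := by
    refine le_of_tendsto_of_tendsto hlim hlim2 ?_
    filter_upwards [Ioo_mem_nhdsGT (zero_lt_one (α := ℝ))] with t ht
    have h := hc.2 (Set.mem_univ x) (Set.mem_univ y) (sub_nonneg.2 ht.2.le) ht.1.le (by ring)
    rw [show (1 - t) • x + t • y = x + t • (y - x) by module] at h
    rw [inv_mul_le_iff₀ ht.1, norm_sub_rev y x]
    simp only [smul_eq_mul] at h
    linarith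
  linarith

/-- This is μ ≤ L, in a form that also holds in dimension 0. -/
theorem mul_norm_sq_le (hF : IsSmooth L F) (hc : StrongConvexOn Set.univ μ F)
    (v : EuclideanSpace ℝ (Fin d)) : μ * ‖v‖ ^ 2 ≤ L * ‖v‖ ^ 2 := by
  have h1 := hF.strongConvex_lower hc 0 v
  have h2 := hF.le_quadratic 0 v
  rw [sub_zero] at h1 h2
  linarith

/-- Estimate F at x* + ∇F(x)/L twice: from below by convexity at `x`, from above by smoothness at
x*. -/
theorem cocoercive_at_min (hF : IsSmooth L F) (hL : 0 < L) (hc : ConvexOn ℝ Set.univ F)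
    (hmin : ∀ x, F xstar ≤ F x) (x : EuclideanSpace ℝ (Fin d)) :
    F x - F xstar + ‖gradient F x‖ ^ 2 / (2 * L) ≤ ⟪gradient F x, x - xstar⟫_ℝ := by
  have hc0 : StrongConvexOn Set.univ 0 F := strongConvexOn_zero.2 hc
  have h1 := hF.strongConvex_lower hc0 x (xstar + L⁻¹ • gradient F x)
  have h2 := hF.sub_min_le hmin (xstar + L⁻¹ • gradient F x)
  rw [show xstar + L⁻¹ • gradient F x - x = L⁻¹ • gradient F x - (x - xstar) by abel,
    inner_sub_right, real_inner_smul_right, real_inner_self_eq_norm_sq] at h1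
  rw [add_sub_cancel_left, norm_smul, Real.norm_of_nonneg (inv_nonneg.2 hL.le)] at h2
  have h3 : L / 2 * (L⁻¹ * ‖gradient F x‖) ^ 2 = ‖gradient F x‖ ^ 2 / (2 * L) := by
    field_simp
  have h4 : L⁻¹ * ‖gradient F x‖ ^ 2 =
      ‖gradient F x‖ ^ 2 / (2 * L) + ‖gradient F x‖ ^ 2 / (2 * L) := by
    field_simp
    ring
  linarith

/-- Cocoercivity supplies ‖∇F(x)‖²/L. A quarter of it pays for the squared step, the rest for
Young's inequality on the displacement term ⟨∇F(x), x - y⟩. -/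
theorem convex_step (hF : IsSmooth L F) (hL : 0 < L) (hc : ConvexOn ℝ Set.univ F)
    (hmin : ∀ x, F xstar ≤ F x) {η : ℝ} (hη : 0 ≤ η) (hηL : η ≤ 1 / (4 * L))
    (x y : EuclideanSpace ℝ (Fin d)) :
    ‖y - η • gradient F x - xstar‖ ^ 2 ≤ ‖y - xstar‖ ^ 2 +
      η * (-2 * (F x - F xstar) + 4 * L / 3 * ‖x - y‖ ^ 2) := by
  have h1 := hF.cocoercive_at_min hL hc hmin x
  rw [show y - η • gradient F x - xstar = (y - xstar) - η • gradient F x by abel,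
    norm_sub_sq_real, real_inner_smul_right, norm_smul, Real.norm_of_nonneg hη,
    real_inner_comm, show y - xstar = (x - xstar) - (x - y) by abel, inner_sub_right]
  have h2 : 2 * ⟪gradient F x, x - y⟫_ℝ ≤
      3 / (4 * L) * ‖gradient F x‖ ^ 2 + 4 * L / 3 * ‖x - y‖ ^ 2 := by
    have h3 := real_inner_le_norm (gradient F x) (x - y)
    have h4 : 0 ≤ 3 / (4 * L) * (‖gradient F x‖ - 4 * L / 3 * ‖x - y‖) ^ 2 := by positivity
    have h5 : 3 / (4 * L) * (‖gradient F x‖ - 4 * L / 3 * ‖x - y‖) ^ 2 =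
        3 / (4 * L) * ‖gradient F x‖ ^ 2 + 4 * L / 3 * ‖x - y‖ ^ 2 -
          2 * (‖gradient F x‖ * ‖x - y‖) := by
      field_simp
      ring
    linarith
  have h6 : η * ‖gradient F x‖ ^ 2 ≤ 1 / (4 * L) * ‖gradient F x‖ ^ 2 := by gcongr
  have h7 : 2 * (‖gradient F x‖ ^ 2 / (2 * L)) =
      3 / (4 * L) * ‖gradient F x‖ ^ 2 + 1 / (4 * L) * ‖gradient F x‖ ^ 2 := by
    field_simp
    ring
  have h8 : -2 * (⟪gradient F x, x - xstar⟫_ℝ - ⟪gradient F x, x - y⟫_ℝ) +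
      η * ‖gradient F x‖ ^ 2 ≤ -2 * (F x - F xstar) + 4 * L / 3 * ‖x - y‖ ^ 2 := by
    linarith
  have h9 := mul_le_mul_of_nonneg_left h8 hη
  linarith

/-- The bounds at `x` first produce a decrease -2(F(y) - F*) - μ‖x - x*‖² + L‖x - y‖². The
contraction -μ‖y - x*‖² is taken half from the quadratic term and half from the growth of F at `y`.
The remaining -(F(y) - F*) is moved back to `x` by smoothness at `y`, leaving 3/4 of F(x) - F*, of
which 1/4 pays for the squared step. -/
theorem strongConvex_step (hF : IsSmooth L F) (hL : 0 < L) (hμ : 0 ≤ μ)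
    (hc : StrongConvexOn Set.univ μ F) (hmin : ∀ x, F xstar ≤ F x)
    {η : ℝ} (hη : 0 ≤ η) (hηL : η ≤ 1 / (8 * L)) (x y : EuclideanSpace ℝ (Fin d)) :
    ‖y - η • gradient F x - xstar‖ ^ 2 ≤ Real.exp (-(μ * η)) * ‖y - xstar‖ ^ 2 +
      η * (-(1 / 2) * (F x - F xstar) + 7 / 2 * L * ‖x - y‖ ^ 2) := by
  have hexp := mul_le_mul_of_nonneg_right (Real.add_one_le_exp (-(μ * η)))
    (sq_nonneg ‖y - xstar‖)
  have h1 := hF.strongConvex_lower hc x xstar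
  have h2 := hF.le_quadratic x y
  have h3 := hF.strongConvex_lower hc xstar y
  rw [gradient_eq_zero hmin, inner_zero_left] at h3
  have h4 := hF.mul_norm_sq_le hc (x - y)
  have h5 : ‖y - xstar‖ ^ 2 ≤ 2 * ‖x - xstar‖ ^ 2 + 2 * ‖x - y‖ ^ 2 := by
    have h := parallelogram_law_with_norm ℝ (x - xstar) (x - y)
    rw [show x - xstar - (x - y) = y - xstar by abel] at h
    nlinarith [norm_nonneg (x - xstar + (x - y))]
  have h5' := mul_le_mul_of_nonneg_left h5 hμ
  have h6 := hF.le_quadratic y x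
  have h7 := hF.norm_gradient_sq_le hL hmin y
  have h8 := hF.norm_gradient_sq_le hL hmin x
  have h9 : ⟪gradient F y, x - y⟫_ℝ ≤ 1 / 3 * (F y - F xstar) + 3 / 2 * L * ‖x - y‖ ^ 2 := by
    have h10 := real_inner_le_norm (gradient F y) (x - y)
    have h11 : ‖gradient F y‖ * ‖x - y‖ ≤
        1 / (6 * L) * ‖gradient F y‖ ^ 2 + 3 / 2 * L * ‖x - y‖ ^ 2 := by
      have h12 : 0 ≤ 1 / (6 * L) * (‖gradient F y‖ - 3 * L * ‖x - y‖) ^ 2 := by positivity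
      have h13 : 1 / (6 * L) * (‖gradient F y‖ - 3 * L * ‖x - y‖) ^ 2 =
          1 / (6 * L) * ‖gradient F y‖ ^ 2 + 3 / 2 * L * ‖x - y‖ ^ 2 -
            ‖gradient F y‖ * ‖x - y‖ := by
        field_simp
        ring
      linarith
    have h14 : 1 / (6 * L) * ‖gradient F y‖ ^ 2 ≤ 1 / 3 * (F y - F xstar) := by
      have h15 : 1 / (6 * L) * ‖gradient F y‖ ^ 2 ≤ 1 / (6 * L) * (2 * L * (F y - F xstar)) := by
        gcongr
      have h16 : 1 / (6 * L) * (2 * L * (F y - F xstar)) = 1 / 3 * (F y - F xstar) := by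
        field_simp
        ring
      linarith
    linarith
  have h17 : η * ‖gradient F x‖ ^ 2 ≤ 1 / 4 * (F x - F xstar) := by
    have h18 : η * ‖gradient F x‖ ^ 2 ≤ 1 / (8 * L) * (2 * L * (F x - F xstar)) := by gcongr
    have h19 : 1 / (8 * L) * (2 * L * (F x - F xstar)) = 1 / 4 * (F x - F xstar) := by
      field_simp
      ring
    linarith
  rw [norm_sub_rev xstar x, show xstar - x = -(x - xstar) by abel, inner_neg_right] at h1
  rw [norm_sub_rev y x, show y - x = -(x - y) by abel, inner_neg_right] at h2
  have h20 : -2 * (⟪gradient F x, x - xstar⟫_ℝ - ⟪gradient F x, x - y⟫_ℝ) +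
      η * ‖gradient F x‖ ^ 2 ≤ -(μ * ‖y - xstar‖ ^ 2) + (-(1 / 2) * (F x - F xstar) +
        7 / 2 * L * ‖x - y‖ ^ 2) := by
    linarith
  have h21 := mul_le_mul_of_nonneg_left h20 hη
  have h22 : ‖y - η • gradient F x - xstar‖ ^ 2 = ‖y - xstar‖ ^ 2 +
      η * (-2 * (⟪gradient F x, x - xstar⟫_ℝ - ⟪gradient F x, x - y⟫_ℝ) +
        η * ‖gradient F x‖ ^ 2) := by
    rw [show y - η • gradient F x - xstar = (y - xstar) - η • gradient F x by abel,
      norm_sub_sq_real, real_inner_smul_right, norm_smul, Real.norm_of_nonneg hη,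
      real_inner_comm, ← inner_sub_right, show x - xstar - (x - y) = y - xstar by abel]
    ring
  linarith

/-- The descent lemma at `y`; the inner product of the two gradients is expanded by polarization,
dropping -‖∇F(y)‖²/2. -/
theorem nonconvex_step (hF : IsSmooth L F) {η : ℝ} (hη : 0 ≤ η)
    (x y n : EuclideanSpace ℝ (Fin d)) :
    F (y - η • (gradient F x + n)) ≤ F y +
      η * (-(1 / 2) * ‖gradient F x‖ ^ 2 + L ^ 2 / 2 * ‖x - y‖ ^ 2) -
        η * ⟪gradient F y, n⟫_ℝ + L / 2 * η ^ 2 * ‖gradient F x + n‖ ^ 2 := by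
  have h1 := hF.le_quadratic y (y - η • (gradient F x + n))
  rw [show y - η • (gradient F x + n) - y = -(η • (gradient F x + n)) by abel, inner_neg_right,
    real_inner_smul_right, inner_add_right, norm_neg, norm_smul, Real.norm_of_nonneg hη,
    mul_pow] at h1
  have h2 : ‖gradient F y - gradient F x‖ ^ 2 ≤ L ^ 2 * ‖x - y‖ ^ 2 := by
    rw [← mul_pow, norm_sub_rev x y]
    exact pow_le_pow_left₀ (norm_nonneg _) (hF.2 y x) 2
  rw [norm_sub_sq_real] at h2
  have h3 : -⟪gradient F y, gradient F x⟫_ℝ ≤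
      -(1 / 2) * ‖gradient F x‖ ^ 2 + L ^ 2 / 2 * ‖x - y‖ ^ 2 := by
    nlinarith [sq_nonneg ‖gradient F y‖]
  have h4 := mul_le_mul_of_nonneg_left h3 hη
  linarith

end IsSmooth

end Smooth

end AsyncSGD

namespace AsyncSGD

/-! ### Fresh samples: variance and orthogonality of the noise. -/

section Noise

open scoped InnerProductSpace

variable {d : ℕ} {Ω Ξ : Type*} {m : MeasurableSpace Ω} [mΩ : MeasurableSpace Ω]
  [MeasurableSpace Ξ] {P : Measure Ω} {D : Measure Ξ}
  {F : EuclideanSpace ℝ (Fin d) → ℝ}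
  {g : EuclideanSpace ℝ (Fin d) → Ξ → EuclideanSpace ℝ (Fin d)} {L σ : ℝ}

theorem integrable_inner_of_memLp {E : Type*} [NormedAddCommGroup E] [InnerProductSpace ℝ E]
    {u v : Ω → E} (hu : MemLp u 2 P) (hv : MemLp v 2 P) :
    Integrable (fun ω => ⟪u ω, v ω⟫_ℝ) P := by
  refine (hu.norm.integrable_mul hv.norm).mono' (hu.1.inner hv.1) ?_
  filter_upwards with ω
  exact norm_inner_le_norm _ _

/-- A random variable independent of a σ-algebra is jointly distributed with the variables of that
σ-algebra according to a product law. -/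
theorem map_prodMk_of_indep {α : Type*} [MeasurableSpace α] [IsProbabilityMeasure P]
    (hm : m ≤ mΩ) {U : Ω → α} (hU : Measurable[m] U) {Z : Ω → Ξ}
    (hZ : Measurable Z) (hlaw : P.map Z = D) (hind : Indep m (MeasurableSpace.comap Z inferInstance) P) :
    P.map (fun ω => (U ω, Z ω)) = (P.map U).prod D := by
  rw [← hlaw]
  refine (indepFun_iff_map_prod_eq_prod_map_map (hU.mono hm le_rfl).aemeasurable
    hZ.aemeasurable).1 ?_
  exact (IndepFun_iff_Indep _ _ _).2 (indep_of_indep_of_le_left hind hU.comap_le)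

/-- The noise of the stochastic gradients. -/
noncomputable def noise (F : EuclideanSpace ℝ (Fin d) → ℝ)
    (g : EuclideanSpace ℝ (Fin d) → Ξ → EuclideanSpace ℝ (Fin d))
    (x : EuclideanSpace ℝ (Fin d)) (z : Ξ) : EuclideanSpace ℝ (Fin d) := g x z - gradient F x

theorem measurable_noise (hg : IsStochasticGradient D F g) (hF : IsSmooth L F) :
    Measurable (fun p : EuclideanSpace ℝ (Fin d) × Ξ => noise F g p.1 p.2) :=
  hg.measurable.sub (hF.continuous_gradient.measurable.comp measurable_fst)

/-- Under the product law the point `U` can be frozen, and the variance bound holds at every fixed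
point. Tonelli is used because integrability is itself part of the claim. -/
theorem memLp_noise [IsProbabilityMeasure P] [IsProbabilityMeasure D]
    (hg : IsStochasticGradient D F g) (hv : HasBoundedVariance D F g σ)
    (hF : IsSmooth L F) (hm : m ≤ mΩ)
    {U : Ω → EuclideanSpace ℝ (Fin d)} (hU : Measurable[m] U) {Z : Ω → Ξ}
    (hZ : Measurable Z) (hlaw : P.map Z = D)
    (hind : Indep m (MeasurableSpace.comap Z inferInstance) P) :
    MemLp (fun ω => noise F g (U ω) (Z ω)) 2 P ∧
      ∫ ω, ‖noise F g (U ω) (Z ω)‖ ^ 2 ∂P ≤ σ ^ 2 := by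
  have hU' : Measurable U := hU.mono hm le_rfl
  have hn := measurable_noise hg hF
  have hmeas : Measurable (fun ω => noise F g (U ω) (Z ω)) := hn.comp (hU'.prodMk hZ)
  have hprod := map_prodMk_of_indep hm hU hZ hlaw hind
  have : IsProbabilityMeasure (P.map U) := Measure.isProbabilityMeasure_map hU'.aemeasurable
  have hle : ∫⁻ ω, ENNReal.ofReal (‖noise F g (U ω) (Z ω)‖ ^ 2) ∂P ≤ ENNReal.ofReal (σ ^ 2) := by
    calc ∫⁻ ω, ENNReal.ofReal (‖noise F g (U ω) (Z ω)‖ ^ 2) ∂P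
        = ∫⁻ p, ENNReal.ofReal (‖noise F g p.1 p.2‖ ^ 2)
            ∂(P.map (fun ω => (U ω, Z ω))) :=
          (lintegral_map (f := fun p : EuclideanSpace ℝ (Fin d) × Ξ =>
            ENNReal.ofReal (‖noise F g p.1 p.2‖ ^ 2))
            (ENNReal.measurable_ofReal.comp (hn.norm.pow_const 2)) (hU'.prodMk hZ)).symm
      _ = ∫⁻ u, ∫⁻ z, ENNReal.ofReal (‖noise F g u z‖ ^ 2) ∂D ∂(P.map U) := by
          rw [hprod]
          exact lintegral_prod _
            (ENNReal.measurable_ofReal.comp (hn.norm.pow_const 2)).aemeasurable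
      _ ≤ ∫⁻ _u, ENNReal.ofReal (σ ^ 2) ∂(P.map U) := by
          refine lintegral_mono fun u => ?_
          change ∫⁻ z, ENNReal.ofReal (‖g u z - gradient F u‖ ^ 2) ∂D ≤ _
          rw [← ofReal_integral_eq_lintegral_ofReal (hv u).1
            (Filter.Eventually.of_forall fun z => sq_nonneg _)]
          exact ENNReal.ofReal_le_ofReal (hv u).2
      _ = ENNReal.ofReal (σ ^ 2) := by simp
  have hint : Integrable (fun ω => ‖noise F g (U ω) (Z ω)‖ ^ 2) P := by
    refine ⟨(hmeas.norm.pow_const 2).aestronglyMeasurable, ?_⟩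
    rw [hasFiniteIntegral_iff_ofReal (Filter.Eventually.of_forall fun z => sq_nonneg _)]
    exact hle.trans_lt ENNReal.ofReal_lt_top
  refine ⟨(memLp_two_iff_integrable_sq_norm hmeas.aestronglyMeasurable).2 hint, ?_⟩
  rw [← ofReal_integral_eq_lintegral_ofReal hint
    (Filter.Eventually.of_forall fun z => sq_nonneg _)] at hle
  exact (ENNReal.ofReal_le_ofReal_iff (sq_nonneg σ)).1 hle

/-- Fubini for the law of ((U, W), Z): with the pair frozen, the noise integrates to zero by
unbiasedness. -/
theorem integral_inner_noise_eq_zero [IsProbabilityMeasure P] [IsProbabilityMeasure D]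
    (hg : IsStochasticGradient D F g)
    (hv : HasBoundedVariance D F g σ)
    (hF : IsSmooth L F) (hm : m ≤ mΩ)
    {U W : Ω → EuclideanSpace ℝ (Fin d)} (hU : Measurable[m] U) (hW : Measurable[m] W)
    (hW2 : MemLp W 2 P) {Z : Ω → Ξ} (hZ : Measurable Z) (hlaw : P.map Z = D)
    (hind : Indep m (MeasurableSpace.comap Z inferInstance) P) :
    ∫ ω, ⟪W ω, noise F g (U ω) (Z ω)⟫_ℝ ∂P = 0 := by
  have hU' : Measurable U := hU.mono hm le_rfl
  have hW' : Measurable W := hW.mono hm le_rfl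
  have hn := measurable_noise hg hF
  have hprod := map_prodMk_of_indep hm (hU.prodMk hW) hZ hlaw hind
  have hmeas : Measurable (fun p : (EuclideanSpace ℝ (Fin d) × EuclideanSpace ℝ (Fin d)) × Ξ =>
      ⟪p.1.2, noise F g p.1.1 p.2⟫_ℝ) :=
    (measurable_snd.comp measurable_fst).inner
      (hn.comp ((measurable_fst.comp measurable_fst).prodMk measurable_snd))
  have hpair : Measurable (fun ω => ((U ω, W ω), Z ω)) := (hU'.prodMk hW').prodMk hZ
  have : IsProbabilityMeasure (P.map fun ω => (U ω, W ω)) :=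
    Measure.isProbabilityMeasure_map (hU'.prodMk hW').aemeasurable
  have hint : Integrable (fun ω => ⟪W ω, noise F g (U ω) (Z ω)⟫_ℝ) P :=
    integrable_inner_of_memLp hW2 (memLp_noise hg hv hF hm hU hZ hlaw hind).1
  have hint' : Integrable
      (fun p : (EuclideanSpace ℝ (Fin d) × EuclideanSpace ℝ (Fin d)) × Ξ =>
        ⟪p.1.2, noise F g p.1.1 p.2⟫_ℝ) ((P.map fun ω => (U ω, W ω)).prod D) := by
    rw [← hprod, integrable_map_measure hmeas.aestronglyMeasurable hpair.aemeasurable]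
    exact hint
  calc ∫ ω, ⟪W ω, noise F g (U ω) (Z ω)⟫_ℝ ∂P
      = ∫ p, ⟪p.1.2, noise F g p.1.1 p.2⟫_ℝ ∂(P.map fun ω => ((U ω, W ω), Z ω)) :=
        (integral_map hpair.aemeasurable hmeas.aestronglyMeasurable).symm
    _ = ∫ u, ∫ z, ⟪u.2, noise F g u.1 z⟫_ℝ ∂D ∂(P.map fun ω => (U ω, W ω)) := by
        rw [hprod]
        exact integral_prod _ hint'
    _ = 0 := by
        refine integral_eq_zero_of_ae (Filter.Eventually.of_forall fun u => ?_)
        have hi : Integrable (noise F g u.1) D := (hg.integrable u.1).sub (integrable_const _)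
        change ∫ z, ⟪u.2, noise F g u.1 z⟫_ℝ ∂D = 0
        rw [integral_inner hi]
        have : ∫ z, noise F g u.1 z ∂D = 0 := by
          unfold noise
          rw [integral_sub (hg.integrable u.1) (integrable_const _), hg.unbiased]
          simp
        rw [this, inner_zero_right]

theorem integral_norm_sub_smul_sq {E : Type*} [NormedAddCommGroup E] [InnerProductSpace ℝ E]
    {u n : Ω → E} (hu : MemLp u 2 P) (hn : MemLp n 2 P) (h : ∫ ω, ⟪u ω, n ω⟫_ℝ ∂P = 0) (c : ℝ) :
    ∫ ω, ‖u ω - c • n ω‖ ^ 2 ∂P = ∫ ω, ‖u ω‖ ^ 2 ∂P + c ^ 2 * ∫ ω, ‖n ω‖ ^ 2 ∂P := by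
  have h1 : ∀ ω, ‖u ω - c • n ω‖ ^ 2 =
      ‖u ω‖ ^ 2 - (2 * c) * ⟪u ω, n ω⟫_ℝ + c ^ 2 * ‖n ω‖ ^ 2 := by
    intro ω
    rw [norm_sub_sq_real, real_inner_smul_right, norm_smul, mul_pow, Real.norm_eq_abs, sq_abs]
    ring
  have hu' := (memLp_two_iff_integrable_sq_norm hu.1).1 hu
  have hn' := (memLp_two_iff_integrable_sq_norm hn.1).1 hn
  have hi := integrable_inner_of_memLp hu hn
  simp_rw [h1]
  have hd : Integrable (fun ω => ‖u ω‖ ^ 2 - (2 * c) * ⟪u ω, n ω⟫_ℝ) P :=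
    hu'.sub (hi.const_mul _)
  rw [integral_add hd (hn'.const_mul _), integral_sub hu' (hi.const_mul _), integral_const_mul, integral_const_mul, h]
  ring

/-- Pairwise uncorrelated variables: the second moment of a linear combination. -/
theorem integral_norm_sum_smul_sq_le {E ι : Type*} [NormedAddCommGroup E] [InnerProductSpace ℝ E]
    (T : Finset ι) (c : ι → ℝ) (n : ι → Ω → E) (hn : ∀ i, MemLp (n i) 2 P)
    (hvar : ∀ i, ∫ ω, ‖n i ω‖ ^ 2 ∂P ≤ σ ^ 2)
    (hort : ∀ i j, i ≠ j → ∫ ω, ⟪n i ω, n j ω⟫_ℝ ∂P = 0) :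
    ∫ ω, ‖∑ i ∈ T, c i • n i ω‖ ^ 2 ∂P ≤ σ ^ 2 * ∑ i ∈ T, c i ^ 2 := by
  classical
  induction T using Finset.induction_on with
  | empty => simp
  | insert a T ha ih =>
    have hs : MemLp (fun ω => ∑ i ∈ T, c i • n i ω) 2 P :=
      memLp_finsetSum T fun i _ => (hn i).const_smul (c i)
    have h0 : ∫ ω, ⟪∑ i ∈ T, c i • n i ω, n a ω⟫_ℝ ∂P = 0 := by
      simp_rw [sum_inner, real_inner_smul_left]
      rw [integral_finsetSum T fun i _ => (integrable_inner_of_memLp (hn i) (hn a)).const_mul _]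
      refine Finset.sum_eq_zero fun i hi => ?_
      rw [integral_const_mul, hort i a (fun h => ha (h ▸ hi)), mul_zero]
    have h1 := integral_norm_sub_smul_sq hs (hn a) h0 (-c a)
    have h2 : ∀ ω, ∑ i ∈ insert a T, c i • n i ω = ∑ i ∈ T, c i • n i ω - (-c a) • n a ω := by
      intro ω
      rw [Finset.sum_insert ha, neg_smul, sub_neg_eq_add, add_comm]
    simp_rw [h2]
    rw [h1, Finset.sum_insert ha]
    have := mul_le_mul_of_nonneg_left (hvar a) (sq_nonneg (-c a))
    nlinarith

end Noise

end AsyncSGD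

namespace AsyncSGD

/-! ### The virtual sequence and the gradients in flight. -/

section VirtualIterate

variable {M : ℕ} {E Ξ : Type*} [AddCommGroup E] [Module ℝ E]

/-- The virtual iterate, which contains all gradients whose computation has been started at
`x_0, …, x_k`. -/
noncomputable def virtualIterate (g : E → Ξ → E) (γ : ℕ → ℝ) (x₀ : E) (s : ℕ → Fin M)
    (ξ : ℕ → Fin M → Ξ) (K : ℕ) : ℕ → E
  | 0 => x₀ - ∑ m, jobStep γ s K 0 m • g x₀ (ξ 0 m)
  | k + 1 => virtualIterate g γ x₀ s ξ K k -
      stepHat γ s K (k + 1) • g (iterate g γ x₀ s ξ (k + 1)) (ξ (k + 1) (s (k + 1)))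

/-- Before a delivery x_k - y_k is the sum over all `M` pending jobs. The delivery removes the term
of the delivering worker, and the new job entered into y refills that slot. -/
theorem iterate_sub_virtualIterate_aux (g : E → Ξ → E) (γ : ℕ → ℝ) (x₀ : E) (s : ℕ → Fin M)
    (ξ : ℕ → Fin M → Ξ) (K k : ℕ) (hk : k < K) :
    iterate g γ x₀ s ξ k - virtualIterate g γ x₀ s ξ K k =
      ∑ m, jobStep γ s K (prev s (k + 1) m) m •
        g (iterate g γ x₀ s ξ (prev s (k + 1) m)) (ξ (prev s (k + 1) m) m) ∧
    iterate g γ x₀ s ξ (k + 1) - virtualIterate g γ x₀ s ξ K k =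
      ∑ m ∈ Finset.univ.filter (fun m => s (k + 1) ≠ m), jobStep γ s K (prev s (k + 1) m) m •
        g (iterate g γ x₀ s ξ (prev s (k + 1) m)) (ξ (prev s (k + 1) m) m) := by
  have key : ∀ k < K, iterate g γ x₀ s ξ k - virtualIterate g γ x₀ s ξ K k =
      ∑ m, jobStep γ s K (prev s (k + 1) m) m •
        g (iterate g γ x₀ s ξ (prev s (k + 1) m)) (ξ (prev s (k + 1) m) m) →
      iterate g γ x₀ s ξ (k + 1) - virtualIterate g γ x₀ s ξ K k =
      ∑ m ∈ Finset.univ.filter (fun m => s (k + 1) ≠ m), jobStep γ s K (prev s (k + 1) m) m •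
        g (iterate g γ x₀ s ξ (prev s (k + 1) m)) (ξ (prev s (k + 1) m) m) := by
    intro k hk h
    -- The stepsize of the delivery is the one with which this gradient was entered into y; here `k
    -- + 1 ≤ K` is needed.
    have h1 : γ (delay s (k + 1) (s (k + 1))) =
        jobStep γ s K (prev s (k + 1) (s (k + 1))) (s (k + 1)) := by
      unfold jobStep
      rw [jobDelay_prev s (by omega) hk]
    rw [← Finset.add_sum_erase _ _ (Finset.mem_univ (s (k + 1)))] at h
    rw [iterate, h1, sub_right_comm, h, add_sub_cancel_left]
    refine Finset.sum_congr ?_ fun _ _ => rfl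
    ext m
    simp [eq_comm]
  have main : ∀ k < K, iterate g γ x₀ s ξ k - virtualIterate g γ x₀ s ξ K k =
      ∑ m, jobStep γ s K (prev s (k + 1) m) m •
        g (iterate g γ x₀ s ξ (prev s (k + 1) m)) (ξ (prev s (k + 1) m) m) := by
    intro k
    induction k with
    | zero =>
      intro _
      rw [virtualIterate, iterate, sub_sub_cancel]
      simp only [zero_add, prev_one]
      refine Finset.sum_congr rfl fun m _ => ?_
      rw [iterate]
    | succ k ih =>
      intro hk
      have h := key k (by omega) (ih (by omega))
      rw [virtualIterate, sub_sub_eq_add_sub, add_sub_right_comm, h,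
        ← Finset.add_sum_erase Finset.univ _ (Finset.mem_univ (s (k + 1))), add_comm]
      rw [prev_succ s (by omega), if_pos rfl]
      congr 1
      refine Finset.sum_congr ?_ fun m hm => ?_
      · ext m
        simp [eq_comm]
      · have hm : s (k + 1) ≠ m := fun h => (Finset.mem_erase.1 hm).1 h.symm
        rw [prev_succ s k.succ_pos, if_neg hm]
  exact ⟨main k hk, key k hk (main k hk)⟩

/-- An iterate differs from the virtual iterate by the gradients in flight. -/
theorem iterate_sub_virtualIterate (g : E → Ξ → E) (γ : ℕ → ℝ) (x₀ : E) (s : ℕ → Fin M)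
    (ξ : ℕ → Fin M → Ξ) (K k : ℕ) (hk : k < K) :
    iterate g γ x₀ s ξ (k + 1) - virtualIterate g γ x₀ s ξ K k =
      ∑ m ∈ Finset.univ.filter (fun m => s (k + 1) ≠ m), jobStep γ s K (prev s (k + 1) m) m •
        g (iterate g γ x₀ s ξ (prev s (k + 1) m)) (ξ (prev s (k + 1) m) m) :=
  (iterate_sub_virtualIterate_aux g γ x₀ s ξ K k hk).2

end VirtualIterate

/-! ### Splitting the gradients of a run into mean and noise. -/

section RunNoise

variable {M d : ℕ} {Ω Ξ : Type*} {F : EuclideanSpace ℝ (Fin d) → ℝ}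
  {g : EuclideanSpace ℝ (Fin d) → Ξ → EuclideanSpace ℝ (Fin d)} {ξ : ℕ → Fin M → Ω → Ξ}
  (γ : ℕ → ℝ) (x₀ : EuclideanSpace ℝ (Fin d)) (s : ℕ → Fin M)

/-- The noise of the gradient that worker `m` computes at `x_j`. -/
noncomputable def runNoise (F : EuclideanSpace ℝ (Fin d) → ℝ)
    (g : EuclideanSpace ℝ (Fin d) → Ξ → EuclideanSpace ℝ (Fin d)) (ξ : ℕ → Fin M → Ω → Ξ)
    (j : ℕ) (m : Fin M) (ω : Ω) : EuclideanSpace ℝ (Fin d) :=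
  noise F g (iterate g γ x₀ s (fun j m => ξ j m ω) j) (ξ j m ω)

theorem gradient_add_runNoise (j : ℕ) (m : Fin M) (ω : Ω) :
    g (iterate g γ x₀ s (fun j m => ξ j m ω) j) (ξ j m ω) =
      gradient F (iterate g γ x₀ s (fun j m => ξ j m ω) j) + runNoise γ x₀ s F g ξ j m ω := by
  unfold runNoise noise
  abel

theorem virtualIterate_zero_eq (K : ℕ) (ω : Ω) :
    virtualIterate g γ x₀ s (fun j m => ξ j m ω) K 0 =
      x₀ - (∑ m, jobStep γ s K 0 m) • gradient F x₀ -
        ∑ m, jobStep γ s K 0 m • runNoise γ x₀ s F g ξ 0 m ω := by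
  have h : ∀ m, g x₀ (ξ 0 m ω) = gradient F x₀ + runNoise γ x₀ s F g ξ 0 m ω := by
    intro m
    have := gradient_add_runNoise (F := F) (g := g) (ξ := ξ) γ x₀ s 0 m ω
    rwa [iterate] at this
  rw [virtualIterate]
  simp_rw [h, smul_add]
  rw [Finset.sum_add_distrib, ← Finset.sum_smul, sub_sub]

theorem virtualIterate_succ_eq (K k : ℕ) (ω : Ω) :
    virtualIterate g γ x₀ s (fun j m => ξ j m ω) K (k + 1) =
      virtualIterate g γ x₀ s (fun j m => ξ j m ω) K k - stepHat γ s K (k + 1) •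
        (gradient F (iterate g γ x₀ s (fun j m => ξ j m ω) (k + 1)) +
          runNoise γ x₀ s F g ξ (k + 1) (s (k + 1)) ω) := by
  rw [virtualIterate, ← gradient_add_runNoise]

end RunNoise

/-! ### Measurability and second moments for a fixed schedule. -/

section FixedSchedule

open scoped InnerProductSpace

variable {M d : ℕ} {Ω Ξ : Type*} [MeasurableSpace Ξ] {D : Measure Ξ}
  {F : EuclideanSpace ℝ (Fin d) → ℝ}
  {g : EuclideanSpace ℝ (Fin d) → Ξ → EuclideanSpace ℝ (Fin d)} {L σ : ℝ}
  {xstar : EuclideanSpace ℝ (Fin d)} {ξ : ℕ → Fin M → Ω → Ξ}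

/-- The σ-algebra generated by a set of samples. -/
abbrev sampleSigma (ξ : ℕ → Fin M → Ω → Ξ) (T : Set (ℕ × Fin M)) : MeasurableSpace Ω :=
  ⨆ p ∈ T, MeasurableSpace.comap (ξ p.1 p.2) inferInstance

theorem sampleSigma_mono {S T : Set (ℕ × Fin M)} (h : S ⊆ T) :
    sampleSigma ξ S ≤ sampleSigma ξ T :=
  biSup_mono h

theorem measurable_sample {T : Set (ℕ × Fin M)} {j : ℕ} {m : Fin M} (h : (j, m) ∈ T) :
    Measurable[sampleSigma ξ T] (ξ j m) := by
  refine Measurable.of_comap_le ?_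
  exact le_iSup₂_of_le (f := fun (p : ℕ × Fin M) (_ : p ∈ T) =>
    MeasurableSpace.comap (ξ p.1 p.2) inferInstance) (j, m) h le_rfl

/-- The samples with iteration index below `k`. -/
def before (M k : ℕ) : Set (ℕ × Fin M) := {p | p.1 < k}

theorem before_mono {j k : ℕ} (h : j ≤ k) : before M j ⊆ before M k :=
  fun _ hp => lt_of_lt_of_le hp h

theorem measurable_smul_gradient_at {m : MeasurableSpace Ω} (hg : IsStochasticGradient D F g)
    {U : Ω → EuclideanSpace ℝ (Fin d)} (hU : Measurable[m] U) {Z : Ω → Ξ} (hZ : Measurable[m] Z)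
    (c : ℝ) : Measurable[m] (fun ω => c • g (U ω) (Z ω)) :=
  (hg.measurable.comp (hU.prodMk hZ)).const_smul c

variable (γ : ℕ → ℝ) (x₀ : EuclideanSpace ℝ (Fin d)) (s : ℕ → Fin M)

/-- Only gradients started at earlier iterates have been delivered, so the samples of index `k` are
fresh at x_k. -/
theorem measurable_iterate (hg : IsStochasticGradient D F g) (k : ℕ) :
    Measurable[sampleSigma ξ (before M k)]
      (fun ω => iterate g γ x₀ s (fun j m => ξ j m ω) k) := by
  induction k using Nat.strong_induction_on with
  | _ k ih =>
    cases k with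
    | zero =>
      simp_rw [iterate]
      exact measurable_const
    | succ k =>
      have hl := prev_lt s (Nat.succ_pos k) (s (k + 1))
      simp_rw [iterate]
      have h1 := (ih k (by omega)).mono (sampleSigma_mono (ξ := ξ) (before_mono k.le_succ)) le_rfl
      have h2 := (ih _ hl).mono (sampleSigma_mono (ξ := ξ) (before_mono hl.le)) le_rfl
      have h3 : Measurable[sampleSigma ξ (before M (k + 1))]
          (ξ (prev s (k + 1) (s (k + 1))) (s (k + 1))) := measurable_sample hl
      exact h1.sub (measurable_smul_gradient_at hg h2 h3 _)

/-- y_k already uses samples of index `k`, but none of index `k + 1`, which drive its next step. -/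
theorem measurable_virtualIterate (hg : IsStochasticGradient D F g) (K k : ℕ) :
    Measurable[sampleSigma ξ (before M (k + 1))]
      (fun ω => virtualIterate g γ x₀ s (fun j m => ξ j m ω) K k) := by
  induction k with
  | zero =>
    simp_rw [virtualIterate]
    refine measurable_const.sub (Finset.measurable_sum _ fun m _ => ?_)
    have h3 : Measurable[sampleSigma ξ (before M (0 + 1))] (ξ 0 m) :=
      measurable_sample (Nat.zero_lt_one : (0 : ℕ) < 0 + 1)
    exact measurable_smul_gradient_at hg measurable_const h3 _
  | succ k ih =>
    simp_rw [virtualIterate]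
    have h1 := ih.mono (sampleSigma_mono (ξ := ξ) (before_mono (k + 1).le_succ)) le_rfl
    have h2 := (measurable_iterate (ξ := ξ) γ x₀ s hg (k + 1)).mono
      (sampleSigma_mono (ξ := ξ) (before_mono (k + 1).le_succ)) le_rfl
    have h3 : Measurable[sampleSigma ξ (before M (k + 1 + 1))] (ξ (k + 1) (s (k + 1))) :=
      measurable_sample (Nat.lt_succ_self (k + 1))
    exact h1.sub (measurable_smul_gradient_at hg h2 h3 _)

variable [mΩ : MeasurableSpace Ω] {P : Measure Ω}

theorem IsIIDSample.sampleSigma_le (hξ : IsIIDSample P D ξ) (T : Set (ℕ × Fin M)) :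
    sampleSigma ξ T ≤ mΩ :=
  iSup₂_le fun p _ => (hξ.measurable p.1 p.2).comap_le

theorem IsIIDSample.indep_sampleSigma (hξ : IsIIDSample P D ξ) {T : Set (ℕ × Fin M)} {j : ℕ}
    {m : Fin M} (h : (j, m) ∉ T) :
    Indep (sampleSigma ξ T) (MeasurableSpace.comap (ξ j m) inferInstance) P := by
  have h1 := indep_iSup_of_disjoint (fun p : ℕ × Fin M => (hξ.measurable p.1 p.2).comap_le)
    hξ.indep.iIndep (Set.disjoint_singleton_right.2 h)
  simpa [sampleSigma] using h1

variable [IsProbabilityMeasure P] [IsProbabilityMeasure D]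

theorem memLp_runNoise (hg : IsStochasticGradient D F g) (hv : HasBoundedVariance D F g σ)
    (hF : IsSmooth L F) (hξ : IsIIDSample P D ξ) (j : ℕ) (m : Fin M) :
    MemLp (runNoise γ x₀ s F g ξ j m) 2 P ∧
      ∫ ω, ‖runNoise γ x₀ s F g ξ j m ω‖ ^ 2 ∂P ≤ σ ^ 2 :=
  memLp_noise hg hv hF (hξ.sampleSigma_le _) (measurable_iterate γ x₀ s hg j)
    (hξ.measurable j m) (hξ.law j m) (hξ.indep_sampleSigma (fun h => lt_irrefl j h))

/-- The noise is uncorrelated with everything determined by other samples, those of the point at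
which the gradient is computed included. -/
theorem integral_inner_runNoise (hg : IsStochasticGradient D F g)
    (hv : HasBoundedVariance D F g σ) (hF : IsSmooth L F) (hξ : IsIIDSample P D ξ) (j : ℕ)
    (m : Fin M) {T : Set (ℕ × Fin M)} (hT : before M j ⊆ T) (hjm : (j, m) ∉ T)
    {W : Ω → EuclideanSpace ℝ (Fin d)} (hW : Measurable[sampleSigma ξ T] W) (hW2 : MemLp W 2 P) :
    ∫ ω, ⟪W ω, runNoise γ x₀ s F g ξ j m ω⟫_ℝ ∂P = 0 :=
  integral_inner_noise_eq_zero hg hv hF (hξ.sampleSigma_le T)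
    ((measurable_iterate γ x₀ s hg j).mono (sampleSigma_mono hT) le_rfl) hW hW2
    (hξ.measurable j m) (hξ.law j m) (hξ.indep_sampleSigma hjm)

/-- Adjoin the sample of the earlier noise to those before the later one: the earlier noise becomes
measurable while the later sample stays outside. This covers different workers at the same iterate
as well. -/
theorem integral_inner_runNoise_runNoise (hg : IsStochasticGradient D F g)
    (hv : HasBoundedVariance D F g σ) (hF : IsSmooth L F) (hξ : IsIIDSample P D ξ)
    {i j : ℕ} {l m : Fin M} (h : (i, l) ≠ (j, m)) :
    ∫ ω, ⟪runNoise γ x₀ s F g ξ i l ω, runNoise γ x₀ s F g ξ j m ω⟫_ℝ ∂P = 0 := by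
  wlog hij : i ≤ j generalizing i j l m
  · rw [← this h.symm (not_le.1 hij).le]
    exact integral_congr_ae (Filter.Eventually.of_forall fun ω => real_inner_comm _ _)
  refine integral_inner_runNoise γ x₀ s hg hv hF hξ j m (T := insert (i, l) (before M j))
    (Set.subset_insert _ _) ?_ ?_ (memLp_runNoise γ x₀ s hg hv hF hξ i l).1
  · rintro (h' | h')
    · exact h h'.symm
    · exact lt_irrefl j h'
  · have h1 := (measurable_iterate (ξ := ξ) γ x₀ s hg i).mono (sampleSigma_mono (ξ := ξ)
      ((before_mono hij).trans (Set.subset_insert (i, l) (before M j)))) le_rfl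
    exact (measurable_noise hg hF).comp
      (h1.prodMk (measurable_sample (Set.mem_insert (i, l) (before M j))))

theorem memLp_smul_gradient_at (hg : IsStochasticGradient D F g)
    (hv : HasBoundedVariance D F g σ) (hF : IsSmooth L F) (hξ : IsIIDSample P D ξ) {j : ℕ}
    {m : Fin M}
    (h : MemLp (fun ω => gradient F (iterate g γ x₀ s (fun j m => ξ j m ω) j)) 2 P) (c : ℝ) :
    MemLp (fun ω => c • g (iterate g γ x₀ s (fun j m => ξ j m ω) j) (ξ j m ω)) 2 P := by
  simp_rw [gradient_add_runNoise (F := F)]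
  exact (h.add (memLp_runNoise γ x₀ s hg hv hF hξ j m).1).const_smul c

/-- The linear growth of ∇F around x* lets second moments propagate along the run without bounded
gradients. -/
theorem memLp_gradient (hF : IsSmooth L F) (hmin : ∀ x, F xstar ≤ F x)
    {U : Ω → EuclideanSpace ℝ (Fin d)} (hU : MemLp U 2 P) :
    MemLp (fun ω => gradient F (U ω)) 2 P :=
  (hU.sub (memLp_const xstar)).of_le_mul
    (hF.continuous_gradient.comp_aestronglyMeasurable hU.1)
    (Filter.Eventually.of_forall fun ω => hF.norm_gradient_le hmin (U ω))

theorem memLp_iterate (hg : IsStochasticGradient D F g) (hv : HasBoundedVariance D F g σ)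
    (hF : IsSmooth L F) (hmin : ∀ x, F xstar ≤ F x) (hξ : IsIIDSample P D ξ) (k : ℕ) :
    MemLp (fun ω => iterate g γ x₀ s (fun j m => ξ j m ω) k) 2 P := by
  induction k using Nat.strong_induction_on with
  | _ k ih =>
    cases k with
    | zero =>
      simp_rw [iterate]
      exact memLp_const x₀
    | succ k =>
      have hl := prev_lt s (Nat.succ_pos k) (s (k + 1))
      simp_rw [iterate]
      exact (ih k (by omega)).sub (memLp_smul_gradient_at γ x₀ s hg hv hF hξ
        (memLp_gradient hF hmin (ih _ hl)) _)

theorem memLp_virtualIterate (hg : IsStochasticGradient D F g) (hv : HasBoundedVariance D F g σ)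
    (hF : IsSmooth L F) (hmin : ∀ x, F xstar ≤ F x) (hξ : IsIIDSample P D ξ) (K k : ℕ) :
    MemLp (fun ω => virtualIterate g γ x₀ s (fun j m => ξ j m ω) K k) 2 P := by
  have hstep : ∀ j m (c : ℝ),
      MemLp (fun ω => c • g (iterate g γ x₀ s (fun j m => ξ j m ω) j) (ξ j m ω)) 2 P :=
    fun j m c => memLp_smul_gradient_at γ x₀ s hg hv hF hξ
      (memLp_gradient hF hmin (memLp_iterate γ x₀ s hg hv hF hmin hξ j)) c
  induction k with
  | zero =>
    simp_rw [virtualIterate]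
    refine (memLp_const x₀).sub (memLp_finsetSum _ fun m _ => ?_)
    have := hstep 0 m (jobStep γ s K 0 m)
    simp_rw [iterate] at this
    exact this
  | succ k ih =>
    simp_rw [virtualIterate]
    exact ih.sub (hstep _ _ _)

/-- The second moment of the gradients in flight. -/
theorem integral_inFlight_le (hg : IsStochasticGradient D F g) (hv : HasBoundedVariance D F g σ)
    (hF : IsSmooth L F) (hmin : ∀ x, F xstar ≤ F x) (hξ : IsIIDSample P D ξ) (K k : ℕ)
    (hk : k < K) :
    ∫ ω, ‖iterate g γ x₀ s (fun j m => ξ j m ω) (k + 1) -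
        virtualIterate g γ x₀ s (fun j m => ξ j m ω) K k‖ ^ 2 ∂P ≤
      ∑ m ∈ Finset.univ.filter (fun m => s (k + 1) ≠ m), jobStep γ s K (prev s (k + 1) m) m ^ 2 *
        (2 * σ ^ 2 + 2 * M * ∫ ω, ‖gradient F
          (iterate g γ x₀ s (fun j m => ξ j m ω) (prev s (k + 1) m))‖ ^ 2 ∂P) := by
  set T := Finset.univ.filter (fun m => s (k + 1) ≠ m) with hT
  set c : Fin M → ℝ := fun m => jobStep γ s K (prev s (k + 1) m) m with hc
  set p : Fin M → ℕ := fun m => prev s (k + 1) m with hp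
  set G : Fin M → Ω → EuclideanSpace ℝ (Fin d) := fun m ω =>
    gradient F (iterate g γ x₀ s (fun j m => ξ j m ω) (p m)) with hGdef
  have hG : ∀ m, MemLp (G m) 2 P := fun m =>
    memLp_gradient hF hmin (memLp_iterate γ x₀ s hg hv hF hmin hξ (p m))
  have hG2 : ∀ m, Integrable (fun ω => ‖G m ω‖ ^ 2) P := fun m =>
    (memLp_two_iff_integrable_sq_norm (hG m).1).1 (hG m)
  have hN : MemLp (fun ω => ∑ m ∈ T, c m • runNoise γ x₀ s F g ξ (p m) m ω) 2 P :=
    memLp_finsetSum T fun m _ => (memLp_runNoise γ x₀ s hg hv hF hξ _ _).1.const_smul (c m)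
  have hN2 := (memLp_two_iff_integrable_sq_norm hN.1).1 hN
  have hnoise : ∫ ω, ‖∑ m ∈ T, c m • runNoise γ x₀ s F g ξ (p m) m ω‖ ^ 2 ∂P ≤
      σ ^ 2 * ∑ m ∈ T, c m ^ 2 :=
    integral_norm_sum_smul_sq_le T c (fun m => runNoise γ x₀ s F g ξ (p m) m)
      (fun m => (memLp_runNoise γ x₀ s hg hv hF hξ _ _).1)
      (fun m => (memLp_runNoise γ x₀ s hg hv hF hξ _ _).2)
      (fun l m hlm => integral_inner_runNoise_runNoise γ x₀ s hg hv hF hξ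
        (fun h => hlm (congrArg Prod.snd h)))
  have hpt : ∀ ω, ‖iterate g γ x₀ s (fun j m => ξ j m ω) (k + 1) -
        virtualIterate g γ x₀ s (fun j m => ξ j m ω) K k‖ ^ 2 ≤
      2 * ‖∑ m ∈ T, c m • runNoise γ x₀ s F g ξ (p m) m ω‖ ^ 2 +
        ∑ m ∈ T, 2 * M * (c m ^ 2 * ‖G m ω‖ ^ 2) := by
    intro ω
    rw [iterate_sub_virtualIterate g γ x₀ s _ K k hk]
    simp_rw [gradient_add_runNoise (F := F), smul_add]
    rw [Finset.sum_add_distrib]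
    have h1 : ∀ a b : EuclideanSpace ℝ (Fin d), ‖a + b‖ ^ 2 ≤ 2 * ‖b‖ ^ 2 + 2 * ‖a‖ ^ 2 := by
      intro a b
      have := parallelogram_law_with_norm ℝ a b
      nlinarith [norm_nonneg (a - b)]
    refine (h1 _ _).trans ?_
    gcongr
    rw [← Finset.mul_sum, mul_assoc]
    gcongr
    -- The means can all point the same way, so Cauchy–Schwarz over the workers costs a factor `M`.
    -- This is what forces the cap of order 1/(ML) on the stepsizes.
    have h2 : ‖∑ m ∈ T, c m • G m ω‖ ≤ ∑ m ∈ T, ‖c m • G m ω‖ := norm_sum_le _ _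
    calc ‖∑ m ∈ T, c m • G m ω‖ ^ 2 ≤ (∑ m ∈ T, ‖c m • G m ω‖) ^ 2 := by gcongr
      _ ≤ T.card * ∑ m ∈ T, ‖c m • G m ω‖ ^ 2 := sq_sum_le_card_mul_sum_sq
      _ ≤ M * ∑ m ∈ T, ‖c m • G m ω‖ ^ 2 := by
          gcongr
          exact (Finset.card_filter_le _ _).trans (by simp)
      _ = M * ∑ m ∈ T, c m ^ 2 * ‖G m ω‖ ^ 2 := by
          congr 1
          refine Finset.sum_congr rfl fun m _ => ?_
          rw [norm_smul, mul_pow, Real.norm_eq_abs, sq_abs]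
  have hint : Integrable (fun ω => ∑ m ∈ T, 2 * M * (c m ^ 2 * ‖G m ω‖ ^ 2)) P :=
    integrable_finsetSum T fun m _ => ((hG2 m).const_mul _).const_mul _
  have hX := (memLp_iterate γ x₀ s hg hv hF hmin hξ (k + 1)).sub
    (memLp_virtualIterate γ x₀ s hg hv hF hmin hξ K k)
  calc _ ≤ ∫ ω, (2 * ‖∑ m ∈ T, c m • runNoise γ x₀ s F g ξ (p m) m ω‖ ^ 2 +
        ∑ m ∈ T, 2 * M * (c m ^ 2 * ‖G m ω‖ ^ 2)) ∂P :=
        integral_mono ((memLp_two_iff_integrable_sq_norm hX.1).1 hX)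
          ((hN2.const_mul 2).add hint) hpt
    _ = 2 * ∫ ω, ‖∑ m ∈ T, c m • runNoise γ x₀ s F g ξ (p m) m ω‖ ^ 2 ∂P +
        ∑ m ∈ T, 2 * M * (c m ^ 2 * ∫ ω, ‖G m ω‖ ^ 2 ∂P) := by
        rw [integral_add (hN2.const_mul 2) hint, integral_const_mul,
          integral_finsetSum T fun m _ => ((hG2 m).const_mul _).const_mul _]
        congr 1
        refine Finset.sum_congr rfl fun m _ => ?_
        rw [integral_const_mul, integral_const_mul]
    _ ≤ 2 * (σ ^ 2 * ∑ m ∈ T, c m ^ 2) +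
        ∑ m ∈ T, 2 * M * (c m ^ 2 * ∫ ω, ‖G m ω‖ ^ 2 ∂P) := by gcongr
    _ = _ := by
        rw [Finset.mul_sum, Finset.mul_sum, ← Finset.sum_add_distrib]
        refine Finset.sum_congr rfl fun m _ => ?_
        ring

end FixedSchedule

end AsyncSGD

namespace AsyncSGD

/-! ### Expected descent of the virtual sequence. -/

section ExpectedDescent

open scoped InnerProductSpace

variable {M d : ℕ} {Ω Ξ : Type*} [mΩ : MeasurableSpace Ω] [MeasurableSpace Ξ]
  {P : Measure Ω} [IsProbabilityMeasure P] {D : Measure Ξ} [IsProbabilityMeasure D]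
  {F : EuclideanSpace ℝ (Fin d) → ℝ}
  {g : EuclideanSpace ℝ (Fin d) → Ξ → EuclideanSpace ℝ (Fin d)} {L σ μ b h : ℝ}
  {xstar : EuclideanSpace ℝ (Fin d)} {ξ : ℕ → Fin M → Ω → Ξ}
  {γ : ℕ → ℝ} (x₀ : EuclideanSpace ℝ (Fin d)) (s : ℕ → Fin M)

theorem integrable_sub_min (hF : IsSmooth L F) (hmin : ∀ x, F xstar ≤ F x)
    {U : Ω → EuclideanSpace ℝ (Fin d)} (hU : MemLp U 2 P) :
    Integrable (fun ω => F (U ω) - F xstar) P := by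
  have h1 := hU.sub (memLp_const xstar)
  refine (((memLp_two_iff_integrable_sq_norm h1.1).1 h1).const_mul (L / 2)).mono'
    ((hF.1.continuous.comp_aestronglyMeasurable hU.1).sub aestronglyMeasurable_const) ?_
  filter_upwards with ω
  rw [Real.norm_of_nonneg (sub_nonneg.2 (hmin _))]
  exact hF.sub_min_le hmin (U ω)

theorem integrable_norm_gradient_sq (hF : IsSmooth L F) (hmin : ∀ x, F xstar ≤ F x)
    {U : Ω → EuclideanSpace ℝ (Fin d)} (hU : MemLp U 2 P) :
    Integrable (fun ω => ‖gradient F (U ω)‖ ^ 2) P := by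
  have h1 := memLp_gradient hF hmin hU
  exact (memLp_two_iff_integrable_sq_norm h1.1).1 h1

/-- The total noise of the initial gradients. -/
theorem initial_noise (hg : IsStochasticGradient D F g) (hv : HasBoundedVariance D F g σ)
    (hF : IsSmooth L F) (hξ : IsIIDSample P D ξ) (c : Fin M → ℝ)
    (u : EuclideanSpace ℝ (Fin d)) :
    MemLp (fun ω => ∑ m, c m • runNoise γ x₀ s F g ξ 0 m ω) 2 P ∧
    ∫ ω, ‖∑ m, c m • runNoise γ x₀ s F g ξ 0 m ω‖ ^ 2 ∂P ≤ σ ^ 2 * ∑ m, c m ^ 2 ∧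
    ∫ ω, ⟪u, ∑ m, c m • runNoise γ x₀ s F g ξ 0 m ω⟫_ℝ ∂P = 0 := by
  have hn := fun m => memLp_runNoise γ x₀ s hg hv hF hξ 0 m
  refine ⟨memLp_finsetSum _ fun m _ => (hn m).1.const_smul (c m),
    integral_norm_sum_smul_sq_le _ c (fun m => runNoise γ x₀ s F g ξ 0 m)
      (fun m => (hn m).1) (fun m => (hn m).2)
      (fun l m hlm => integral_inner_runNoise_runNoise γ x₀ s hg hv hF hξ
        (fun h => hlm (congrArg Prod.snd h))), ?_⟩
  simp_rw [inner_sum, real_inner_smul_right]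
  rw [integral_finsetSum _ fun m _ =>
    (integrable_inner_of_memLp (memLp_const u) (hn m).1).const_mul _]
  refine Finset.sum_eq_zero fun m _ => ?_
  rw [integral_const_mul, integral_inner_runNoise γ x₀ s hg hv hF hξ 0 m (T := before M 0)
    subset_rfl (lt_irrefl 0) measurable_const (memLp_const u), mul_zero]

/-- One step of the virtual iterates, for a potential given by the distance to the minimizer. -/
theorem expected_distance_step (hg : IsStochasticGradient D F g)
    (hv : HasBoundedVariance D F g σ) (hF : IsSmooth L F) (hmin : ∀ x, F xstar ≤ F x)
    (hξ : IsIIDSample P D ξ) (K k : ℕ) {q a cA : ℝ}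
    (hstep : ∀ x y, ‖y - stepHat γ s K (k + 1) • gradient F x - xstar‖ ^ 2 ≤
      q * ‖y - xstar‖ ^ 2 +
        stepHat γ s K (k + 1) * (-a * (F x - F xstar) + cA * ‖x - y‖ ^ 2)) :
    ∫ ω, ‖virtualIterate g γ x₀ s (fun j m => ξ j m ω) K (k + 1) - xstar‖ ^ 2 ∂P ≤
      q * ∫ ω, ‖virtualIterate g γ x₀ s (fun j m => ξ j m ω) K k - xstar‖ ^ 2 ∂P +
      stepHat γ s K (k + 1) *
        (-a * ∫ ω, (F (iterate g γ x₀ s (fun j m => ξ j m ω) (k + 1)) - F xstar) ∂P +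
          cA * ∫ ω, ‖iterate g γ x₀ s (fun j m => ξ j m ω) (k + 1) -
            virtualIterate g γ x₀ s (fun j m => ξ j m ω) K k‖ ^ 2 ∂P +
          1 * σ ^ 2 * stepHat γ s K (k + 1)) := by
  set η := stepHat γ s K (k + 1) with hηdef
  set X := fun ω => iterate g γ x₀ s (fun j m => ξ j m ω) (k + 1) with hX
  set Y := fun ω => virtualIterate g γ x₀ s (fun j m => ξ j m ω) K k with hY
  set n := runNoise γ x₀ s F g ξ (k + 1) (s (k + 1)) with hn
  have hX2 : MemLp X 2 P := memLp_iterate γ x₀ s hg hv hF hmin hξ (k + 1)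
  have hY2 : MemLp Y 2 P := memLp_virtualIterate γ x₀ s hg hv hF hmin hξ K k
  have hn2 := memLp_runNoise γ x₀ s hg hv hF hξ (k + 1) (s (k + 1))
  set u := fun ω => Y ω - η • gradient F (X ω) - xstar with hu
  have hu2 : MemLp u 2 P :=
    (hY2.sub ((memLp_gradient hF hmin hX2).const_smul η)).sub (memLp_const xstar)
  have hum : Measurable[sampleSigma ξ (before M (k + 1))] u := by
    have h1 : Measurable[sampleSigma ξ (before M (k + 1))] Y :=
      measurable_virtualIterate γ x₀ s hg K k
    have h2 : Measurable[sampleSigma ξ (before M (k + 1))] (fun ω => η • gradient F (X ω)) :=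
      (hF.continuous_gradient.measurable.comp
        (measurable_iterate γ x₀ s hg (k + 1))).const_smul η
    exact (h1.sub h2).sub measurable_const
  -- `u` depends only on samples of index at most `k`, the noise has a fresh one of index `k + 1`.
  have horth : ∫ ω, ⟪u ω, n ω⟫_ℝ ∂P = 0 :=
    integral_inner_runNoise γ x₀ s hg hv hF hξ (k + 1) (s (k + 1)) (T := before M (k + 1))
      subset_rfl (lt_irrefl (k + 1)) hum hu2
  have heq : ∀ ω, virtualIterate g γ x₀ s (fun j m => ξ j m ω) K (k + 1) - xstar =
      u ω - η • n ω := by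
    intro ω
    rw [virtualIterate_succ_eq (F := F), smul_add, hu]
    simp only [hX, hY, hn, hηdef]
    abel
  simp_rw [heq]
  rw [integral_norm_sub_smul_sq hu2 hn2.1 horth η]
  have hδ := integrable_sub_min hF hmin hX2
  have hA2 := hX2.sub hY2
  have hA : Integrable (fun ω => ‖X ω - Y ω‖ ^ 2) P :=
    (memLp_two_iff_integrable_sq_norm hA2.1).1 hA2
  have hr2 := hY2.sub (memLp_const xstar)
  have hr : Integrable (fun ω => ‖Y ω - xstar‖ ^ 2) P :=
    (memLp_two_iff_integrable_sq_norm hr2.1).1 hr2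
  have hin : Integrable (fun ω => -a * (F (X ω) - F xstar) + cA * ‖X ω - Y ω‖ ^ 2) P :=
    (hδ.const_mul _).add (hA.const_mul _)
  have hle : ∫ ω, ‖u ω‖ ^ 2 ∂P ≤ q * ∫ ω, ‖Y ω - xstar‖ ^ 2 ∂P +
      η * (-a * ∫ ω, (F (X ω) - F xstar) ∂P + cA * ∫ ω, ‖X ω - Y ω‖ ^ 2 ∂P) := by
    calc ∫ ω, ‖u ω‖ ^ 2 ∂P ≤ ∫ ω, (q * ‖Y ω - xstar‖ ^ 2 +
        η * (-a * (F (X ω) - F xstar) + cA * ‖X ω - Y ω‖ ^ 2)) ∂P :=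
          integral_mono ((memLp_two_iff_integrable_sq_norm hu2.1).1 hu2)
            ((hr.const_mul q).add (hin.const_mul η)) fun ω => hstep (X ω) (Y ω)
      _ = _ := by
          rw [integral_add (hr.const_mul q) (hin.const_mul η), integral_const_mul,
            integral_const_mul, integral_add (hδ.const_mul _) (hA.const_mul _),
            integral_const_mul, integral_const_mul]
  have hvar := mul_le_mul_of_nonneg_left hn2.2 (sq_nonneg η)
  linarith

/-- All initial gradients are taken at x₀, so y₀ is one undisplaced gradient step whose length is
the sum of `M` stepsizes; this sum must itself stay below 1/(4L). -/
theorem expected_distance_init (hg : IsStochasticGradient D F g)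
    (hv : HasBoundedVariance D F g σ) (hF : IsSmooth L F) (hL : 0 < L)
    (hc : ConvexOn ℝ Set.univ F) (hmin : ∀ x, F xstar ≤ F x)
    (hξ : IsIIDSample P D ξ) (K : ℕ) {a : ℝ} (ha : a ≤ 2) (hγ : ∀ m, 0 ≤ jobStep γ s K 0 m)
    (hS : ∑ m, jobStep γ s K 0 m ≤ 1 / (4 * L)) :
    ∫ ω, ‖virtualIterate g γ x₀ s (fun j m => ξ j m ω) K 0 - xstar‖ ^ 2 ∂P ≤
      ‖x₀ - xstar‖ ^ 2 + ∑ m, jobStep γ s K 0 m *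
        (-a * ∫ ω, (F (iterate g γ x₀ s (fun j m => ξ j m ω) 0) - F xstar) ∂P +
          1 * σ ^ 2 * jobStep γ s K 0 m) := by
  set S := ∑ m, jobStep γ s K 0 m with hSdef
  set u := x₀ - S • gradient F x₀ - xstar with hu
  obtain ⟨hN2, hN, horth⟩ := initial_noise (γ := γ) x₀ s hg hv hF hξ
    (fun m => jobStep γ s K 0 m) u
  have heq : ∀ ω, virtualIterate g γ x₀ s (fun j m => ξ j m ω) K 0 - xstar =
      u - (1 : ℝ) • ∑ m, jobStep γ s K 0 m • runNoise γ x₀ s F g ξ 0 m ω := by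
    intro ω
    rw [virtualIterate_zero_eq (F := F), hu, one_smul]
    abel
  simp_rw [heq, iterate]
  rw [integral_norm_sub_smul_sq (memLp_const u) hN2 horth 1]
  have h1 := hF.convex_step hL hc hmin (Finset.sum_nonneg fun m _ => hγ m) hS x₀ x₀
  simp only [sub_self, norm_zero] at h1
  have h2 : S * (-2 * (F x₀ - F xstar)) ≤ S * (-a * (F x₀ - F xstar)) := by
    refine mul_le_mul_of_nonneg_left ?_ (Finset.sum_nonneg fun m _ => hγ m)
    nlinarith [hmin x₀]
  have h3 : ∑ m, jobStep γ s K 0 m * (-a * (F x₀ - F xstar) + 1 * σ ^ 2 * jobStep γ s K 0 m) =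
      S * (-a * (F x₀ - F xstar)) + σ ^ 2 * ∑ m, jobStep γ s K 0 m ^ 2 := by
    rw [hSdef, Finset.sum_mul, Finset.mul_sum, ← Finset.sum_add_distrib]
    exact Finset.sum_congr rfl fun m _ => by ring
  simp only [integral_const, probReal_univ, one_smul, one_pow, one_mul] at *
  linarith

/-- One step of the virtual iterates, for the potential `F`. -/
theorem expected_value_step (hg : IsStochasticGradient D F g)
    (hv : HasBoundedVariance D F g σ) (hF : IsSmooth L F) (hL : 0 < L)
    (hmin : ∀ x, F xstar ≤ F x) (hξ : IsIIDSample P D ξ) (K k : ℕ)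
    (hη : 0 ≤ stepHat γ s K (k + 1)) (hηL : stepHat γ s K (k + 1) ≤ 1 / (2 * L)) :
    ∫ ω, (F (virtualIterate g γ x₀ s (fun j m => ξ j m ω) K (k + 1)) - F xstar) ∂P ≤
      ∫ ω, (F (virtualIterate g γ x₀ s (fun j m => ξ j m ω) K k) - F xstar) ∂P +
      stepHat γ s K (k + 1) *
        (-(1 / 4) * ∫ ω, ‖gradient F (iterate g γ x₀ s (fun j m => ξ j m ω) (k + 1))‖ ^ 2 ∂P +
          L ^ 2 / 2 * ∫ ω, ‖iterate g γ x₀ s (fun j m => ξ j m ω) (k + 1) -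
            virtualIterate g γ x₀ s (fun j m => ξ j m ω) K k‖ ^ 2 ∂P +
          L / 2 * σ ^ 2 * stepHat γ s K (k + 1)) := by
  set η := stepHat γ s K (k + 1) with hηdef
  set X := fun ω => iterate g γ x₀ s (fun j m => ξ j m ω) (k + 1) with hX
  set Y := fun ω => virtualIterate g γ x₀ s (fun j m => ξ j m ω) K k with hY
  set n := runNoise γ x₀ s F g ξ (k + 1) (s (k + 1)) with hn
  have hX2 : MemLp X 2 P := memLp_iterate γ x₀ s hg hv hF hmin hξ (k + 1)
  have hY2 : MemLp Y 2 P := memLp_virtualIterate γ x₀ s hg hv hF hmin hξ K k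
  have hn2 := memLp_runNoise γ x₀ s hg hv hF hξ (k + 1) (s (k + 1))
  have hXm : Measurable[sampleSigma ξ (before M (k + 1))] X :=
    measurable_iterate γ x₀ s hg (k + 1)
  have hYm : Measurable[sampleSigma ξ (before M (k + 1))] Y :=
    measurable_virtualIterate γ x₀ s hg K k
  have horth : ∀ {U : Ω → EuclideanSpace ℝ (Fin d)},
      Measurable[sampleSigma ξ (before M (k + 1))] U → MemLp U 2 P →
      ∫ ω, ⟪gradient F (U ω), n ω⟫_ℝ ∂P = 0 := fun {U} hU hU2 =>
    integral_inner_runNoise γ x₀ s hg hv hF hξ (k + 1) (s (k + 1)) (T := before M (k + 1))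
      subset_rfl (lt_irrefl (k + 1)) (hF.continuous_gradient.measurable.comp hU)
      (memLp_gradient hF hmin hU2)
  have hgX := memLp_gradient hF hmin hX2
  have hG := integrable_norm_gradient_sq hF hmin hX2
  have hV := integrable_sub_min hF hmin hY2
  have hA2 := hX2.sub hY2
  have hA : Integrable (fun ω => ‖X ω - Y ω‖ ^ 2) P :=
    (memLp_two_iff_integrable_sq_norm hA2.1).1 hA2
  have hin : Integrable (fun ω => ⟪gradient F (Y ω), n ω⟫_ℝ) P :=
    integrable_inner_of_memLp (memLp_gradient hF hmin hY2) hn2.1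
  have hs2 : MemLp (fun ω => gradient F (X ω) - (-1 : ℝ) • n ω) 2 P :=
    hgX.sub (hn2.1.const_smul (-1 : ℝ))
  have hs : Integrable (fun ω => ‖gradient F (X ω) - (-1 : ℝ) • n ω‖ ^ 2) P :=
    (memLp_two_iff_integrable_sq_norm hs2.1).1 hs2
  have hgrad : ∫ ω, ‖gradient F (X ω) - (-1 : ℝ) • n ω‖ ^ 2 ∂P ≤
      ∫ ω, ‖gradient F (X ω)‖ ^ 2 ∂P + σ ^ 2 := by
    rw [integral_norm_sub_smul_sq hgX hn2.1 (horth hXm hX2)]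
    linarith [hn2.2]
  have hd1 : Integrable (fun ω =>
      -(1 / 2) * ‖gradient F (X ω)‖ ^ 2 + L ^ 2 / 2 * ‖X ω - Y ω‖ ^ 2) P :=
    (hG.const_mul _).add (hA.const_mul _)
  have hd2 : Integrable (fun ω => (F (Y ω) - F xstar) +
      η * (-(1 / 2) * ‖gradient F (X ω)‖ ^ 2 + L ^ 2 / 2 * ‖X ω - Y ω‖ ^ 2)) P :=
    hV.add (hd1.const_mul η)
  have hd3 : Integrable (fun ω => (F (Y ω) - F xstar) +
      η * (-(1 / 2) * ‖gradient F (X ω)‖ ^ 2 + L ^ 2 / 2 * ‖X ω - Y ω‖ ^ 2) -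
        η * ⟪gradient F (Y ω), n ω⟫_ℝ) P :=
    hd2.sub (hin.const_mul η)
  calc _ ≤ ∫ ω, ((F (Y ω) - F xstar) +
        η * (-(1 / 2) * ‖gradient F (X ω)‖ ^ 2 + L ^ 2 / 2 * ‖X ω - Y ω‖ ^ 2) -
          η * ⟪gradient F (Y ω), n ω⟫_ℝ +
        L / 2 * η ^ 2 * ‖gradient F (X ω) - (-1 : ℝ) • n ω‖ ^ 2) ∂P := by
        refine integral_mono (integrable_sub_min hF hmin
          (memLp_virtualIterate γ x₀ s hg hv hF hmin hξ K (k + 1)))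
          (hd3.add (hs.const_mul _)) fun ω => ?_
        have h1 := hF.nonconvex_step hη (X ω) (Y ω) (n ω)
        simp only [neg_smul, one_smul, sub_neg_eq_add]
        rw [virtualIterate_succ_eq (F := F)]
        linarith
    _ = ∫ ω, (F (Y ω) - F xstar) ∂P + η * (-(1 / 2) * ∫ ω, ‖gradient F (X ω)‖ ^ 2 ∂P +
          L ^ 2 / 2 * ∫ ω, ‖X ω - Y ω‖ ^ 2 ∂P) +
        L / 2 * η ^ 2 * ∫ ω, ‖gradient F (X ω) - (-1 : ℝ) • n ω‖ ^ 2 ∂P := by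
        rw [integral_add hd3 (hs.const_mul _), integral_sub hd2 (hin.const_mul η),
          integral_add hV (hd1.const_mul η), integral_const_mul, integral_const_mul,
          integral_const_mul, integral_add (hG.const_mul _) (hA.const_mul _),
          integral_const_mul, integral_const_mul, horth hYm hY2]
        ring
    _ ≤ _ := by
        have h1 := mul_le_mul_of_nonneg_left hgrad (show 0 ≤ L / 2 * η ^ 2 by positivity)
        have hG0 : 0 ≤ ∫ ω, ‖gradient F (X ω)‖ ^ 2 ∂P := integral_nonneg fun ω => sq_nonneg _
        -- Half of the descent coefficient 1/2 pays for the squared gradient, leaving 1/4.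
        have h2 : L / 2 * η ^ 2 * ∫ ω, ‖gradient F (X ω)‖ ^ 2 ∂P ≤
            η * (1 / 4 * ∫ ω, ‖gradient F (X ω)‖ ^ 2 ∂P) := by
          have h3 : L * η ≤ 1 / 2 := by
            rw [le_div_iff₀ (by positivity)] at hηL
            linarith
          nlinarith [mul_nonneg hη hG0]
        linarith

/-- A single step of total length S decreases F by at least 3S‖∇F(x₀)‖²/4, up to noise. Only the
share 1/8 needed for absorption is kept. -/
theorem expected_value_init (hg : IsStochasticGradient D F g)
    (hv : HasBoundedVariance D F g σ) (hF : IsSmooth L F) (hL : 0 < L)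
    (hmin : ∀ x, F xstar ≤ F x) (hξ : IsIIDSample P D ξ) (K : ℕ)
    (hγ : ∀ m, 0 ≤ jobStep γ s K 0 m) (hS : ∑ m, jobStep γ s K 0 m ≤ 1 / (2 * L)) :
    ∫ ω, (F (virtualIterate g γ x₀ s (fun j m => ξ j m ω) K 0) - F xstar) ∂P ≤
      F x₀ - F xstar + ∑ m, jobStep γ s K 0 m *
        (-(1 / 8) * ∫ ω, ‖gradient F (iterate g γ x₀ s (fun j m => ξ j m ω) 0)‖ ^ 2 ∂P +
          L / 2 * σ ^ 2 * jobStep γ s K 0 m) := by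
  set S := ∑ m, jobStep γ s K 0 m with hSdef
  have hS0 : 0 ≤ S := Finset.sum_nonneg fun m _ => hγ m
  set u := gradient F x₀ with hu
  obtain ⟨hN2, hN, horth⟩ := initial_noise (γ := γ) x₀ s hg hv hF hξ
    (fun m => jobStep γ s K 0 m) u
  set N := fun ω => ∑ m, jobStep γ s K 0 m • runNoise γ x₀ s F g ξ 0 m ω with hNdef
  have horth' : ∫ ω, ⟪S • u, N ω⟫_ℝ ∂P = 0 := by
    simp_rw [real_inner_smul_left]
    rw [integral_const_mul, horth, mul_zero]
  have hin : Integrable (fun ω => ⟪u, N ω⟫_ℝ) P := integrable_inner_of_memLp (memLp_const u) hN2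
  have hs2 : MemLp (fun ω => S • u - (-1 : ℝ) • N ω) 2 P :=
    (memLp_const (S • u)).sub (hN2.const_smul (-1 : ℝ))
  have hs : Integrable (fun ω => ‖S • u - (-1 : ℝ) • N ω‖ ^ 2) P :=
    (memLp_two_iff_integrable_sq_norm hs2.1).1 hs2
  have hi2 : Integrable (fun ω => (F x₀ - F xstar - S * ‖u‖ ^ 2) - ⟪u, N ω⟫_ℝ) P :=
    (integrable_const _).sub hin
  have hle : ∫ ω, (F (virtualIterate g γ x₀ s (fun j m => ξ j m ω) K 0) - F xstar) ∂P ≤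
      F x₀ - F xstar - S * ‖u‖ ^ 2 + L / 2 * (S ^ 2 * ‖u‖ ^ 2 + ∫ ω, ‖N ω‖ ^ 2 ∂P) := by
    calc _ ≤ ∫ ω, ((F x₀ - F xstar - S * ‖u‖ ^ 2) - ⟪u, N ω⟫_ℝ +
          L / 2 * ‖S • u - (-1 : ℝ) • N ω‖ ^ 2) ∂P := by
          refine integral_mono (integrable_sub_min hF hmin
            (memLp_virtualIterate γ x₀ s hg hv hF hmin hξ K 0))
            (hi2.add (hs.const_mul _)) fun ω => ?_
          have h1 := hF.le_quadratic x₀ (x₀ - S • u - N ω)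
          rw [show x₀ - S • u - N ω - x₀ = -(S • u - (-1 : ℝ) • N ω) by
            rw [neg_one_smul]
            abel, norm_neg, inner_neg_right, inner_sub_right, real_inner_smul_right,
            real_inner_smul_right, ← hu, real_inner_self_eq_norm_sq] at h1
          change F (virtualIterate g γ x₀ s (fun j m => ξ j m ω) K 0) - F xstar ≤ _
          rw [virtualIterate_zero_eq (F := F)]
          linarith
      _ = _ := by
          rw [integral_add hi2 (hs.const_mul _), integral_sub (integrable_const _) hin,
            integral_const_mul, integral_norm_sub_smul_sq (memLp_const (S • u)) hN2 horth',
            horth]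
          simp only [integral_const, probReal_univ, one_smul, norm_smul, mul_pow,
            Real.norm_eq_abs, sq_abs]
          ring
  have h3 : ∑ m, jobStep γ s K 0 m * (-(1 / 8) * ‖u‖ ^ 2 + L / 2 * σ ^ 2 * jobStep γ s K 0 m) =
      S * (-(1 / 8) * ‖u‖ ^ 2) + L / 2 * (σ ^ 2 * ∑ m, jobStep γ s K 0 m ^ 2) := by
    rw [hSdef, Finset.sum_mul, Finset.mul_sum, Finset.mul_sum, ← Finset.sum_add_distrib]
    exact Finset.sum_congr rfl fun m _ => by ring
  simp_rw [iterate]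
  rw [integral_const, probReal_univ, one_smul, ← hu, h3]
  have h4 := mul_le_mul_of_nonneg_left hN (show 0 ≤ L / 2 by positivity)
  have h5 : L / 2 * (S ^ 2 * ‖u‖ ^ 2) ≤ S * (1 / 4 * ‖u‖ ^ 2) := by
    have h6 : L * S ≤ 1 / 2 := by
      rw [le_div_iff₀ (by positivity)] at hS
      linarith
    nlinarith [mul_nonneg hS0 (sq_nonneg ‖u‖)]
  have h7 := mul_nonneg hS0 (sq_nonneg ‖u‖)
  linarith

end ExpectedDescent

end AsyncSGD

/-! ### Bounds for a fixed schedule and initial point. -/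

namespace AsyncSGD

theorem expWeight_zero {M : ℕ} (γ : ℕ → ℝ) (s : ℕ → Fin M) (K k : ℕ) :
    expWeight 0 γ s K k = stepHat γ s K k := by
  simp [expWeight]

section FixedSchedule

variable {M d : ℕ} {Ω Ξ : Type*} [mΩ : MeasurableSpace Ω] [MeasurableSpace Ξ]
  {P : Measure Ω} [IsProbabilityMeasure P] {D : Measure Ξ} [IsProbabilityMeasure D]
  {F : EuclideanSpace ℝ (Fin d) → ℝ}
  {g : EuclideanSpace ℝ (Fin d) → Ξ → EuclideanSpace ℝ (Fin d)} {L σ μ b h : ℝ}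
  {xstar : EuclideanSpace ℝ (Fin d)} {ξ : ℕ → Fin M → Ω → Ξ}
  {γ : ℕ → ℝ} (x₀ : EuclideanSpace ℝ (Fin d)) (s : ℕ → Fin M)

theorem IsAdaptiveStep.sum_initial_le_of_cap (hγ : IsAdaptiveStep γ L μ b h) {B : ℝ}
    (hb : M * b ≤ B) (K : ℕ) : ∑ m, jobStep γ s K 0 m ≤ B :=
  (hγ.sum_initial_le s K).trans
    ((mul_le_mul_of_nonneg_left hγ.le_cap (Nat.cast_nonneg M)).trans hb)

theorem IsAdaptiveStep.stepHat_le_of_cap (hγ : IsAdaptiveStep γ L μ b h) {B : ℝ}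
    (hM : 1 ≤ M) (hb : M * b ≤ B) (K k : ℕ) : stepHat γ s K k ≤ B := by
  have hM' : (1 : ℝ) ≤ M := by exact_mod_cast hM
  have h1 := hγ.le_cap
  have h2 := hγ.nonneg
  have h3 := hγ.stepHat_le s K k
  nlinarith

/-- The weighted suboptimality of a run with a fixed schedule. -/
theorem weighted_suboptimality_le (hg : IsStochasticGradient D F g)
    (hv : HasBoundedVariance D F g σ) (hF : IsSmooth L F) (hL : 0 < L)
    (hc : ConvexOn ℝ Set.univ F) (hmin : ∀ x, F xstar ≤ F x)
    (hξ : IsIIDSample P D ξ) {K : ℕ} (hγ : IsAdaptiveStep γ L μ b h) (hμ : 0 ≤ μ)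
    (hlow : ∀ τ : ℕ, 1 ≤ τ → h * (1 - τ / (4 * M)) ≤ 8 * γ τ) (hMK : M ≤ K) (hM : 1 ≤ M)
    {a a' cA : ℝ} (hcA : 0 ≤ cA) (hb : M * b ≤ 1 / (4 * L)) (ha' : a' ≤ 2)
    (hcAa : cA * (M * b) ≤ a')
    (hstep : ∀ η, 0 ≤ η → M * η ≤ M * b → ∀ x y, ‖y - η • gradient F x - xstar‖ ^ 2 ≤
      Real.exp (-(μ * η)) * ‖y - xstar‖ ^ 2 +
        η * (-a * (F x - F xstar) + cA * ‖x - y‖ ^ 2)) :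
    (a - a') * ∑ k ∈ Finset.Icc 1 K, expWeight μ γ s K k *
        ∫ ω, (F (iterate g γ x₀ s (fun j m => ξ j m ω) k) - F xstar) ∂P ≤
      ‖x₀ - xstar‖ ^ 2 + 17 * (1 + cA / (2 * L)) * σ ^ 2 * h *
        ∑ k ∈ Finset.Icc 1 K, expWeight μ γ s K k := by
  have hX := memLp_iterate γ x₀ s hg hv hF hmin hξ
  refine hγ.weighted_descent hμ hL s hlow hMK hM (a' := a') hcA zero_le_one
    (fun k => ∫ ω, ‖virtualIterate g γ x₀ s (fun j m => ξ j m ω) K k - xstar‖ ^ 2 ∂P)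
    (fun k => ∫ ω, (F (iterate g γ x₀ s (fun j m => ξ j m ω) k) - F xstar) ∂P)
    -- The displacement x_k - y_{k-1}; its value at k = 0, where the subtraction truncates, plays no
    -- role.
    (fun k => ∫ ω, ‖iterate g γ x₀ s (fun j m => ξ j m ω) k -
      virtualIterate g γ x₀ s (fun j m => ξ j m ω) K (k - 1)‖ ^ 2 ∂P)
    (fun k => ∫ ω, ‖gradient F (iterate g γ x₀ s (fun j m => ξ j m ω) k)‖ ^ 2 ∂P)
    (integral_nonneg fun ω => sq_nonneg _) (fun k => integral_nonneg fun ω => sq_nonneg _)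
    (fun k => ?_) (fun k _ => ?_) (fun k hk => ?_) ?_
  · have h1 : ∫ ω, ‖gradient F (iterate g γ x₀ s (fun j m => ξ j m ω) k)‖ ^ 2 ∂P ≤
        2 * L * ∫ ω, (F (iterate g γ x₀ s (fun j m => ξ j m ω) k) - F xstar) ∂P := by
      rw [← integral_const_mul]
      exact integral_mono (integrable_norm_gradient_sq hF hmin (hX k))
        ((integrable_sub_min hF hmin (hX k)).const_mul _)
        fun ω => hF.norm_gradient_sq_le hL hmin _
    have h2 : 0 ≤ ∫ ω, (F (iterate g γ x₀ s (fun j m => ξ j m ω) k) - F xstar) ∂P :=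
      integral_nonneg fun ω => sub_nonneg.2 (hmin _)
    have hb0 : 0 ≤ M * b := mul_nonneg (Nat.cast_nonneg M) (hγ.nonneg.trans hγ.le_cap)
    calc _ ≤ cA * (M * b / (2 * L)) *
          (2 * L * ∫ ω, (F (iterate g γ x₀ s (fun j m => ξ j m ω) k) - F xstar) ∂P) :=
          mul_le_mul_of_nonneg_left h1 (by positivity)
      _ = cA * (M * b) * ∫ ω, (F (iterate g γ x₀ s (fun j m => ξ j m ω) k) - F xstar) ∂P := by
          field_simp
      _ ≤ _ := mul_le_mul_of_nonneg_right hcAa h2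
  · exact expected_distance_step x₀ s hg hv hF hmin hξ K k
      (hstep _ (hγ.stepHat_pos s K _).le (mul_le_mul_of_nonneg_left
        ((hγ.stepHat_le s K _).trans hγ.le_cap) (Nat.cast_nonneg M)))
  · obtain ⟨k, rfl⟩ := Nat.exists_eq_add_of_le' (Finset.mem_Icc.1 hk).1
    exact integral_inFlight_le γ x₀ s hg hv hF hmin hξ K k (Finset.mem_Icc.1 hk).2
  · exact expected_distance_init x₀ s hg hv hF hL hc hmin hξ K ha'
      (fun m => (hγ.jobStep_pos s K 0 m).le) (hγ.sum_initial_le_of_cap s hb K)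

/-- The weighted squared gradients of a run with a fixed schedule. -/
theorem weighted_gradient_le (hg : IsStochasticGradient D F g)
    (hv : HasBoundedVariance D F g σ) (hF : IsSmooth L F) (hL : 0 < L)
    (hmin : ∀ x, F xstar ≤ F x)
    (hξ : IsIIDSample P D ξ) {K : ℕ} (hγ : IsAdaptiveStep γ L 0 b h)
    (hlow : ∀ τ : ℕ, 1 ≤ τ → h * (1 - τ / (4 * M)) ≤ 8 * γ τ) (hMK : M ≤ K) (hM : 1 ≤ M)
    (hb : M * b ≤ 1 / (2 * L)) :
    ∑ k ∈ Finset.Icc 1 K, stepHat γ s K k *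
        ∫ ω, ‖gradient F (iterate g γ x₀ s (fun j m => ξ j m ω) k)‖ ^ 2 ∂P ≤
      8 * (F x₀ - F xstar) + 102 * L * σ ^ 2 * h * ∑ k ∈ Finset.Icc 1 K, stepHat γ s K k := by
  have key := hγ.weighted_descent le_rfl hL s (K := K) hlow hMK hM (σ := σ) (a := 1 / 4)
    (a' := 1 / 8) (cA := L ^ 2 / 2) (c₀ := L / 2) (V₀ := F x₀ - F xstar) (by positivity)
    (by positivity)
    (fun k => ∫ ω, (F (virtualIterate g γ x₀ s (fun j m => ξ j m ω) K k) - F xstar) ∂P)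
    (fun k => ∫ ω, ‖gradient F (iterate g γ x₀ s (fun j m => ξ j m ω) k)‖ ^ 2 ∂P)
    (fun k => ∫ ω, ‖iterate g γ x₀ s (fun j m => ξ j m ω) k -
      virtualIterate g γ x₀ s (fun j m => ξ j m ω) K (k - 1)‖ ^ 2 ∂P)
    (fun k => ∫ ω, ‖gradient F (iterate g γ x₀ s (fun j m => ξ j m ω) k)‖ ^ 2 ∂P)
    (integral_nonneg fun ω => sub_nonneg.2 (hmin _))
    (fun k => integral_nonneg fun ω => sq_nonneg _)
    (fun k => ?_) (fun k _ => ?_) (fun k hk => ?_) ?_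
  · simp_rw [expWeight_zero] at key
    -- The inequality is then multiplied by 8, the inverse of a - a' = 1/8, which turns this into
    -- 102L.
    have h1 : 17 * (L / 2 + L ^ 2 / 2 / (2 * L)) = 17 * (3 / 4) * L := by
      field_simp
      ring
    rw [h1] at key
    linarith
  · refine mul_le_mul_of_nonneg_right ?_ (integral_nonneg fun ω => sq_nonneg _)
    have h2 : L ^ 2 / 2 * (M * b / (2 * L)) = L / 4 * (M * b) := by
      field_simp
      ring
    have h3 : L / 4 * (M * b) ≤ L / 4 * (1 / (2 * L)) :=
      mul_le_mul_of_nonneg_left hb (by positivity)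
    have h4 : L / 4 * (1 / (2 * L)) = 1 / 8 := by
      field_simp
      norm_num
    linarith
  · simp only [zero_mul, neg_zero, Real.exp_zero, one_mul]
    exact expected_value_step x₀ s hg hv hF hL hmin hξ K k (hγ.stepHat_pos s K _).le
      (hγ.stepHat_le_of_cap s hM hb K _)
  · obtain ⟨k, rfl⟩ := Nat.exists_eq_add_of_le' (Finset.mem_Icc.1 hk).1
    exact integral_inFlight_le γ x₀ s hg hv hF hmin hξ K k (Finset.mem_Icc.1 hk).2
  · exact expected_value_init x₀ s hg hv hF hL hmin hξ K
      (fun m => (hγ.jobStep_pos s K 0 m).le) (hγ.sum_initial_le_of_cap s hb K)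

theorem suboptimality_weightedAverage_le (hc : ConvexOn ℝ Set.univ F)
    {K : ℕ} {w : ℕ → ℝ} (hw : ∀ k, 0 < w k) (hK : 1 ≤ K) (x : ℕ → EuclideanSpace ℝ (Fin d)) :
    F (weightedAverage w x K) - F xstar ≤
      (∑ k ∈ Finset.Icc 1 K, w k)⁻¹ * ∑ k ∈ Finset.Icc 1 K, w k * (F (x k) - F xstar) := by
  have hW : 0 < ∑ k ∈ Finset.Icc 1 K, w k :=
    Finset.sum_pos (fun k _ => hw k) ⟨1, Finset.mem_Icc.2 ⟨le_rfl, hK⟩⟩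
  have h1 := hc.map_centerMass_le (t := Finset.Icc 1 K) (w := w) (p := x)
    (fun k _ => (hw k).le) hW (fun k _ => Set.mem_univ _)
  simp only [Finset.centerMass, smul_eq_mul, Function.comp_apply] at h1
  unfold weightedAverage
  simp_rw [mul_sub]
  rw [Finset.sum_sub_distrib, ← Finset.sum_mul, mul_sub, inv_mul_cancel_left₀ hW.ne']
  linarith

/-- The suboptimality of the averaged output of a run with a fixed schedule. -/
theorem integral_weightedAverage_le (hg : IsStochasticGradient D F g)
    (hv : HasBoundedVariance D F g σ) (hF : IsSmooth L F)
    (hc : ConvexOn ℝ Set.univ F) (hmin : ∀ x, F xstar ≤ F x)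
    (hξ : IsIIDSample P D ξ) {K : ℕ} (hK : 1 ≤ K) {w : ℕ → ℝ} (hw : ∀ k, 0 < w k) {B : ℝ}
    (hB : ∑ k ∈ Finset.Icc 1 K, w k *
        ∫ ω, (F (iterate g γ x₀ s (fun j m => ξ j m ω) k) - F xstar) ∂P ≤
      B * ∑ k ∈ Finset.Icc 1 K, w k) :
    Integrable (fun ω =>
      F (weightedAverage w (iterate g γ x₀ s (fun j m => ξ j m ω)) K) - F xstar) P ∧
    ∫ ω, (F (weightedAverage w (iterate g γ x₀ s (fun j m => ξ j m ω)) K) - F xstar) ∂P ≤ B := by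
  have hX := memLp_iterate γ x₀ s hg hv hF hmin hξ
  have hW : 0 < ∑ k ∈ Finset.Icc 1 K, w k :=
    Finset.sum_pos (fun k _ => hw k) ⟨1, Finset.mem_Icc.2 ⟨le_rfl, hK⟩⟩
  have hav : MemLp (fun ω => weightedAverage w (iterate g γ x₀ s (fun j m => ξ j m ω)) K) 2 P :=
    (memLp_finsetSum (f := fun k ω => w k • iterate g γ x₀ s (fun j m => ξ j m ω) k)
      (Finset.Icc 1 K) fun k _ => (hX k).const_smul (w k)).const_smul
        (∑ k ∈ Finset.Icc 1 K, w k)⁻¹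
  have hi := integrable_sub_min hF hmin hav
  refine ⟨hi, ?_⟩
  have hterm : ∀ k, Integrable (fun ω =>
      w k * (F (iterate g γ x₀ s (fun j m => ξ j m ω) k) - F xstar)) P :=
    fun k => (integrable_sub_min hF hmin (hX k)).const_mul _
  calc _ ≤ ∫ ω, (∑ k ∈ Finset.Icc 1 K, w k)⁻¹ * ∑ k ∈ Finset.Icc 1 K,
        w k * (F (iterate g γ x₀ s (fun j m => ξ j m ω) k) - F xstar) ∂P :=
        integral_mono hi ((integrable_finsetSum _ fun k _ => hterm k).const_mul _)
          fun ω => suboptimality_weightedAverage_le hc hw hK _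
    _ = (∑ k ∈ Finset.Icc 1 K, w k)⁻¹ * ∑ k ∈ Finset.Icc 1 K, w k *
        ∫ ω, (F (iterate g γ x₀ s (fun j m => ξ j m ω) k) - F xstar) ∂P := by
        rw [integral_const_mul, integral_finsetSum _ fun k _ => hterm k]
        simp_rw [integral_const_mul]
    _ ≤ B := by
        rw [inv_mul_le_iff₀ hW]
        linarith

theorem fixed_schedule_convex (hg : IsStochasticGradient D F g)
    (hv : HasBoundedVariance D F g σ) (hF : IsSmooth L F) (hL : 0 < L)
    (hc : ConvexOn ℝ Set.univ F) (hmin : ∀ x, F xstar ≤ F x)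
    (hξ : IsIIDSample P D ξ) {K : ℕ} (hγ : IsAdaptiveStep γ L 0 b h) (hh : 0 < h)
    (hlow : ∀ τ : ℕ, 1 ≤ τ → h * (1 - τ / (4 * M)) ≤ 8 * γ τ) (hMK : M ≤ K) (hM : 1 ≤ M)
    (hb : M * b ≤ 1 / (4 * L)) :
    Integrable (fun ω =>
      F (weightedAverage (stepHat γ s K) (iterate g γ x₀ s (fun j m => ξ j m ω)) K) - F xstar) P ∧
    ∫ ω, (F (weightedAverage (stepHat γ s K) (iterate g γ x₀ s (fun j m => ξ j m ω)) K) -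
      F xstar) ∂P ≤ 16 / (h * K) * ‖x₀ - xstar‖ ^ 2 + 17 * σ ^ 2 * h := by
  have hK : 1 ≤ K := hM.trans hMK
  have hK' : (0 : ℝ) < K := by exact_mod_cast hK
  refine integral_weightedAverage_le x₀ s hg hv hF hc hmin hξ hK (hγ.stepHat_pos s K) ?_
  -- a' = 1/3 is `cA` times the bound 1/(4L) on Mb. The noise constant 17(1 + 2/3) and a - a' = 5/3
  -- cancel to 17.
  have h1 := weighted_suboptimality_le x₀ s hg hv hF hL hc hmin hξ hγ le_rfl hlow hMK hM
    (a := 2) (a' := 1 / 3) (cA := 4 * L / 3) (by positivity) hb (by norm_num) (by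
      have := mul_le_mul_of_nonneg_left hb (show 0 ≤ 4 * L / 3 by positivity)
      have h2 : 4 * L / 3 * (1 / (4 * L)) = 1 / 3 := by field_simp
      linarith) (fun η hη hηb x y => by
        rw [zero_mul, neg_zero, Real.exp_zero, one_mul]
        refine hF.convex_step hL hc hmin hη ?_ x y
        have hM' : (1 : ℝ) ≤ M := by exact_mod_cast hM
        nlinarith)
  simp_rw [expWeight_zero] at h1
  have h2 := IsAdaptiveStep.sum_stepHat_ge s K hh.le hlow hM
  set W := ∑ k ∈ Finset.Icc 1 K, stepHat γ s K k
  have h3 : 17 * (1 + 4 * L / 3 / (2 * L)) = 17 * (5 / 3) := by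
    field_simp
    norm_num
  rw [h3] at h1
  have h4 : ‖x₀ - xstar‖ ^ 2 ≤ 16 / (h * K) * ‖x₀ - xstar‖ ^ 2 * W := by
    have h5 : 1 ≤ 16 / (h * K) * W := by
      rw [div_mul_eq_mul_div, le_div_iff₀ (by positivity)]
      linarith
    nlinarith [sq_nonneg ‖x₀ - xstar‖]
  nlinarith [sq_nonneg ‖x₀ - xstar‖]

theorem fixed_schedule_stronglyConvex (hg : IsStochasticGradient D F g)
    (hv : HasBoundedVariance D F g σ) (hF : IsSmooth L F) (hL : 0 < L) (hμ : 0 < μ)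
    (hc : StrongConvexOn Set.univ μ F) (hmin : ∀ x, F xstar ≤ F x)
    (hξ : IsIIDSample P D ξ) {K : ℕ} (hγ : IsAdaptiveStep γ L μ b h) (hh : 0 < h)
    (hlow : ∀ τ : ℕ, 1 ≤ τ → h * (1 - τ / (4 * M)) ≤ 8 * γ τ) (hMK : M ≤ K) (hM : 1 ≤ M)
    (hb : M * b ≤ 1 / (8 * L)) :
    Integrable (fun ω =>
      F (weightedAverage (expWeight μ γ s K) (iterate g γ x₀ s (fun j m => ξ j m ω)) K) -
        F xstar) P ∧
    ∫ ω, (F (weightedAverage (expWeight μ γ s K) (iterate g γ x₀ s (fun j m => ξ j m ω)) K) -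
      F xstar) ∂P ≤
        256 / (h * K) * Real.exp (-(μ * (h * K) / 32)) * ‖x₀ - xstar‖ ^ 2 + 748 * σ ^ 2 * h := by
  have hK : 1 ≤ K := hM.trans hMK
  have hK' : (0 : ℝ) < K := by exact_mod_cast hK
  have hcc : ConvexOn ℝ Set.univ F := strongConvexOn_zero.1 (hc.mono hμ.le)
  refine integral_weightedAverage_le x₀ s hg hv hF hcc hmin hξ hK (hγ.expWeight_pos s K) ?_
  have hb' : 1 / (8 * L) ≤ 1 / (4 * L) := by
    gcongr
    norm_num
  -- The cap 1/(8L) on Mb leaves a - a' = 1/16. Multiplying by 16 gives 16 · 17 · 11/4 = 748 for the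
  -- noise and, with T = hK/16, 16 · 16 = 256 for the initial distance.
  have h1 := weighted_suboptimality_le x₀ s hg hv hF hL hcc hmin hξ hγ hμ.le hlow hMK hM
    (a := 1 / 2) (a' := 7 / 16) (cA := 7 / 2 * L) (by positivity) (hb.trans hb') (by norm_num) (by
      have := mul_le_mul_of_nonneg_left hb (show 0 ≤ 7 / 2 * L by positivity)
      have h2 : 7 / 2 * L * (1 / (8 * L)) = 7 / 16 := by
        field_simp
        norm_num
      linarith) (fun η hη hηb x y => by
        refine hF.strongConvex_step hL hμ.le hc hmin hη ?_ x y
        have hM' : (1 : ℝ) ≤ M := by exact_mod_cast hM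
        nlinarith)
  have h2 := IsAdaptiveStep.sum_stepHat_ge s K hh.le hlow hM
  have h5 := sum_expWeight_ge (γ := γ) hμ s (K := K) (T := h * K / 16) (by positivity) h2
  set W := ∑ k ∈ Finset.Icc 1 K, expWeight μ γ s K k
  have h3 : 17 * (1 + 7 / 2 * L / (2 * L)) = 17 * (11 / 4) := by
    field_simp
    norm_num
  rw [h3] at h1
  have h4 : 16 * ‖x₀ - xstar‖ ^ 2 ≤
      256 / (h * K) * Real.exp (-(μ * (h * K) / 32)) * ‖x₀ - xstar‖ ^ 2 * W := by
    have h6 : 16 ≤ 256 / (h * K) * Real.exp (-(μ * (h * K) / 32)) * W := by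
      refine le_trans (le_of_eq ?_) (mul_le_mul_of_nonneg_left h5 (by positivity))
      have h7 : Real.exp (-(μ * (h * K) / 32)) * Real.exp (μ * (h * K / 16) / 2) = 1 := by
        rw [← Real.exp_add, ← Real.exp_zero]
        congr 1
        ring
      calc (16 : ℝ) = 256 / (h * K) * (h * K / 16) *
            (Real.exp (-(μ * (h * K) / 32)) * Real.exp (μ * (h * K / 16) / 2)) := by
            rw [h7]
            field_simp
            norm_num
        _ = _ := by ring
    nlinarith [sq_nonneg ‖x₀ - xstar‖]
  linarith

theorem fixed_schedule_nonconvex (hg : IsStochasticGradient D F g)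
    (hv : HasBoundedVariance D F g σ) (hF : IsSmooth L F) (hL : 0 < L)
    (hmin : ∀ x, F xstar ≤ F x)
    (hξ : IsIIDSample P D ξ) {K : ℕ} (hγ : IsAdaptiveStep γ L 0 b h) (hh : 0 < h)
    (hlow : ∀ τ : ℕ, 1 ≤ τ → h * (1 - τ / (4 * M)) ≤ 8 * γ τ) (hMK : M ≤ K) (hM : 1 ≤ M)
    (hb : M * b ≤ 1 / (2 * L)) :
    Integrable (fun ω => ∑ k ∈ Finset.Icc 1 K,
      stepHat γ s K k / (∑ j ∈ Finset.Icc 1 K, stepHat γ s K j) *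
        ‖gradient F (iterate g γ x₀ s (fun j m => ξ j m ω) k)‖ ^ 2) P ∧
    ∫ ω, ∑ k ∈ Finset.Icc 1 K, stepHat γ s K k / (∑ j ∈ Finset.Icc 1 K, stepHat γ s K j) *
        ‖gradient F (iterate g γ x₀ s (fun j m => ξ j m ω) k)‖ ^ 2 ∂P ≤
      128 / (h * K) * (F x₀ - F xstar) + 102 * L * σ ^ 2 * h := by
  have hK : 1 ≤ K := hM.trans hMK
  have hK' : (0 : ℝ) < K := by exact_mod_cast hK
  have hX := memLp_iterate γ x₀ s hg hv hF hmin hξ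
  have h1 := weighted_gradient_le x₀ s hg hv hF hL hmin hξ hγ hlow hMK hM hb
  have h2 := IsAdaptiveStep.sum_stepHat_ge s K hh.le hlow hM
  set W := ∑ k ∈ Finset.Icc 1 K, stepHat γ s K k
  have hW : 0 < W := lt_of_lt_of_le (by positivity) h2
  have hi : ∀ k, Integrable (fun ω => stepHat γ s K k / W *
      ‖gradient F (iterate g γ x₀ s (fun j m => ξ j m ω) k)‖ ^ 2) P :=
    fun k => (integrable_norm_gradient_sq hF hmin (hX k)).const_mul _
  refine ⟨integrable_finsetSum _ fun k _ => hi k, ?_⟩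
  rw [integral_finsetSum _ fun k _ => hi k]
  simp_rw [integral_const_mul, div_mul_eq_mul_div]
  rw [← Finset.sum_div, div_le_iff₀ hW]
  have h3 : 8 * (F x₀ - F xstar) ≤ 128 / (h * K) * (F x₀ - F xstar) * W := by
    have h5 : 8 ≤ 128 / (h * K) * W := by
      rw [div_mul_eq_mul_div, le_div_iff₀ (by positivity)]
      linarith
    nlinarith [hmin x₀]
  rw [div_mul_eq_mul_div 128] at h3
  linarith

end FixedSchedule

end AsyncSGD

namespace AsyncSGD

/-! ### The concrete stepsizes and the resulting rates. -/

section Stepsizes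

/-- The common form of the stepsizes: `min {exp(-μτ/(4ML))/(4Lτ), b, η}`. -/
noncomputable def delayStep (M : ℕ) (L μ b η : ℝ) (τ : ℕ) : ℝ :=
  min (min (Real.exp (-(μ * τ) / (4 * M * L)) / (4 * L * τ)) b) η

variable {M K : ℕ} {L σ μ b η B Δ : ℝ}

theorem delayStep_pos (hL : 0 < L) (hb : 0 < b) (hη : 0 < η) {τ : ℕ} (hτ : 1 ≤ τ) :
    0 < delayStep M L μ b η τ := by
  have hτ' : (0 : ℝ) < τ := by exact_mod_cast hτ
  unfold delayStep
  refine lt_min (lt_min ?_ hb) hη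
  positivity

/-- The condition on `b` carries a factor μ so that it is void for μ = 0: the non-convex cap 1/(2ML)
exceeds 1/(4ML). -/
theorem isAdaptiveStep_delayStep (hL : 0 < L) (hb : 0 < b) (hη : 0 < η)
    (hbμ : μ * b ≤ μ / (4 * M * L)) :
    IsAdaptiveStep (delayStep M L μ b η) L μ b (min b η) where
  pos _ hτ := delayStep_pos hL hb hη hτ
  le τ _ := by
    unfold delayStep
    rw [min_assoc]
    exact min_le_right _ _
  mul_le τ hτ := by
    have hτ' : (0 : ℝ) < τ := by exact_mod_cast hτ
    have h1 : delayStep M L μ b η τ ≤ Real.exp (-(μ * τ) / (4 * M * L)) / (4 * L * τ) :=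
      (min_le_left _ _).trans (min_le_left _ _)
    have h2 : Real.exp (μ * b * τ) ≤ Real.exp (μ * τ / (4 * M * L)) := by
      refine Real.exp_le_exp.2 ?_
      rw [mul_div_right_comm]
      gcongr
    calc _ ≤ Real.exp (-(μ * τ) / (4 * M * L)) / (4 * L * τ) *
          (τ * Real.exp (μ * τ / (4 * M * L))) := by gcongr
      _ = (Real.exp (-(μ * τ) / (4 * M * L)) * Real.exp (μ * τ / (4 * M * L))) *
          (τ / (4 * L * τ)) := by ring
      _ = 1 / (4 * L) := by
          rw [← Real.exp_add, neg_div, neg_add_cancel, Real.exp_zero]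
          field_simp
  le_cap := min_le_left _ _

/-- For τ ≥ 4M the left side is nonpositive. For τ < 4M the first term of the stepsize is at least
exp(-μ/L)/(16ML) ≥ b/8. -/
theorem delayStep_lower (hL : 0 < L) (hM : 1 ≤ M) (hμ : 0 ≤ μ) (hb : 0 < b) (hη : 0 < η)
    (hbL : b * (2 * M * L) ≤ Real.exp (-(μ / L))) (τ : ℕ) (hτ : 1 ≤ τ) :
    min b η * (1 - τ / (4 * M)) ≤ 8 * delayStep M L μ b η τ := by
  have hM' : (0 : ℝ) < M := by exact_mod_cast hM
  have hτ' : (0 : ℝ) < τ := by exact_mod_cast hτ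
  have hh : 0 < min b η := lt_min hb hη
  have hpos := delayStep_pos (M := M) (μ := μ) hL hb hη hτ
  rcases le_or_gt (4 * (M : ℝ)) τ with h | h
  · have h1 : (1 : ℝ) ≤ τ / (4 * M) := by
      rw [le_div_iff₀ (by positivity)]
      linarith
    nlinarith
  · have h0 : (0 : ℝ) ≤ τ / (4 * M) := by positivity
    have h1 : min b η * (1 - τ / (4 * M)) ≤ min b η := by nlinarith
    refine h1.trans ?_
    have h2 : min b η ≤ 8 * (Real.exp (-(μ * τ) / (4 * M * L)) / (4 * L * τ)) := by
      have h3 : Real.exp (-(μ / L)) ≤ Real.exp (-(μ * τ) / (4 * M * L)) := by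
        refine Real.exp_le_exp.2 ?_
        rw [neg_div, neg_le_neg_iff, div_le_div_iff₀ (by positivity) hL]
        nlinarith [mul_nonneg hμ hL.le]
      have h4 : b ≤ Real.exp (-(μ / L)) / (2 * M * L) := by
        rw [le_div_iff₀ (by positivity)]
        exact hbL
      calc min b η ≤ b := min_le_left _ _
        _ ≤ Real.exp (-(μ / L)) / (2 * M * L) := h4
        _ ≤ Real.exp (-(μ * τ) / (4 * M * L)) / (2 * M * L) := by gcongr
        _ = 8 * (Real.exp (-(μ * τ) / (4 * M * L)) / (4 * L * (4 * M))) := by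
            field_simp
            norm_num
        _ ≤ _ := by gcongr
    unfold delayStep
    rw [mul_min_of_nonneg _ _ (by norm_num), mul_min_of_nonneg _ _ (by norm_num)]
    refine le_min (le_min h2 ?_) ?_
    · have := min_le_left b η
      linarith
    · have := min_le_right b η
      linarith

/-- The last term of the stepsize of the convex case. -/
noncomputable def convexCap (M K : ℕ) (L σ B : ℝ) : ℝ :=
  if σ = 0 then 1 / (4 * M * L) else B / (σ * √K)

/-- The last term of the stepsize of the strongly convex case. -/
noncomputable def stronglyConvexCap (M K : ℕ) (L σ B μ : ℝ) : ℝ :=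
  if σ = 0 then 1 / (8 * M * L)
  else 504 * Real.log (Real.exp 1 + μ ^ 2 * K ^ 2 * B ^ 2 / σ ^ 2) / (μ * K)

/-- The last term of the stepsize of the non-convex case. -/
noncomputable def nonconvexCap (M K : ℕ) (L σ Δ : ℝ) : ℝ :=
  if σ = 0 then 1 / (2 * M * L) else √(Δ / (K * L * σ ^ 2))

/-- For σ = 0 the cap repeats the second term of the minimum, which represents an infinite third
term. -/
theorem convexStep_eq (M K : ℕ) (L σ B : ℝ) :
    convexStep M K L σ B = delayStep M L 0 (1 / (4 * M * L)) (convexCap M K L σ B) := by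
  funext τ
  unfold convexStep delayStep convexCap
  split_ifs <;> simp [min_assoc]

theorem stronglyConvexStep_eq (M K : ℕ) (L σ B μ : ℝ) :
    stronglyConvexStep M K L σ B μ =
      delayStep M L μ (1 / (8 * M * L)) (stronglyConvexCap M K L σ B μ) := by
  funext τ
  unfold stronglyConvexStep delayStep stronglyConvexCap
  split_ifs <;> simp [min_assoc]

theorem nonconvexStep_eq (M K : ℕ) (L σ Δ : ℝ) :
    nonconvexStep M K L σ Δ = delayStep M L 0 (1 / (2 * M * L)) (nonconvexCap M K L σ Δ) := by
  funext τ
  unfold nonconvexStep delayStep nonconvexCap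
  split_ifs <;> simp [min_assoc]

theorem convexCap_pos (hL : 0 < L) (hσ : 0 ≤ σ) (hM : 1 ≤ M) (hK : 1 ≤ K) (hB : 0 < B) :
    0 < convexCap M K L σ B := by
  have hM' : (0 : ℝ) < M := by exact_mod_cast hM
  have hK' : (0 : ℝ) < K := by exact_mod_cast hK
  unfold convexCap
  split_ifs with h
  · positivity
  · have : 0 < σ := lt_of_le_of_ne hσ (Ne.symm h)
    positivity

theorem one_le_log_exp_one_add {X : ℝ} (hX : 0 ≤ X) : 1 ≤ Real.log (Real.exp 1 + X) := by
  rw [Real.le_log_iff_exp_le (by positivity)]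
  linarith

theorem stronglyConvexCap_pos (hL : 0 < L) (hM : 1 ≤ M) (hK : 1 ≤ K) (hμ : 0 < μ) :
    0 < stronglyConvexCap M K L σ B μ := by
  have hM' : (0 : ℝ) < M := by exact_mod_cast hM
  have hK' : (0 : ℝ) < K := by exact_mod_cast hK
  unfold stronglyConvexCap
  split_ifs with h
  · positivity
  · have := one_le_log_exp_one_add (X := μ ^ 2 * K ^ 2 * B ^ 2 / σ ^ 2) (by positivity)
    positivity

theorem nonconvexCap_pos (hL : 0 < L) (hM : 1 ≤ M) (hK : 1 ≤ K) (hΔ : 0 < Δ) :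
    0 < nonconvexCap M K L σ Δ := by
  have hM' : (0 : ℝ) < M := by exact_mod_cast hM
  have hK' : (0 : ℝ) < K := by exact_mod_cast hK
  unfold nonconvexCap
  split_ifs with h
  · positivity
  · have : 0 < σ ^ 2 := by positivity
    positivity

theorem inv_min_le (hb : 0 < b) (hη : 0 < η) : 1 / min b η ≤ 1 / b + 1 / η := by
  have h1 : 0 < 1 / b := by positivity
  have h2 : 0 < 1 / η := by positivity
  rcases min_choice b η with h | h <;> rw [h] <;> linarith

theorem convex_rate (hL : 0 < L) (hσ : 0 ≤ σ) (hM : 1 ≤ M) (hK : 1 ≤ K) (hB : 0 < B) :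
    16 / (min (1 / (4 * M * L)) (convexCap M K L σ B) * K) * B ^ 2 +
      17 * σ ^ 2 * min (1 / (4 * M * L)) (convexCap M K L σ B) ≤
      64 * (M * L * B ^ 2 / K + σ * B / √K) := by
  have hM' : (0 : ℝ) < M := by exact_mod_cast hM
  have hK' : (0 : ℝ) < K := by exact_mod_cast hK
  have hs : √(K : ℝ) ^ 2 = K := Real.sq_sqrt hK'.le
  have hs0 : 0 < √(K : ℝ) := Real.sqrt_pos.2 hK'
  unfold convexCap
  split_ifs with h
  · rw [h, min_self]
    refine le_of_eq ?_
    field_simp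
    ring
  · have hσ' : 0 < σ := lt_of_le_of_ne hσ (Ne.symm h)
    have h1 := inv_min_le (b := 1 / (4 * M * L)) (η := B / (σ * √K)) (by positivity)
      (by positivity)
    have h2 := min_le_right (1 / (4 * M * L)) (B / (σ * √K))
    have h3 := mul_le_mul_of_nonneg_left h1 (show 0 ≤ 16 * B ^ 2 / K by positivity)
    have h4 := mul_le_mul_of_nonneg_left h2 (show 0 ≤ 17 * σ ^ 2 by positivity)
    have h5 : 16 / (min (1 / (4 * M * L)) (B / (σ * √K)) * K) * B ^ 2 =
        16 * B ^ 2 / K * (1 / min (1 / (4 * M * L)) (B / (σ * √K))) := by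
      rw [div_mul_eq_mul_div, div_mul_div_comm, mul_one, mul_comm (K : ℝ)]
    have h6 : 16 * B ^ 2 / K * (1 / (1 / (4 * M * L)) + 1 / (B / (σ * √K))) =
        64 * (M * L * B ^ 2 / K) + 16 * (σ * B / √K) := by
      -- With √K generalized to r and K to r² this is an identity of rational functions.
      have h7 : ∀ k r : ℝ, 0 < r → r ^ 2 = k →
          16 * B ^ 2 / k * (1 / (1 / (4 * M * L)) + 1 / (B / (σ * r))) =
            64 * (M * L * B ^ 2 / k) + 16 * (σ * B / r) := by
        rintro k r hr rfl
        field_simp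
        ring
      exact h7 K √K hs0 hs
    have h7 : 17 * σ ^ 2 * (B / (σ * √K)) = 17 * (σ * B / √K) := by
      field_simp
    have h8 : 0 ≤ σ * B / √K := by positivity
    rw [h5]
    linarith

theorem nonconvex_rate (hL : 0 < L) (hM : 1 ≤ M) (hK : 1 ≤ K) (hΔ : 0 < Δ) :
    128 / (min (1 / (2 * M * L)) (nonconvexCap M K L σ Δ) * K) * Δ +
      102 * L * σ ^ 2 * min (1 / (2 * M * L)) (nonconvexCap M K L σ Δ) ≤
      256 * (M * L * Δ / K + √(L * Δ * σ ^ 2 / K)) := by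
  have hM' : (0 : ℝ) < M := by exact_mod_cast hM
  have hK' : (0 : ℝ) < K := by exact_mod_cast hK
  unfold nonconvexCap
  split_ifs with h
  · rw [h, min_self]
    simp only [ne_eq, OfNat.ofNat_ne_zero, not_false_eq_true, zero_pow, mul_zero, zero_mul,
      zero_div, Real.sqrt_zero, add_zero]
    refine le_of_eq ?_
    field_simp
    ring
  · have hσ : 0 < σ ^ 2 := by positivity
    set η := √(Δ / (K * L * σ ^ 2)) with hη
    have hη0 : 0 < η := Real.sqrt_pos.2 (by positivity)
    have hη2 : η ^ 2 = Δ / (K * L * σ ^ 2) := Real.sq_sqrt (by positivity)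
    -- The cap η balances the two errors: Δ/(Kη) and Lσ²η both equal this root.
    have hr : √(L * Δ * σ ^ 2 / K) = L * σ ^ 2 * η := by
      rw [Real.sqrt_eq_iff_mul_self_eq (by positivity) (by positivity)]
      have : L * σ ^ 2 * η * (L * σ ^ 2 * η) = L ^ 2 * (σ ^ 2) ^ 2 * η ^ 2 := by ring
      rw [this, hη2]
      field_simp
    have hΔη : Δ / K = L * σ ^ 2 * η ^ 2 := by
      rw [hη2]
      field_simp
    have h1 := inv_min_le (b := 1 / (2 * M * L)) (η := η) (by positivity) hη0
    have h2 := min_le_right (1 / (2 * M * L)) η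
    have h3 := mul_le_mul_of_nonneg_left h1 (show 0 ≤ 128 * (Δ / K) by positivity)
    have h4 := mul_le_mul_of_nonneg_left h2 (show 0 ≤ 102 * L * σ ^ 2 by positivity)
    have h5 : 128 / (min (1 / (2 * M * L)) η * K) * Δ =
        128 * (Δ / K) * (1 / min (1 / (2 * M * L)) η) := by
      ring
    have h6 : 128 * (Δ / K) * (1 / (1 / (2 * M * L)) + 1 / η) =
        256 * (M * L * Δ / K) + 128 * (L * σ ^ 2 * η) := by
      rw [mul_add]
      congr 1
      · field_simp
        ring
      · rw [hΔη]
        field_simp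
    have h8 : 0 ≤ L * σ ^ 2 * η := by positivity
    rw [h5, hr]
    linarith

/-- If the cap 1/(8ML) is the minimum, the first term decays with rate 1/(8 · 32) = 1/256. If the
logarithmic cap is, the exponential is at most 1/(e + X) and the first term is of the order of the
noise. The noise constant is 748 · 504 = 376992. -/
theorem stronglyConvex_rate (hL : 0 < L) (hM : 1 ≤ M) (hK : 1 ≤ K)
    (hμ : 0 < μ) :
    256 / (min (1 / (8 * M * L)) (stronglyConvexCap M K L σ B μ) * K) *
        Real.exp (-(μ * (min (1 / (8 * M * L)) (stronglyConvexCap M K L σ B μ) * K) / 32)) *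
        B ^ 2 +
      748 * σ ^ 2 * min (1 / (8 * M * L)) (stronglyConvexCap M K L σ B μ) ≤
      400000 * (M * L * B ^ 2 * Real.exp (-(1 / 256 * K * μ) / (M * L)) +
            σ ^ 2 / (μ * K) * Real.log (Real.exp 1 + μ ^ 2 * K ^ 2 * B ^ 2 / σ ^ 2)) := by
  have hM' : (0 : ℝ) < M := by exact_mod_cast hM
  have hK' : (1 : ℝ) ≤ K := by exact_mod_cast hK
  have hK0 : (0 : ℝ) < K := by linarith
  set X := μ ^ 2 * K ^ 2 * B ^ 2 / σ ^ 2 with hX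
  have hX0 : 0 ≤ X := by positivity
  have hlog := one_le_log_exp_one_add hX0
  have hcap : 256 / (1 / (8 * M * L) * K) * Real.exp (-(μ * (1 / (8 * M * L) * K) / 32)) * B ^ 2 ≤
      2048 * (M * L * B ^ 2 * Real.exp (-(1 / 256 * K * μ) / (M * L))) := by
    have h1 : -(μ * (1 / (8 * M * L) * K) / 32) = -(1 / 256 * K * μ) / (M * L) := by
      field_simp
      norm_num
    rw [h1]
    have h2 : 256 / (1 / (8 * M * L) * K) ≤ 2048 * (M * L) := by
      rw [div_le_iff₀ (by positivity)]
      have : 2048 * (M * L) * (1 / (8 * M * L) * K) = 256 * K := by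
        field_simp
        norm_num
      linarith
    have h3 := mul_le_mul_of_nonneg_right h2
      (show 0 ≤ Real.exp (-(1 / 256 * K * μ) / (M * L)) * B ^ 2 by positivity)
    linarith
  have hE : 0 ≤ M * L * B ^ 2 * Real.exp (-(1 / 256 * K * μ) / (M * L)) := by positivity
  have hN : 0 ≤ σ ^ 2 / (μ * K) * Real.log (Real.exp 1 + X) := by positivity
  unfold stronglyConvexCap
  split_ifs with h
  · rw [min_self]
    have : 748 * σ ^ 2 * (1 / (8 * M * L)) = 0 := by
      rw [h]
      ring
    linarith
  · have hσ : 0 < σ ^ 2 := by positivity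
    set l := Real.log (Real.exp 1 + X) with hl
    set η := 504 * l / (μ * K) with hη
    have hη0 : 0 < η := by positivity
    have hnoise : 748 * σ ^ 2 * min (1 / (8 * M * L)) η ≤ 376992 * (σ ^ 2 / (μ * K) * l) := by
      have h4 := mul_le_mul_of_nonneg_left (min_le_right (1 / (8 * M * L)) η)
        (show 0 ≤ 748 * σ ^ 2 by positivity)
      have : 748 * σ ^ 2 * η = 376992 * (σ ^ 2 / (μ * K) * l) := by
        rw [hη]
        ring
      linarith
    have hsmall : 256 / (η * K) * Real.exp (-(μ * (η * K) / 32)) * B ^ 2 ≤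
        σ ^ 2 / (μ * K) * l := by
      have h1 : μ * (η * K) = 504 * l := by
        rw [hη]
        field_simp
      have h2 : Real.exp (-(μ * (η * K) / 32)) ≤ (Real.exp 1 + X)⁻¹ := by
        rw [h1, ← Real.exp_log (show 0 < Real.exp 1 + X by positivity), ← Real.exp_neg, ← hl]
        refine Real.exp_le_exp.2 ?_
        linarith
      have h3 : B ^ 2 = X * σ ^ 2 / (μ ^ 2 * K ^ 2) := by
        rw [hX]
        field_simp
      have h4 : (Real.exp 1 + X)⁻¹ * X ≤ 1 := by
        rw [inv_mul_le_iff₀ (by positivity)]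
        linarith [Real.exp_pos 1]
      have h5 : 256 / (η * K) ≤ μ := by
        rw [div_le_iff₀ (by positivity), h1]
        linarith
      -- B² is proportional to X, so the factor 1/(e + X) removes the dependence on the initial
      -- distance.
      calc _ ≤ μ * (Real.exp 1 + X)⁻¹ * B ^ 2 := by gcongr
        _ = ((Real.exp 1 + X)⁻¹ * X) * (σ ^ 2 / (μ * K ^ 2)) := by
            rw [h3]
            field_simp
        _ ≤ 1 * (σ ^ 2 / (μ * K ^ 2)) := by gcongr
        _ ≤ σ ^ 2 / (μ * K) := by
            rw [one_mul]
            gcongr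
            nlinarith
        _ ≤ _ := le_mul_of_one_le_right (by positivity) hlog
    rcases min_choice (1 / (8 * M * L)) η with hmin | hmin
    · rw [hmin] at hnoise ⊢
      linarith
    · rw [hmin] at hnoise ⊢
      linarith

end Stepsizes

end AsyncSGD

namespace AsyncSGD

/-! ### Measurability in the schedule, and its recovery from the delays. -/

section Schedules

variable {M : ℕ}

/-- The schedule whose entries up to `K` are given and constant from there on. -/
def extendSchedule (K : ℕ) (v : Fin (K + 1) → Fin M) (j : ℕ) : Fin M :=
  v ⟨min j K, by omega⟩

/-- Only finitely many entries of the schedule matter, so joint measurability reduces to a product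
with a countable space. -/
theorem measurable_of_schedule {A : Type*} [MeasurableSpace A] {K : ℕ}
    {Φ : A → (ℕ → Fin M) → ℝ}
    (hcongr : ∀ a s s', (∀ j, 1 ≤ j → j ≤ K → s j = s' j) → Φ a s = Φ a s')
    (hmeas : ∀ s, Measurable fun a => Φ a s) :
    Measurable (fun p : A × (ℕ → Fin M) => Φ p.1 p.2) := by
  have h1 : Measurable (fun p : A × (Fin (K + 1) → Fin M) => Φ p.1 (extendSchedule K p.2)) :=
    measurable_from_prod_countable_left fun v => hmeas (extendSchedule K v)
  have h2 : Measurable (fun p : A × (ℕ → Fin M) =>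
      (p.1, fun i : Fin (K + 1) => p.2 (i : ℕ))) := by
    refine measurable_fst.prodMk (measurable_pi_iff.2 fun i => ?_)
    exact (measurable_pi_apply _).comp measurable_snd
  convert h1.comp h2 using 1
  funext p
  refine hcongr _ _ _ fun j _ hj => ?_
  simp [extendSchedule, min_eq_left hj]

/-- This is why independence from the delays is independence from the schedule. It fails at `j = 0`,
where every worker has delay 1. -/
theorem delay_succ_eq_one_iff (s : ℕ → Fin M) {j : ℕ} (hj : 1 ≤ j) (m : Fin M) :
    delay s (j + 1) m = 1 ↔ s j = m := by
  unfold delay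
  rw [prev_succ s hj]
  have := prev_lt s hj m
  split_ifs with h
  · simp [h]
  · simp only [h, iff_false]
    omega

open Classical in
/-- The schedule read off the delays. -/
noncomputable def readSchedule (m₀ : Fin M) (τ : ℕ → Fin M → ℕ) (j : ℕ) : Fin M :=
  if h : 1 ≤ j ∧ ∃ m, τ (j + 1) m = 1 then h.2.choose else m₀

theorem readSchedule_delay (m₀ : Fin M) (s : ℕ → Fin M) {j : ℕ} (hj : 1 ≤ j) :
    readSchedule m₀ (fun k m => delay s k m) j = s j := by
  have h : 1 ≤ j ∧ ∃ m, delay s (j + 1) m = 1 :=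
    ⟨hj, s j, (delay_succ_eq_one_iff s hj _).2 rfl⟩
  unfold readSchedule
  rw [dif_pos h]
  exact ((delay_succ_eq_one_iff s hj _).1 h.2.choose_spec).symm

theorem readSchedule_zero (m₀ : Fin M) (τ : ℕ → Fin M → ℕ) : readSchedule m₀ τ 0 = m₀ := by
  simp [readSchedule]

theorem measurable_readSchedule (m₀ : Fin M) : Measurable (readSchedule m₀) := by
  classical
  refine measurable_pi_iff.2 fun j => ?_
  have h : Measurable (fun t : Fin M → ℕ =>
      if h : 1 ≤ j ∧ ∃ m, t m = 1 then h.2.choose else m₀) := Measurable.of_discrete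
  have h' : Measurable (fun τ : ℕ → Fin M → ℕ => τ (j + 1)) := measurable_pi_apply (j + 1)
  convert h.comp h' using 1
  funext τ
  simp only [Function.comp_apply, readSchedule]

end Schedules

/-! ### From fixed to random schedules and initial points. -/

section Disintegration

variable {M d : ℕ} {Ω Ξ : Type*} [MeasurableSpace Ξ]
  {x₀ : Ω → EuclideanSpace ℝ (Fin d)} {s : ℕ → Ω → Fin M} {ξ : ℕ → Fin M → Ω → Ξ}

theorem measurable_runSigma {K : ℕ}
    {Φ : EuclideanSpace ℝ (Fin d) × (ℕ → Fin M → Ξ) → (ℕ → Fin M) → ℝ}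
    (hcongr : ∀ a s s', (∀ j, 1 ≤ j → j ≤ K → s j = s' j) → Φ a s = Φ a s')
    (hmeas : ∀ s, Measurable fun a => Φ a s) :
    Measurable[runSigma x₀ s ξ] (fun ω => Φ (x₀ ω, fun j m => ξ j m ω) (fun j => s j ω)) := by
  have h1 : Measurable (fun p : EuclideanSpace ℝ (Fin d) × (ℕ → Fin M) × (ℕ → Fin M → Ξ) =>
      Φ (p.1, p.2.2) p.2.1) :=
    (measurable_of_schedule hcongr hmeas).comp ((measurable_fst.prodMk
      (measurable_snd.comp measurable_snd)).prodMk (measurable_fst.comp measurable_snd))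
  exact h1.comp (comap_measurable _)

variable [mΩ : MeasurableSpace Ω]

theorem runSigma_le (hx₀ : Measurable x₀) (hs : ∀ k, Measurable (s k))
    (hξ : ∀ k m, Measurable (ξ k m)) : runSigma x₀ s ξ ≤ mΩ :=
  (hx₀.prodMk ((measurable_pi_iff.2 hs).prodMk
    (measurable_pi_iff.2 fun j => measurable_pi_iff.2 fun m => hξ j m))).comap_le

variable {P : Measure Ω} [IsProbabilityMeasure P]

/-- A bound for all deterministic initial points and schedules carries over to random ones that are
independent of the samples. -/
theorem integral_le_of_fixed_schedule (hx₀ : Measurable x₀) (hs : ∀ k, Measurable (s k))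
    (hξ : ∀ k m, Measurable (ξ k m)) (hind : DataIndependentOfDelays P x₀ s ξ) {K : ℕ}
    {Φ : EuclideanSpace ℝ (Fin d) × (ℕ → Fin M → Ξ) → (ℕ → Fin M) → ℝ}
    (hcongr : ∀ a s s', (∀ j, 1 ≤ j → j ≤ K → s j = s' j) → Φ a s = Φ a s')
    (hmeas : ∀ s, Measurable fun a => Φ a s) (hnn : ∀ a s, 0 ≤ Φ a s)
    {C : EuclideanSpace ℝ (Fin d) → ℝ} (hC : Measurable C) (hCi : Integrable (fun ω => C (x₀ ω)) P)
    (hfix : ∀ x s, Integrable (fun ω => Φ (x, fun j m => ξ j m ω) s) P ∧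
      ∫ ω, Φ (x, fun j m => ξ j m ω) s ∂P ≤ C x) :
    Integrable (fun ω => Φ (x₀ ω, fun j m => ξ j m ω) (fun j => s j ω)) P ∧
      ∫ ω, Φ (x₀ ω, fun j m => ξ j m ω) (fun j => s j ω) ∂P ≤ ∫ ω, C (x₀ ω) ∂P := by
  obtain ⟨ω₀⟩ : Nonempty Ω := nonempty_of_isProbabilityMeasure P
  set m₀ : Fin M := s 0 ω₀
  set X : Ω → EuclideanSpace ℝ (Fin d) × (ℕ → Fin M) := fun ω =>
    (x₀ ω, readSchedule m₀ (fun k m => delay (fun j => s j ω) k m)) with hX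
  set Z : Ω → (ℕ → Fin M → Ξ) := fun ω j m => ξ j m ω with hZ
  have hZm : Measurable Z :=
    measurable_pi_iff.2 fun j => measurable_pi_iff.2 fun m => hξ j m
  have hXm : Measurable X := by
    refine hx₀.prodMk (measurable_pi_iff.2 fun j => ?_)
    rcases Nat.eq_zero_or_pos j with rfl | hj
    · simp_rw [readSchedule_zero]
      exact measurable_const
    · simp_rw [readSchedule_delay m₀ _ hj]
      exact hs j
  -- `X` is a measurable function of x₀ and the delays alone, and contains the true schedule from
  -- index 1 on.
  have hXZ : IndepFun X Z P := by
    have h := hind.comp (φ := fun p : EuclideanSpace ℝ (Fin d) × (ℕ → Fin M → ℕ) =>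
      (p.1, readSchedule m₀ p.2)) (ψ := id)
      (measurable_fst.prodMk ((measurable_readSchedule m₀).comp measurable_snd)) measurable_id
    exact h
  have heq : ∀ ω, Φ (x₀ ω, fun j m => ξ j m ω) (fun j => s j ω) =
      Φ ((X ω).1, Z ω) (X ω).2 := fun ω =>
    hcongr _ _ _ fun j hj _ => (readSchedule_delay m₀ (fun j => s j ω) hj).symm
  have hΦ : Measurable (fun p : (EuclideanSpace ℝ (Fin d) × (ℕ → Fin M)) × (ℕ → Fin M → Ξ) =>
      Φ (p.1.1, p.2) p.1.2) :=
    (measurable_of_schedule hcongr hmeas).comp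
      (((measurable_fst.comp measurable_fst).prodMk measurable_snd).prodMk
        (measurable_snd.comp measurable_fst))
  have hprod := (indepFun_iff_map_prod_eq_prod_map_map hXm.aemeasurable hZm.aemeasurable).1 hXZ
  have : IsProbabilityMeasure (P.map Z) := Measure.isProbabilityMeasure_map hZm.aemeasurable
  have : IsProbabilityMeasure (P.map X) := Measure.isProbabilityMeasure_map hXm.aemeasurable
  -- The bound is nonnegative because it dominates the integral of a nonnegative function.
  have hC0 : ∀ x, 0 ≤ C x := fun x =>
    (integral_nonneg fun ω => hnn _ _).trans (hfix x fun _ => m₀).2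
  have hΦm : Measurable (fun ω => Φ ((X ω).1, Z ω) (X ω).2) := hΦ.comp (hXm.prodMk hZm)
  have hle : ∫⁻ ω, ENNReal.ofReal (Φ ((X ω).1, Z ω) (X ω).2) ∂P ≤
      ENNReal.ofReal (∫ ω, C (x₀ ω) ∂P) := by
    calc ∫⁻ ω, ENNReal.ofReal (Φ ((X ω).1, Z ω) (X ω).2) ∂P
        = ∫⁻ p, ENNReal.ofReal (Φ (p.1.1, p.2) p.1.2) ∂(P.map fun ω => (X ω, Z ω)) :=
          (lintegral_map (f := fun p : (EuclideanSpace ℝ (Fin d) × (ℕ → Fin M)) ×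
            (ℕ → Fin M → Ξ) => ENNReal.ofReal (Φ (p.1.1, p.2) p.1.2))
            (ENNReal.measurable_ofReal.comp hΦ) (hXm.prodMk hZm)).symm
      _ = ∫⁻ a, ∫⁻ z, ENNReal.ofReal (Φ (a.1, z) a.2) ∂(P.map Z) ∂(P.map X) := by
          rw [hprod]
          exact lintegral_prod _ (ENNReal.measurable_ofReal.comp hΦ).aemeasurable
      _ ≤ ∫⁻ a, ENNReal.ofReal (C a.1) ∂(P.map X) := by
          refine lintegral_mono fun a => ?_
          have h1 : Measurable (fun z : ℕ → Fin M → Ξ => ENNReal.ofReal (Φ (a.1, z) a.2)) :=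
            ENNReal.measurable_ofReal.comp (hΦ.comp (measurable_const.prodMk measurable_id))
          rw [lintegral_map h1 hZm, ← ofReal_integral_eq_lintegral_ofReal (hfix a.1 a.2).1
            (Filter.Eventually.of_forall fun ω => hnn _ _)]
          exact ENNReal.ofReal_le_ofReal (hfix a.1 a.2).2
      _ = ∫⁻ ω, ENNReal.ofReal (C (x₀ ω)) ∂P :=
          lintegral_map (f := fun a : EuclideanSpace ℝ (Fin d) × (ℕ → Fin M) =>
            ENNReal.ofReal (C a.1))
            (ENNReal.measurable_ofReal.comp (hC.comp measurable_fst)) hXm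
      _ = ENNReal.ofReal (∫ ω, C (x₀ ω) ∂P) :=
          (ofReal_integral_eq_lintegral_ofReal hCi
            (Filter.Eventually.of_forall fun ω => hC0 _)).symm
  simp_rw [heq]
  have hint : Integrable (fun ω => Φ ((X ω).1, Z ω) (X ω).2) P := by
    refine ⟨hΦm.aestronglyMeasurable, ?_⟩
    rw [hasFiniteIntegral_iff_ofReal (Filter.Eventually.of_forall fun ω => hnn _ _)]
    exact hle.trans_lt ENNReal.ofReal_lt_top
  refine ⟨hint, ?_⟩
  rw [← ofReal_integral_eq_lintegral_ofReal hint
    (Filter.Eventually.of_forall fun ω => hnn _ _)] at hle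
  exact (ENNReal.ofReal_le_ofReal_iff (integral_nonneg fun ω => hC0 _)).1 hle

end Disintegration

/-! ### Averaging over a random index. -/

section RandomIndex

variable {Ω : Type*} {m : MeasurableSpace Ω} [mΩ : MeasurableSpace Ω]
  {P : Measure Ω} [IsProbabilityMeasure P]

/-- The measure P restricted to A and the measure with density p agree on the σ-algebra `m`, by the
defining property of conditional expectation; hence so do their integrals of `m`-measurable
functions. -/
theorem setLIntegral_eq_of_condExp_indicator (hm : m ≤ mΩ) {A : Set Ω} (hA : MeasurableSet A)
    {p : Ω → ℝ} (hp0 : ∀ ω, 0 ≤ p ω) (hp : P[A.indicator (fun _ => (1 : ℝ)) | m] =ᵐ[P] p)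
    {f : Ω → ENNReal} (hf : Measurable[m] f) :
    ∫⁻ ω in A, f ω ∂P = ∫⁻ ω, ENNReal.ofReal (p ω) * f ω ∂P := by
  have h1 : Integrable (A.indicator fun _ => (1 : ℝ)) P := (integrable_const 1).indicator hA
  have hpi : Integrable p P := integrable_condExp.congr hp
  have hpm : AEMeasurable (fun ω => ENNReal.ofReal (p ω)) P :=
    hpi.1.aemeasurable.ennreal_ofReal
  have htrim : (P.restrict A).trim hm =
      (P.withDensity fun ω => ENNReal.ofReal (p ω)).trim hm := by
    refine @Measure.ext _ m _ _ fun B hB => ?_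
    rw [trim_measurableSet_eq hm hB, trim_measurableSet_eq hm hB,
      Measure.restrict_apply (hm B hB), withDensity_apply _ (hm B hB)]
    have h2 : ∫ ω in B, p ω ∂P = P.real (B ∩ A) := by
      rw [← setIntegral_congr_ae (hm B hB) (hp.mono fun ω h _ => h),
        setIntegral_condExp hm h1 hB, integral_indicator hA, Measure.restrict_restrict hA]
      simp [Set.inter_comm]
    rw [← ofReal_integral_eq_lintegral_ofReal hpi.integrableOn
      (Filter.Eventually.of_forall hp0), h2, ofReal_measureReal]
  rw [← lintegral_trim hm hf, htrim, lintegral_trim hm hf,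
    lintegral_withDensity_eq_lintegral_mul₀ hpm (hf.mono hm le_rfl).aemeasurable]
  rfl

/-- The mean of a nonnegative process at a random index with given conditional probabilities. -/
theorem integral_random_index (hm : m ≤ mΩ) {T : Finset ℕ} {κ : Ω → ℕ} (hκ : Measurable κ)
    (hκT : ∀ ω, κ ω ∈ T) {p : Ω → ℕ → ℝ} (hp0 : ∀ ω, ∀ k ∈ T, 0 ≤ p ω k)
    (hp : ∀ k ∈ T, P[(κ ⁻¹' {k}).indicator (fun _ => (1 : ℝ)) | m] =ᵐ[P] fun ω => p ω k)
    {G : ℕ → Ω → ℝ} (hG : ∀ k ∈ T, Measurable[m] (G k)) (hG0 : ∀ k ω, 0 ≤ G k ω)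
    (hint : Integrable (fun ω => ∑ k ∈ T, p ω k * G k ω) P) :
    Integrable (fun ω => G (κ ω) ω) P ∧
      ∫ ω, G (κ ω) ω ∂P = ∫ ω, ∑ k ∈ T, p ω k * G k ω ∂P := by
  have hA : ∀ k, MeasurableSet (κ ⁻¹' {k}) := fun k => hκ (measurableSet_singleton k)
  have hsum : ∀ ω, G (κ ω) ω = ∑ k ∈ T, (κ ⁻¹' {k}).indicator (G k) ω := by
    intro ω
    rw [Finset.sum_eq_single_of_mem (κ ω) (hκT ω)]
    · simp
    · intro k _ hk
      exact Set.indicator_of_notMem (fun h => hk h.symm) _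
  have hmeas : Measurable (fun ω => G (κ ω) ω) := by
    simp_rw [hsum]
    exact Finset.measurable_sum _ fun k hk => ((hG k hk).mono hm le_rfl).indicator (hA k)
  have hsum' : ∀ ω, ENNReal.ofReal (G (κ ω) ω) =
      ∑ k ∈ T, (κ ⁻¹' {k}).indicator (fun ω => ENNReal.ofReal (G k ω)) ω := by
    intro ω
    rw [Finset.sum_eq_single_of_mem (κ ω) (hκT ω)]
    · simp
    · intro k _ hk
      exact Set.indicator_of_notMem (fun h => hk h.symm) _
  have hpG0 : ∀ ω, ∀ k ∈ T, 0 ≤ p ω k * G k ω := fun ω k hk => mul_nonneg (hp0 ω k hk) (hG0 k ω)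
  have hGm : ∀ k ∈ T, Measurable[m] (fun ω => ENNReal.ofReal (G k ω)) := fun k hk =>
    ENNReal.measurable_ofReal.comp (hG k hk)
  have key : ∫⁻ ω, ENNReal.ofReal (G (κ ω) ω) ∂P =
      ∫⁻ ω, ENNReal.ofReal (∑ k ∈ T, p ω k * G k ω) ∂P := by
    have hpm : ∀ k ∈ T, AEMeasurable (fun ω => ENNReal.ofReal (p ω k)) P := fun k hk =>
      (integrable_condExp.congr (hp k hk)).1.aemeasurable.ennreal_ofReal
    simp_rw [hsum']
    rw [lintegral_finsetSum' _ fun k hk =>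
      (((hGm k hk).mono hm le_rfl).indicator (hA k)).aemeasurable]
    have h3 : ∀ ω, ENNReal.ofReal (∑ k ∈ T, p ω k * G k ω) =
        ∑ k ∈ T, ENNReal.ofReal (p ω k) * ENNReal.ofReal (G k ω) := by
      intro ω
      rw [ENNReal.ofReal_sum_of_nonneg (hpG0 ω)]
      exact Finset.sum_congr rfl fun k hk => ENNReal.ofReal_mul (hp0 ω k hk)
    simp_rw [h3]
    have h4 : ∀ k ∈ T,
        AEMeasurable (fun ω => ENNReal.ofReal (p ω k) * ENNReal.ofReal (G k ω)) P :=
      fun k hk => (hpm k hk).mul ((hGm k hk).mono hm le_rfl).aemeasurable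
    rw [lintegral_finsetSum' _ h4]
    refine Finset.sum_congr rfl fun k hk => ?_
    rw [lintegral_indicator (hA k)]
    have hp' : P[(κ ⁻¹' {k}).indicator (fun _ => (1 : ℝ)) | m] =ᵐ[P] fun ω => max (p ω k) 0 := by
      refine (hp k hk).trans (Filter.Eventually.of_forall fun ω => ?_)
      exact (max_eq_left (hp0 ω k hk)).symm
    rw [setLIntegral_eq_of_condExp_indicator hm (hA k) (fun ω => le_max_right _ _) hp'
      (hGm k hk)]
    refine lintegral_congr fun ω => ?_
    rw [max_eq_left (hp0 ω k hk)]
  have hH0 : ∀ ω, 0 ≤ ∑ k ∈ T, p ω k * G k ω := fun ω => Finset.sum_nonneg (hpG0 ω)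
  have hi : Integrable (fun ω => G (κ ω) ω) P := by
    refine ⟨hmeas.aestronglyMeasurable, ?_⟩
    rw [hasFiniteIntegral_iff_ofReal (Filter.Eventually.of_forall fun ω => hG0 _ _), key]
    exact (hasFiniteIntegral_iff_ofReal (Filter.Eventually.of_forall hH0)).1 hint.2
  refine ⟨hi, ?_⟩
  rw [integral_eq_lintegral_of_nonneg_ae (Filter.Eventually.of_forall fun ω => hG0 _ _) hi.1,
    integral_eq_lintegral_of_nonneg_ae (Filter.Eventually.of_forall hH0) hint.1, key]

end RandomIndex

end AsyncSGD

namespace AsyncSGD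

/-! ### The three cases for random schedules. -/

section Rates

variable {M d : ℕ} {Ω Ξ : Type*} [MeasurableSpace Ω] [MeasurableSpace Ξ]
  {P : Measure Ω} [IsProbabilityMeasure P] {D : Measure Ξ}
  {F : EuclideanSpace ℝ (Fin d) → ℝ}
  {g : EuclideanSpace ℝ (Fin d) → Ξ → EuclideanSpace ℝ (Fin d)} {L σ : ℝ}
  {x₀ : Ω → EuclideanSpace ℝ (Fin d)} {s : ℕ → Ω → Fin M} {ξ : ℕ → Fin M → Ω → Ξ}
  {xstar : EuclideanSpace ℝ (Fin d)}

theorem measurable_iterate_of_schedule (hg : IsStochasticGradient D F g) (γ : ℕ → ℝ)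
    (s : ℕ → Fin M) (k : ℕ) :
    Measurable (fun a : EuclideanSpace ℝ (Fin d) × (ℕ → Fin M → Ξ) =>
      iterate g γ a.1 s a.2 k) := by
  induction k using Nat.strong_induction_on with
  | _ k ih =>
    cases k with
    | zero =>
      simp_rw [iterate]
      exact measurable_fst
    | succ k =>
      have hl := prev_lt s (Nat.succ_pos k) (s (k + 1))
      simp_rw [iterate]
      have h1 : Measurable (fun a : EuclideanSpace ℝ (Fin d) × (ℕ → Fin M → Ξ) =>
          a.2 (prev s (k + 1) (s (k + 1))) (s (k + 1))) :=
        (measurable_pi_apply _).comp ((measurable_pi_apply _).comp measurable_snd)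
      exact (ih k (by omega)).sub (measurable_smul_gradient_at hg (ih _ hl) h1 _)

theorem weightedAverage_congr {E : Type*} [AddCommGroup E] [Module ℝ E] {w w' : ℕ → ℝ}
    {x x' : ℕ → E} {K : ℕ} (hw : ∀ k, 1 ≤ k → k ≤ K → w k = w' k)
    (hx : ∀ k, 1 ≤ k → k ≤ K → x k = x' k) : weightedAverage w x K = weightedAverage w' x' K := by
  have h1 : ∀ k ∈ Finset.Icc 1 K, w k = w' k := fun k hk =>
    hw k (Finset.mem_Icc.1 hk).1 (Finset.mem_Icc.1 hk).2
  have h2 : ∀ k ∈ Finset.Icc 1 K, w k • x k = w' k • x' k := fun k hk => by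
    rw [h1 k hk, hx k (Finset.mem_Icc.1 hk).1 (Finset.mem_Icc.1 hk).2]
  unfold weightedAverage
  rw [Finset.sum_congr rfl h1, Finset.sum_congr rfl h2]

/-- From fixed to random initial points and schedules, for averaged outputs. -/
theorem integral_averagedOutput_le (hg : IsStochasticGradient D F g) (hF : IsSmooth L F)
    (hmin : ∀ x, F xstar ≤ F x) (hx₀ : Measurable x₀) (hs : ∀ k, Measurable (s k))
    (hξ : IsIIDSample P D ξ) (hind : DataIndependentOfDelays P x₀ s ξ) {K : ℕ} {γ : ℕ → ℝ}
    {w : (ℕ → Fin M) → ℕ → ℝ}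
    (hw : ∀ s s' : ℕ → Fin M, (∀ j, 1 ≤ j → j ≤ K → s j = s' j) →
      ∀ k, 1 ≤ k → k ≤ K → w s k = w s' k) {B α β : ℝ} (hα : 0 ≤ α)
    (hi : Integrable (fun ω => ‖x₀ ω - xstar‖ ^ 2) P) (hB : ∫ ω, ‖x₀ ω - xstar‖ ^ 2 ∂P ≤ B ^ 2)
    (hfix : ∀ x s, Integrable (fun ω =>
      F (weightedAverage (w s) (iterate g γ x s (fun j m => ξ j m ω)) K) - F xstar) P ∧
      ∫ ω, (F (weightedAverage (w s) (iterate g γ x s (fun j m => ξ j m ω)) K) - F xstar) ∂P ≤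
        α * ‖x - xstar‖ ^ 2 + β) :
    Integrable (fun ω => F (weightedAverage (w fun j => s j ω) (run g γ x₀ s ξ ω) K) -
        F xstar) P ∧
      ∫ ω, (F (weightedAverage (w fun j => s j ω) (run g γ x₀ s ξ ω) K) - F xstar) ∂P ≤
        α * B ^ 2 + β := by
  have h := integral_le_of_fixed_schedule hx₀ hs hξ.measurable hind (K := K)
    (Φ := fun a s => F (weightedAverage (w s) (iterate g γ a.1 s a.2) K) - F xstar)
    (C := fun x => α * ‖x - xstar‖ ^ 2 + β)
    (fun a s s' hss => by
      rw [weightedAverage_congr (hw s s' hss) fun k _ hk => iterate_congr hss g γ a.1 a.2 hk])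
    (fun s => by
      have h1 : Measurable (fun a : EuclideanSpace ℝ (Fin d) × (ℕ → Fin M → Ξ) =>
          ∑ k ∈ Finset.Icc 1 K, w s k • iterate g γ a.1 s a.2 k) :=
        Finset.measurable_sum _ fun k _ =>
          (measurable_iterate_of_schedule hg γ s k).const_smul (w s k)
      exact (hF.1.continuous.measurable.comp
        (h1.const_smul (∑ k ∈ Finset.Icc 1 K, w s k)⁻¹)).sub_const _)
    (fun a s => sub_nonneg.2 (hmin _)) (by fun_prop)
    ((hi.const_mul α).add (integrable_const β)) hfix
  refine ⟨h.1, h.2.trans ?_⟩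
  rw [integral_add (hi.const_mul α) (integrable_const β), integral_const_mul, integral_const,
    probReal_univ, one_smul]
  have := mul_le_mul_of_nonneg_left hB hα
  linarith

variable [IsProbabilityMeasure D]

theorem convex_case (hM : 1 ≤ M) (hg : IsStochasticGradient D F g) (hL : 0 < L)
    (hF : IsSmooth L F) (hσ : 0 ≤ σ) (hv : HasBoundedVariance D F g σ) (hx₀ : Measurable x₀)
    (hs : ∀ k, Measurable (s k)) (hξ : IsIIDSample P D ξ)
    (hind : DataIndependentOfDelays P x₀ s ξ) (hmin : ∀ x, F xstar ≤ F x)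
    {K : ℕ} {B : ℝ} (hMK : M ≤ K) (hc : ConvexOn ℝ Set.univ F) (hB : 0 < B)
    (hi : Integrable (fun ω => ‖x₀ ω - xstar‖ ^ 2) P)
    (hiB : ∫ ω, ‖x₀ ω - xstar‖ ^ 2 ∂P ≤ B ^ 2) :
    Integrable (fun ω => F (convexOutput g (convexStep M K L σ B) x₀ s ξ K ω) - F xstar) P ∧
      ∫ ω, (F (convexOutput g (convexStep M K L σ B) x₀ s ξ K ω) - F xstar) ∂P ≤
        64 * (M * L * B ^ 2 / K + σ * B / √K) := by
  have hK : 1 ≤ K := hM.trans hMK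
  have hM' : (0 : ℝ) < M := by exact_mod_cast hM
  have hb : (0 : ℝ) < 1 / (4 * M * L) := by positivity
  have hη := convexCap_pos (M := M) hL hσ hM hK hB
  have hγ := isAdaptiveStep_delayStep (M := M) (μ := 0) hL hb hη (by simp)
  have hlow := delayStep_lower hL hM le_rfl hb hη (by
    rw [zero_div, neg_zero, Real.exp_zero, div_mul_eq_mul_div, div_le_one (by positivity)]
    nlinarith [mul_pos hM' hL])
  rw [convexStep_eq]
  set γ := delayStep M L 0 (1 / (4 * M * L)) (convexCap M K L σ B)
  have hh := lt_min hb hη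
  have h := integral_averagedOutput_le (B := B) (γ := γ) hg hF hmin hx₀ hs hξ hind
    (w := fun s => stepHat γ s K)
    (fun s s' hss k h1 h2 => stepHat_congr hss γ h1 h2) (by positivity) hi hiB
    (fun x s => fixed_schedule_convex x s hg hv hF hL hc hmin hξ hγ hh hlow hMK hM (by
      refine le_of_eq ?_
      field_simp))
  exact ⟨h.1, h.2.trans (convex_rate hL hσ hM hK hB)⟩

theorem stronglyConvex_case (hM : 1 ≤ M) (hg : IsStochasticGradient D F g) (hL : 0 < L)
    (hF : IsSmooth L F) (hv : HasBoundedVariance D F g σ) (hx₀ : Measurable x₀)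
    (hs : ∀ k, Measurable (s k)) (hξ : IsIIDSample P D ξ)
    (hind : DataIndependentOfDelays P x₀ s ξ) (hmin : ∀ x, F xstar ≤ F x)
    {K : ℕ} {B μ : ℝ} (hMK : M ≤ K) (hμ : 0 < μ) (hc : StrongConvexOn Set.univ μ F)
    (hi : Integrable (fun ω => ‖x₀ ω - xstar‖ ^ 2) P)
    (hiB : ∫ ω, ‖x₀ ω - xstar‖ ^ 2 ∂P ≤ B ^ 2) :
    Integrable (fun ω => F (stronglyConvexOutput μ g (stronglyConvexStep M K L σ B μ)
        x₀ s ξ K ω) - F xstar) P ∧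
      ∫ ω, (F (stronglyConvexOutput μ g (stronglyConvexStep M K L σ B μ) x₀ s ξ K ω) -
        F xstar) ∂P ≤
        400000 * (M * L * B ^ 2 * Real.exp (-(1 / 256 * K * μ) / (M * L)) +
            σ ^ 2 / (μ * K) * Real.log (Real.exp 1 + μ ^ 2 * K ^ 2 * B ^ 2 / σ ^ 2)) := by
  have hK : 1 ≤ K := hM.trans hMK
  have hM' : (0 : ℝ) < M := by exact_mod_cast hM
  have hK' : (0 : ℝ) < K := by exact_mod_cast hK
  -- In dimension 0 strong convexity gives no relation between μ and L, but there is nothing to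
  -- prove.
  rcases subsingleton_or_nontrivial (EuclideanSpace ℝ (Fin d)) with hE | hE
  · have h0 : ∀ x, F x - F xstar = 0 := fun x => by rw [Subsingleton.elim x xstar, sub_self]
    simp_rw [h0]
    refine ⟨integrable_zero _ _ _, ?_⟩
    have := one_le_log_exp_one_add (X := μ ^ 2 * K ^ 2 * B ^ 2 / σ ^ 2) (by positivity)
    rw [integral_zero]
    positivity
  have hμL : μ ≤ L := by
    obtain ⟨v, hv0⟩ := exists_ne (0 : EuclideanSpace ℝ (Fin d))
    exact le_of_mul_le_mul_right (hF.mul_norm_sq_le hc v) (by positivity)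
  have hb : (0 : ℝ) < 1 / (8 * M * L) := by positivity
  have hη := stronglyConvexCap_pos (M := M) (σ := σ) (B := B) hL hM hK hμ
  have hγ := isAdaptiveStep_delayStep (M := M) (μ := μ) hL hb hη (by
    rw [mul_one_div]
    gcongr
    norm_num)
  -- Since μ ≤ L, exp(-μ/L) ≥ 1/e ≥ 1/4, which is exactly the cap times 2ML.
  have hlow := delayStep_lower hL hM hμ.le hb hη (by
    have h1 : 1 / (8 * M * L) * (2 * M * L) = (1 / 4 : ℝ) := by
      field_simp
      norm_num
    have h2 : Real.exp (-1) ≤ Real.exp (-(μ / L)) :=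
      Real.exp_le_exp.2 (neg_le_neg ((div_le_one hL).2 hμL))
    have h3 : (1 / 4 : ℝ) ≤ Real.exp (-1) := by
      rw [Real.exp_neg, one_div]
      exact inv_anti₀ (Real.exp_pos 1) (by linarith [Real.exp_one_lt_d9])
    linarith)
  rw [stronglyConvexStep_eq]
  set γ := delayStep M L μ (1 / (8 * M * L)) (stronglyConvexCap M K L σ B μ)
  have hh := lt_min hb hη
  have h := integral_averagedOutput_le (B := B) (γ := γ) hg hF hmin hx₀ hs hξ hind
    (w := fun s => expWeight μ γ s K)
    (fun s s' hss k h1 h2 => expWeight_congr hss μ γ h1 h2) (by positivity) hi hiB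
    (fun x s => fixed_schedule_stronglyConvex x s hg hv hF hL hμ hc hmin hξ hγ hh hlow hMK hM (by
      refine le_of_eq ?_
      field_simp))
  exact ⟨h.1, h.2.trans (stronglyConvex_rate hL hM hK hμ)⟩

theorem nonconvex_case (hM : 1 ≤ M) (hg : IsStochasticGradient D F g) (hL : 0 < L)
    (hF : IsSmooth L F) (hv : HasBoundedVariance D F g σ) (hx₀ : Measurable x₀)
    (hs : ∀ k, Measurable (s k)) (hξ : IsIIDSample P D ξ)
    (hind : DataIndependentOfDelays P x₀ s ξ) (hmin : ∀ x, F xstar ≤ F x)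
    {K : ℕ} {Δ : ℝ} {κ : Ω → ℕ} (hMK : M ≤ K) (hΔ : 0 < Δ)
    (hi : Integrable (fun ω => F (x₀ ω)) P) (hiΔ : ∫ ω, F (x₀ ω) ∂P - F xstar ≤ Δ)
    (hκ : IsRandomIndex P x₀ s ξ
      (fun ω => stepHat (nonconvexStep M K L σ Δ) (fun j => s j ω) K) K κ) :
    Integrable (fun ω =>
        ‖gradient F (run g (nonconvexStep M K L σ Δ) x₀ s ξ ω (κ ω))‖ ^ 2) P ∧
      ∫ ω, ‖gradient F (run g (nonconvexStep M K L σ Δ) x₀ s ξ ω (κ ω))‖ ^ 2 ∂P ≤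
        256 * (M * L * Δ / K + √(L * Δ * σ ^ 2 / K)) := by
  have hK : 1 ≤ K := hM.trans hMK
  have hM' : (0 : ℝ) < M := by exact_mod_cast hM
  have hK' : (0 : ℝ) < K := by exact_mod_cast hK
  have hb : (0 : ℝ) < 1 / (2 * M * L) := by positivity
  have hη := nonconvexCap_pos (M := M) (σ := σ) hL hM hK hΔ
  have hγ := isAdaptiveStep_delayStep (M := M) (μ := 0) hL hb hη (by simp)
  have hlow := delayStep_lower hL hM le_rfl hb hη (by
    rw [zero_div, neg_zero, Real.exp_zero, div_mul_cancel₀ _ (by positivity)])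
  rw [nonconvexStep_eq] at hκ ⊢
  have hrate := nonconvex_rate (σ := σ) hL hM hK hΔ
  set γ := delayStep M L 0 (1 / (2 * M * L)) (nonconvexCap M K L σ Δ)
  have hh := lt_min hb hη
  set h := min (1 / (2 * M * L)) (nonconvexCap M K L σ Δ)
  have hmeas : ∀ (s : ℕ → Fin M) k, Measurable
      (fun a : EuclideanSpace ℝ (Fin d) × (ℕ → Fin M → Ξ) =>
        ‖gradient F (iterate g γ a.1 s a.2 k)‖ ^ 2) := fun s k =>
    ((hF.continuous_gradient.measurable.comp
      (measurable_iterate_of_schedule hg γ s k)).norm).pow_const 2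
  have hcongr : ∀ (a : EuclideanSpace ℝ (Fin d) × (ℕ → Fin M → Ξ)) (s s' : ℕ → Fin M),
      (∀ j, 1 ≤ j → j ≤ K → s j = s' j) → ∀ k ≤ K,
      ‖gradient F (iterate g γ a.1 s a.2 k)‖ ^ 2 =
        ‖gradient F (iterate g γ a.1 s' a.2 k)‖ ^ 2 := fun a s s' hss k hk => by
    rw [iterate_congr hss g γ a.1 a.2 hk]
  have hp0 : ∀ (s : ℕ → Fin M) k,
      0 ≤ stepHat γ s K k / ∑ j ∈ Finset.Icc 1 K, stepHat γ s K j := fun s k =>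
    div_nonneg (hγ.stepHat_pos s K k).le (Finset.sum_nonneg fun j _ => (hγ.stepHat_pos s K j).le)
  have hav := integral_le_of_fixed_schedule hx₀ hs hξ.measurable hind (K := K)
    (Φ := fun a s => ∑ k ∈ Finset.Icc 1 K,
      stepHat γ s K k / (∑ j ∈ Finset.Icc 1 K, stepHat γ s K j) *
        ‖gradient F (iterate g γ a.1 s a.2 k)‖ ^ 2)
    (C := fun x => 128 / (h * K) * (F x - F xstar) + 102 * L * σ ^ 2 * h)
    (fun a s s' hss => by
      have h1 : ∀ k ∈ Finset.Icc 1 K, stepHat γ s K k = stepHat γ s' K k := fun k hk =>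
        stepHat_congr hss γ (Finset.mem_Icc.1 hk).1 (Finset.mem_Icc.1 hk).2
      rw [Finset.sum_congr rfl h1]
      refine Finset.sum_congr rfl fun k hk => ?_
      rw [h1 k hk, hcongr a s s' hss k (Finset.mem_Icc.1 hk).2])
    (fun s => Finset.measurable_sum _ fun k _ => (hmeas s k).const_mul _)
    (fun a s => Finset.sum_nonneg fun k _ => mul_nonneg (hp0 s k) (sq_nonneg _))
    (((hF.1.continuous.measurable.sub_const _).const_mul _).add_const _)
    (((hi.sub (integrable_const _)).const_mul _).add (integrable_const _))
    (fun x s => fixed_schedule_nonconvex x s hg hv hF hL hmin hξ hγ hh hlow hMK hM (by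
      refine le_of_eq ?_
      field_simp))
  -- The gradient norms are determined by the run, so the random index can be replaced by its
  -- conditional weights.
  have hidx := integral_random_index (runSigma_le hx₀ hs hξ.measurable) hκ.measurable hκ.mem
    (p := fun ω k => stepHat γ (fun j => s j ω) K k /
      ∑ j ∈ Finset.Icc 1 K, stepHat γ (fun j => s j ω) K j)
    (fun ω k _ => hp0 _ k) hκ.condProb
    (G := fun k ω => ‖gradient F (run g γ x₀ s ξ ω k)‖ ^ 2)
    (fun k hk => measurable_runSigma (K := K)
      (Φ := fun a s => ‖gradient F (iterate g γ a.1 s a.2 k)‖ ^ 2)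
      (fun a s s' hss => hcongr a s s' hss k (Finset.mem_Icc.1 hk).2) fun s => hmeas s k)
    (fun k ω => sq_nonneg _) hav.1
  refine ⟨hidx.1, hidx.2.le.trans (hav.2.trans (le_trans ?_ hrate))⟩
  have h1 : Integrable (fun ω => 128 / (h * K) * (F (x₀ ω) - F xstar)) P :=
    (hi.sub (integrable_const _)).const_mul _
  rw [integral_add h1 (integrable_const _), integral_const_mul,
    integral_sub hi (integrable_const _), integral_const, integral_const, probReal_univ,
    one_smul, one_smul]
  gcongr

end Rates

end AsyncSGD

theorem theorem3 :
    ∃ c₁ c₂ c₃ c₄ : ℝ, 0 < c₁ ∧ 0 < c₂ ∧ 0 < c₃ ∧ 0 < c₄ ∧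
    ∀ (d M : ℕ) (Ω Ξ : Type*) [MeasurableSpace Ω] [MeasurableSpace Ξ]
      (P : Measure Ω) [IsProbabilityMeasure P] (D : Measure Ξ) [IsProbabilityMeasure D]
      -- the loss, the objective `F(x) = E f(x; ξ)`, and the stochastic gradients `∇f(x; ξ)`
      (f : EuclideanSpace ℝ (Fin d) → Ξ → ℝ) (F : EuclideanSpace ℝ (Fin d) → ℝ)
      (g : EuclideanSpace ℝ (Fin d) → Ξ → EuclideanSpace ℝ (Fin d)) (L σ : ℝ)
      -- the initial point, the arrival schedule, and the samples
      (x₀ : Ω → EuclideanSpace ℝ (Fin d)) (s : ℕ → Ω → Fin M) (ξ : ℕ → Fin M → Ω → Ξ)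
      (xstar : EuclideanSpace ℝ (Fin d)),
      (∀ x, Integrable (f x) D ∧ F x = ∫ z, f x z ∂D) →
      AsyncSGD.IsStochasticGradient D F g →
      0 < L → AsyncSGD.IsSmooth L F →
      0 ≤ σ → AsyncSGD.HasBoundedVariance D F g σ →
      Measurable x₀ → (∀ k, Measurable (s k)) → AsyncSGD.IsIIDSample P D ξ →
      AsyncSGD.DataIndependentOfDelays P x₀ s ξ →
      (∀ x, F xstar ≤ F x) →
      -- convex case
      (∀ (K : ℕ) (B : ℝ), M ≤ K → ConvexOn ℝ Set.univ F → 0 < B →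
        Integrable (fun ω => ‖x₀ ω - xstar‖ ^ 2) P → ∫ ω, ‖x₀ ω - xstar‖ ^ 2 ∂P ≤ B ^ 2 →
        Integrable (fun ω => F (AsyncSGD.convexOutput g (AsyncSGD.convexStep M K L σ B)
          x₀ s ξ K ω) - F xstar) P ∧
        ∫ ω, (F (AsyncSGD.convexOutput g (AsyncSGD.convexStep M K L σ B)
          x₀ s ξ K ω) - F xstar) ∂P ≤ c₁ * (M * L * B ^ 2 / K + σ * B / √K)) ∧
      -- strongly convex case
      (∀ (K : ℕ) (B μ : ℝ), 3 * M ≤ K → 0 < μ → StrongConvexOn Set.univ μ F → 0 ≤ B →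
        Integrable (fun ω => ‖x₀ ω - xstar‖ ^ 2) P → ∫ ω, ‖x₀ ω - xstar‖ ^ 2 ∂P ≤ B ^ 2 →
        Integrable (fun ω => F (AsyncSGD.stronglyConvexOutput μ g
          (AsyncSGD.stronglyConvexStep M K L σ B μ) x₀ s ξ K ω) - F xstar) P ∧
        ∫ ω, (F (AsyncSGD.stronglyConvexOutput μ g
          (AsyncSGD.stronglyConvexStep M K L σ B μ) x₀ s ξ K ω) - F xstar) ∂P ≤
          c₂ * (M * L * B ^ 2 * Real.exp (-(c₃ * K * μ) / (M * L)) +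
            σ ^ 2 / (μ * K) * Real.log (Real.exp 1 + μ ^ 2 * K ^ 2 * B ^ 2 / σ ^ 2))) ∧
      -- general, possibly non-convex case
      (∀ (K : ℕ) (Δ : ℝ) (κ : Ω → ℕ), M ≤ K → 0 < Δ →
        Integrable (fun ω => F (x₀ ω)) P → ∫ ω, F (x₀ ω) ∂P - F xstar ≤ Δ →
        AsyncSGD.IsRandomIndex P x₀ s ξ
          (fun ω => AsyncSGD.stepHat (AsyncSGD.nonconvexStep M K L σ Δ) (fun j => s j ω) K) K κ →
        Integrable (fun ω => ‖gradient F
          (AsyncSGD.run g (AsyncSGD.nonconvexStep M K L σ Δ) x₀ s ξ ω (κ ω))‖ ^ 2) P ∧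
        ∫ ω, ‖gradient F
          (AsyncSGD.run g (AsyncSGD.nonconvexStep M K L σ Δ) x₀ s ξ ω (κ ω))‖ ^ 2 ∂P ≤
          c₄ * (M * L * Δ / K + √(L * Δ * σ ^ 2 / K))) := by

  refine ⟨64, 400000, 1 / 256, 256, by norm_num, by norm_num, by norm_num, by norm_num, ?_⟩
  intro d M Ω Ξ _ _ P _ D _ f F g L σ x₀ s ξ xstar _ hg hL hF hσ hv hx₀ hs hξ hind hmin
  obtain ⟨ω₀⟩ : Nonempty Ω := nonempty_of_isProbabilityMeasure P
  -- A schedule on a nonempty probability space provides at least one worker.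
  have hM : 1 ≤ M := Fin.pos (s 0 ω₀)
  refine ⟨?_, ?_, ?_⟩
  · intro K B hMK hc hB hi hiB
    exact AsyncSGD.convex_case hM hg hL hF hσ hv hx₀ hs hξ hind hmin hMK hc hB hi hiB
  · intro K B μ hMK hμ hc _ hi hiB
    exact AsyncSGD.stronglyConvex_case hM hg hL hF hv hx₀ hs hξ hind hmin (by omega) hμ hc hi hiB
  · intro K Δ κ hMK hΔ hi hiΔ hκ
    exact AsyncSGD.nonconvex_case hM hg hL hF hv hx₀ hs hξ hind hmin hMK hΔ hi hiΔ hκ
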